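/- Let $G=(V,E)$ be a connected simple unweighted graph with $n$ vertices, let $L(G)$ be its Laplacian, $\mathbf P$ the transition matrix of its simple random walk, and $\rho=\lceil\sqrt n\rceil$. For $S\subseteq V$ nonempty, $\textsc{Schur}(G,S)$ is the weighted graph on $S$ with Laplacian $L(G)_{SS}-L(G)_{S\bar S}L(G)_{\bar S\bar S}^{-1}L(G)_{\bar SS}$; $\mathbf Q_S[u,v]$ is the probability that the simple random walk on $G$ from $u$ is at $v$ immediately before its first visit to $S$ at a positive time (the transition matrix of $\textsc{ShortCut}(G,S)$); and $\deg_S(u)$ is the number of neighbours of $u$ in $S$. **Matching sampler of error $\delta$.** A randomized procedure that, for every nonnegative square matrix $A$ of edge weights of a complete bipartite graph, returns a perfect matching; whenever some perfect matching has positive weight (product of its edge weights), its output is within total variation distance $\delta$ of the distribution proportional to the weight. **Walk of a phase** (transition matrix $\mathbf M$, start $w_0$, target length $\ell=2^r$). Sample $w_\ell$ from $\mathbf M^\ell[w_0,\cdot]$ and put $W=(w_0,w_\ell)$. For $\delta'=\ell,\ell/2,\dots,2$ do the following. For each pair $(p,q)$ of consecutive entries of $W$ independently draw a midpoint $j$ with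 probability proportional to $\mathbf M^{\delta'/2}[p,j]\,\mathbf M^{\delta'/2}[j,q]$; let $t$ be the position, in $W$ with these midpoints inserted, of the first occurrence of the $\rho$-th distinct vertex (the last position if there are fewer than $\rho$ distinct vertices). Keep only the entries of $W$ and the midpoints up to position $t$. The last of these midpoints keeps its place; of the others only the multiset is retained, and they are assigned to the other gaps by a perfect matching drawn by the matching sampler with weight $\mathbf M^{\delta'/2}[p,j]\,\mathbf M^{\delta'/2}[j,q]$ for midpoint $j$ and gap $(p,q)$. The resulting sequence is the new $W$. The phase fails if a drawn matching has weight $0$, if a distribution to be sampled from has only zero weights, or if the final $W$ has fewer than $\min(\rho,N)$ distinct vertices, where $N$ is the number of vertices of the graph walked on. **Algorithm.** The first phase walks on $G$ (with $\mathbf M=\mathbf P$) from an arbitrary vertex, and for each newly visited vertex records the edge by which the walk first enters it. While there are unvisited vertices, a further phase is run: let $v_f$ be the last vertex of the previous walk and $S$ the set of unvisited vertices together with $v_f$; walk on $\textsc{Schur}(G,S)$ from $v_f$ (with $\mathbf M$ the transition matrix of its random walk); for each vertex $v\ne v_f$ of the walk, whose first occurrence is preceded by $w$, draw a neighbour $u$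 of $v$ in $G$ with probability proportional to $\mathbf Q_S[w,u]/\deg_S(u)$ and record the edge $uv$. The output is the graph on $V$ formed by the recorded edges; if some phase fails, the output is an arbitrary fixed spanning tree $T_0$ of $G$. All arithmetic is exact. **Theorem.** There is an absolute constant $B_0>0$ such that for all $c_1,\kappa>0$ there is $A_0>0$ such that for all $A\ge A_0$ and $B\ge B_0$ there is $D>0$ with the following property. Let $G$ be any connected simple graph, with $n$ vertices, let the start vertex and the spanning tree $T_0$ be arbitrary, let $\epsilon\ge\kappa n^{-c_1}$, let $\ell$ be $B n^3\log c_2$ with $c_2=A n^{1/2+c_1}$, rounded up to a power of $2$, and let the matching sampler have error $\delta$ with $D\sqrt n\,\log n\cdot\delta\le\epsilon$. Then the output of the algorithm is always a spanning tree of $G$, and its distribution is within total variation distance $\epsilon$ of the uniform distribution on the spanning trees of $G$. -/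

import Mathlib

open scoped NNReal ENNReal

universe u v

noncomputable section

open scoped Classical

namespace SpanningTreeSampler

/-! ### Discrete distributions -/

/-- Total variation distance of two discrete distributions. -/
def tvDist {α : Type u} (p q : PMF α) : ℝ :=
  (∑' a, |(p a).toReal - (q a).toReal|) / 2

/-- The distribution on a finite type that is proportional to the weights `w`. -/
def proportional {α : Type u} [Fintype α] (w : α → ℝ≥0) (h : ∑ a, w a ≠ 0) : PMF α :=
  PMF.normalize (fun a => (w a : ℝ≥0∞))
    (by
      rw [tsum_fintype, ← ENNReal.ofNNReal_finsetSum]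
      exact_mod_cast h)
    (by
      rw [tsum_fintype, ← ENNReal.ofNNReal_finsetSum]
      exact ENNReal.coe_ne_top)

/-- Sequencing of two random experiments, each of which may fail (`none`). -/
def andThen {α : Type u} {β : Type v} (p : PMF (Option α)) (f : α → PMF (Option β)) :
    PMF (Option β) :=
  p.bind fun o => o.elim (PMF.pure none) f

/-- Sampling from an unnormalized distribution; it fails if all the weights vanish. -/
def sampleWeighted {α : Type u} [Fintype α] (w : α → ℝ≥0) : PMF (Option α) :=
  if h : ∑ a, w a ≠ 0 then (proportional w h).map some else PMF.pure none

/-! ### Approximate sampling of weighted perfect matchings -/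

/-- The weight of the perfect matching `i ↦ σ i` of the complete bipartite graph on
`Fin k ⊔ Fin k` whose edge `(i, j)` has weight `A i j`. -/
def matchingWeight {k : ℕ} (A : Matrix (Fin k) (Fin k) ℝ≥0) (σ : Equiv.Perm (Fin k)) : ℝ≥0 :=
  ∏ i, A i (σ i)

/-- A randomized procedure that, given the biadjacency matrix of a weighted complete bipartite
graph, returns a perfect matching. -/
def MatchingSampler : Type :=
  ∀ k : ℕ, Matrix (Fin k) (Fin k) ℝ≥0 → PMF (Equiv.Perm (Fin k))

/-- On each input that has a perfect matching of positive weight, the output is within total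
variation distance `δ` of the distribution proportional to the weight of the matching. -/
def MatchingSampler.ErrorAtMost (sampler : MatchingSampler) (δ : ℝ) : Prop :=
  ∀ (k : ℕ) (A : Matrix (Fin k) (Fin k) ℝ≥0) (h : ∑ σ, matchingWeight A σ ≠ 0),
    tvDist (sampler k A) (proportional (matchingWeight A) h) ≤ δ

/-! ### Top-down sampling of a truncated random walk

`X` is the vertex set of the graph walked on and `M` is the transition matrix. A partial walk
`w_0, w_δ, w_{2δ}, …` is stored as the list of its known vertices. -/

section Walk

variable {X : Type u} [Fintype X]

/-- The unnormalized probability of `j` as the midpoint of the gap `g = (p, q)`, where `H` is the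
transition matrix over half the gap. -/
def midpointWeight (H : Matrix X X ℝ≥0) (g : X × X) (j : X) : ℝ≥0 :=
  H g.1 j * H j g.2

/-- Independent midpoints for all the gaps in a list of gaps, in chronological order. -/
def sampleMidpoints (H : Matrix X X ℝ≥0) : List (X × X) → PMF (Option (List X))
  | [] => PMF.pure (some [])
  | g :: gs =>
    andThen (sampleWeighted (midpointWeight H g)) fun j =>
      andThen (sampleMidpoints H gs) fun ms => PMF.pure (some (j :: ms))

/-- `interleave [x₀, x₁, …] [m₁, m₂, …] = [x₀, m₁, x₁, m₂, …]`. -/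
def interleave : List X → List X → List X
  | x :: xs, m :: ms => x :: m :: interleave xs ms
  | xs, [] => xs
  | [], _ => []

/-- The number of entries of the walk `z` up to and including the first occurrence of its
`ρ`-th distinct vertex; the full length of `z` if there are fewer than `ρ` distinct vertices. -/
def truncLength (ρ : ℕ) (z : List X) : ℕ :=
  min z.length
    ((List.range z.length).findIdx (fun i => decide (ρ ≤ (z.take (i + 1)).toFinset.card)) + 1)

/-- The weights for placing the midpoints `L` (rows) into the gaps `gs` (columns). In its use below
`L` and `gs` both have at least `k` entries, so that the default values `d` play no role. -/
def placementWeights (H : Matrix X X ℝ≥0) (L : List X) (gs : List (X × X)) (d : X) (k : ℕ) :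
    Matrix (Fin k) (Fin k) ℝ≥0 :=
  fun i j => midpointWeight H (gs.getD j (d, d)) (L.getD i d)

/-- One level of the distributed algorithm, which refines the partial walk `W`. Midpoints `ms` are
drawn for all the gaps, and the length `N` at which the walk filled in with `ms` has to be truncated
is found. It contains the first `K = N / 2` midpoints. Of these, the leader learns the last one, `mf`,
which keeps its place, and the multiset of the other ones. Those are put into the first `K - 1` gaps
according to a sampled perfect matching. (The leader's labelling `L` of the midpoints depends on
their multiset only.) The level fails if that matching has weight zero. -/
def level (sampler : MatchingSampler) (ρ : ℕ) (H : Matrix X X ℝ≥0) (W : List X) :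
    PMF (Option (List X)) :=
  let gs : List (X × X) := W.zip W.tail
  andThen (sampleMidpoints H gs) fun ms =>
    let N := truncLength ρ (interleave W ms)
    let K := N / 2
    let W' := W.take (N - K)
    match (ms.take K).getLast? with
    | none => PMF.pure (some W')
    | some mf =>
      let L : List X := Multiset.toList (↑(ms.take (K - 1)) : Multiset X)
      let A := placementWeights H L gs mf (K - 1)
      (sampler (K - 1) A).bind fun σ =>
        if matchingWeight A σ = 0 then PMF.pure none
        else PMF.pure (some (interleave W' (List.ofFn (fun j => L.getD (σ.symm j) mf) ++ [mf])))

/-- The last `r` levels: the entries of `W` are `2 ^ r` steps apart. -/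
def fillLevels (sampler : MatchingSampler) (ρ : ℕ) (M : Matrix X X ℝ≥0) :
    ℕ → List X → PMF (Option (List X))
  | 0, W => PMF.pure (some W)
  | r + 1, W => andThen (level sampler ρ (M ^ 2 ^ r) W) (fillLevels sampler ρ M r)

/-- The walk from `x₀` with target length `2 ^ r`, truncated at its `ρ`-th distinct vertex. First
its end vertex is sampled, then it is filled in level by level. The walk fails if it does not visit
`ρ` distinct vertices (all the vertices, if there are fewer than `ρ`). -/
def phaseWalk (sampler : MatchingSampler) (ρ r : ℕ) (M : Matrix X X ℝ≥0) (x₀ : X) :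
    PMF (Option (List X)) :=
  andThen (sampleWeighted fun x => (M ^ 2 ^ r) x₀ x) fun x =>
    andThen (fillLevels sampler ρ M r [x₀, x]) fun W =>
      if min ρ (Fintype.card X) ≤ W.toFinset.card then PMF.pure (some W) else PMF.pure none

end Walk

/-! ### The Schur complement graph and the shortcut graph -/

section Graph

variable {V : Type u} [Fintype V]

/-- The transition matrix of the random walk on a weighted graph. -/
def transition {X : Type u} [Fintype X] (w : X → X → ℝ≥0) : Matrix X X ℝ≥0 :=
  fun x y => w x y / ∑ z, w x z

/-- The transition matrix of the simple random walk on `G`. -/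
def simpleWalk (G : SimpleGraph V) : Matrix V V ℝ≥0 :=
  transition fun x y => if G.Adj x y then 1 else 0

/-- The Schur complement of the matrix `M` onto the index set `S`. -/
def schurComplement (M : Matrix V V ℝ) (S : Finset V) : Matrix S S ℝ :=
  M.toBlock (· ∈ S) (· ∈ S) -
    M.toBlock (· ∈ S) (· ∉ S) * (M.toBlock (· ∉ S) (· ∉ S))⁻¹ * M.toBlock (· ∉ S) (· ∈ S)

/-- The edge weights of the graph on `S` whose Laplacian is the Schur complement of the Laplacian
of `G` onto `S`. -/
def schurWeight (G : SimpleGraph V) (S : Finset V) (x y : S) : ℝ≥0 :=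
  if x = y then 0 else Real.toNNReal (-schurComplement (G.lapMatrix ℝ) S x y)

/-- The probability that the simple random walk `x_0 = a, x_1, x_2, …` on `G` is at `b` immediately
before its first visit to `S` at a positive time `j`, as a sum over `j = k + 1` and over the possible
initial segments `x_0, …, x_{k+1}` of the walk. -/
def shortcut (G : SimpleGraph V) (S : Finset V) (a b : V) : ℝ≥0 :=
  (∑' k : ℕ, ∑ x : Fin (k + 2) → V,
    if x 0 = a ∧ (∀ i : Fin (k + 2), 0 < (i : ℕ) → (i : ℕ) < k + 1 → x i ∉ S) ∧
        x (Fin.last k).castSucc = b ∧ x (Fin.last (k + 1)) ∈ S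
    then ((∏ i : Fin (k + 1), simpleWalk G (x i.castSucc) (x i.succ) : ℝ≥0) : ℝ≥0∞)
    else 0).toNNReal

/-- The number of neighbours of `a` in `S`. -/
def degInto (G : SimpleGraph V) (S : Finset V) (a : V) : ℕ :=
  (S.filter fun b => G.Adj a b).card

/-! ### The phases -/

/-- The pairs `(w_{i-1}, w_i)` such that `w_i` is visited for the first time at time `i`, where the
vertices in `seen` count as visited before. -/
def firstVisits : Finset V → List V → List (V × V)
  | seen, p :: q :: l =>
    if q ∈ seen then firstVisits seen (q :: l)
    else (p, q) :: firstVisits (insert q seen) (q :: l)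
  | _, _ => []

/-- For each pair `(p, b)` of `l`, a neighbour `a` of `b` is drawn with probability proportional to
`shortcut G S p a / degInto G S a`, and the edge `ab` is recorded. -/
def sampleEdges (G : SimpleGraph V) (S : Finset V) : List (V × V) → PMF (Option (Finset (Sym2 V)))
  | [] => PMF.pure (some ∅)
  | (p, b) :: l =>
    andThen
      (sampleWeighted fun a => if G.Adj a b then shortcut G S p a * (1 / degInto G S a) else 0)
      fun a => andThen (sampleEdges G S l) fun E => PMF.pure (some (insert s(a, b) E))

/-- What is known after some phases: the vertices visited by the walks, the last vertex of the most
recent walk, and the first-visit edges. -/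
structure PhaseState (V : Type u) where
  visited : Finset V
  current : V
  edges : Finset (Sym2 V)

/-- The first phase walks on `G` itself, so that the first-visit edges can be read off. -/
def firstPhase (sampler : MatchingSampler) (ρ r : ℕ) (G : SimpleGraph V) (w₀ : V) :
    PMF (Option (PhaseState V)) :=
  andThen (phaseWalk sampler ρ r (simpleWalk G) w₀) fun W =>
    PMF.pure (some
      { visited := W.toFinset
        current := W.getLastD w₀
        edges := ((firstVisits {w₀} W).map fun e => s(e.1, e.2)).toFinset })

/-- The vertices that have not been visited, and the current vertex. -/
def activeSet (s : PhaseState V) : Finset V :=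
  insert s.current s.visitedᶜ

/-- A later phase walks on the Schur complement graph onto the active set and samples the first-visit
edges by means of the shortcut graph. -/
def laterPhase (sampler : MatchingSampler) (ρ r : ℕ) (G : SimpleGraph V) (s : PhaseState V) :
    PMF (Option (PhaseState V)) :=
  andThen
    (phaseWalk sampler ρ r (transition (schurWeight G (activeSet s)))
      ⟨s.current, Finset.mem_insert_self _ _⟩)
    fun W₀ =>
      let W : List V := W₀.map Subtype.val
      andThen (sampleEdges G (activeSet s) (firstVisits {s.current} W)) fun E =>
        PMF.pure (some
          { visited := s.visited ∪ W.toFinset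
            current := W.getLastD s.current
            edges := s.edges ∪ E })

/-- Later phases are run until all the vertices have been visited, at most `fuel` of them. (If
`2 ≤ ρ`, each phase that does not fail visits a new vertex, so `Fintype.card V` phases suffice.) -/
def laterPhases (sampler : MatchingSampler) (ρ r : ℕ) (G : SimpleGraph V) :
    ℕ → PhaseState V → PMF (Option (Finset (Sym2 V)))
  | 0, s => if s.visited = Finset.univ then PMF.pure (some s.edges) else PMF.pure none
  | fuel + 1, s =>
    if s.visited = Finset.univ then PMF.pure (some s.edges)
    else andThen (laterPhase sampler ρ r G s) (laterPhases sampler ρ r G fuel)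

/-- The output distribution of the algorithm: the graph formed by the first-visit edges, or the
given graph `T₀` if some phase has failed. Here `ρ = ⌈√n⌉`, the walks have target length `2 ^ r`, and
the first one starts at `w₀`. -/
def treeSampler (sampler : MatchingSampler) (r : ℕ) (G : SimpleGraph V) (w₀ : V)
    (T₀ : SimpleGraph V) : PMF (SimpleGraph V) :=
  let ρ := ⌈√(Fintype.card V : ℝ)⌉₊
  (andThen (firstPhase sampler ρ r G w₀)
    (laterPhases sampler ρ r G (Fintype.card V))).map
      fun o => o.elim T₀ fun E => SimpleGraph.fromEdgeSet (E : Set (Sym2 V))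

/-! ### Spanning trees and parameters -/

/-- `T` is a spanning tree of `G`. -/
def IsSpanningTree (G T : SimpleGraph V) : Prop :=
  T ≤ G ∧ T.IsTree

/-- The uniform distribution on the spanning trees of a connected graph. -/
def uniformSpanningTree (G : SimpleGraph V) (hG : G.Connected) : PMF (SimpleGraph V) :=
  PMF.uniformOfFinset (Finset.univ.filter (IsSpanningTree G))
    (by
      obtain ⟨T, hT, hT'⟩ := hG.exists_isTree_le
      exact ⟨T, by simp [IsSpanningTree, hT, hT']⟩)

/-- The base-two logarithm of the target length: `B n³ log c₂`, where `c₂ = A n^(1/2 + c₁)`, is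
rounded up to a power of two. -/
def logTargetLength (A B c₁ : ℝ) (n : ℕ) : ℕ :=
  Nat.clog 2 ⌈B * (n : ℝ) ^ 3 * Real.log (A * (n : ℝ) ^ (1 / 2 + c₁))⌉₊

end Graph

end SpanningTreeSampler

end

open SpanningTreeSampler

/-! Total variation is handled through test functions: by `tvDist_le_of_expect_le` it suffices that,
for every `f` with values in `[0, 1]`, the expectation of `f` at the output exceeds its uniform
average by at most `ε`. Hence only upper bounds are needed, and a bad event may be charged its
probability.

Let `Ψ U x E` be the expectation of `f` at the tree that arises if the simple random walk on `G` is
continued from `x`, with visited set `U` and recorded edges `E`, until it has visited everything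
(`treeValue`). It is harmonic for the walk that records its first-visit edges, and it equals `f` of
the recorded graph once all vertices are visited. The algorithm is followed along `Ψ`.

Initially `Ψ` is at most the uniform average of `f`. This is half of the Aldous-Broder theorem: each
tree is the first-visit tree with probability at most one over the number of spanning trees
(`treeCount_mul_treeProb_le_one`). Read backwards, the walk moves the root of a spanning tree, and
by `moveRoot_inj` the uniform measure on rooted trees is not increased by this (`moveCount_le_one`).
The other half is not needed, because both laws have mass one and the output is always a spanning
tree.

An ideal phase does not increase the expectation of `Ψ`. A step from `p` on the Schur complement
graph, with its drawn neighbour, describes the simple walk from `p` up to its first entrance into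
`S` away from `p`, with the last edge used; on the way only visited vertices are met. Both laws are
expressed by one Green function (`IsGreen`), and Green's identity yields `schur_step_le`. Optional
stopping is `pathExpect_walkValue_le`.

An actual phase deviates from the ideal one in two ways. Each of its `r` levels costs `δ`
(`expect_level_le`): independent midpoints reproduce the chain exactly, the truncation length
ignores the order of the earlier midpoints, and given their multiset the order has the law of the
weighted random matching. Moreover the walk may fail to cover, but all hitting times are at most `2
n³`, on `G` (`exists_hittingTime`) and on every Schur complement graph (`hittingBound_schur`), so
this is improbable. At most `4√n` phases with `O(log n)` levels each give the bound. -/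

noncomputable section

open scoped Classical

namespace SpanningTreeSampler

/-! ### Expectations -/

section Expectation

variable {α : Type u} {β : Type v}

/-- The expectation of a nonnegative function under a discrete distribution. -/
def expect (p : PMF α) (f : α → ℝ≥0∞) : ℝ≥0∞ :=
  ∑' a, p a * f a

lemma expect_pure (a : α) (f : α → ℝ≥0∞) : expect (PMF.pure a) f = f a := by
  unfold expect
  rw [tsum_eq_single a]
  · simp
  · intro b hb
    simp [PMF.pure_apply_of_ne _ _ hb]

lemma expect_bind (p : PMF α) (g : α → PMF β) (f : β → ℝ≥0∞) :
    expect (p.bind g) f = expect p fun a => expect (g a) f := by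
  unfold expect
  simp_rw [PMF.bind_apply, ← ENNReal.tsum_mul_right, ← ENNReal.tsum_mul_left]
  rw [ENNReal.tsum_comm]
  simp_rw [mul_assoc]

lemma expect_map (p : PMF α) (g : α → β) (f : β → ℝ≥0∞) :
    expect (p.map g) f = expect p fun a => f (g a) := by
  rw [PMF.map, expect_bind]
  simp [expect_pure]

lemma expect_mono {p : PMF α} {f g : α → ℝ≥0∞} (h : ∀ a, f a ≤ g a) : expect p f ≤ expect p g :=
  ENNReal.tsum_le_tsum fun a => mul_le_mul_right (h a) _

lemma expect_mono_on {p : PMF α} {f g : α → ℝ≥0∞} (h : ∀ a ∈ p.support, f a ≤ g a) :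
    expect p f ≤ expect p g := by
  refine ENNReal.tsum_le_tsum fun a => ?_
  by_cases ha : p a = 0
  · simp [ha]
  · exact mul_le_mul_right (h a ((p.mem_support_iff a).2 ha)) _

lemma expect_const (p : PMF α) (c : ℝ≥0∞) : expect p (fun _ => c) = c := by
  unfold expect
  rw [ENNReal.tsum_mul_right, p.tsum_coe, one_mul]

lemma expect_add (p : PMF α) (f g : α → ℝ≥0∞) :
    expect p (fun a => f a + g a) = expect p f + expect p g := by
  unfold expect
  simp_rw [mul_add]
  exact ENNReal.tsum_add

lemma expect_le_one {p : PMF α} {f : α → ℝ≥0∞} (h : ∀ a, f a ≤ 1) : expect p f ≤ 1 :=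
  (expect_mono h).trans (expect_const p 1).le

lemma expect_fintype [Fintype α] (p : PMF α) (f : α → ℝ≥0∞) : expect p f = ∑ a, p a * f a :=
  tsum_fintype _

lemma expect_andThen (p : PMF (Option α)) (g : α → PMF (Option β)) (f : Option β → ℝ≥0∞) :
    expect (andThen p g) f = expect p fun o => o.elim (f none) fun a => expect (g a) f := by
  rw [andThen, expect_bind]
  congr 1
  ext o
  cases o <;> simp [expect_pure]

lemma some_mem_support_andThen {p : PMF (Option α)} {g : α → PMF (Option β)} {b : β} :
    some b ∈ (andThen p g).support ↔ ∃ a, some a ∈ p.support ∧ some b ∈ (g a).support := by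
  rw [andThen, PMF.mem_support_bind_iff]
  constructor
  · rintro ⟨_ | a, ha, hb⟩
    · simp at hb
    · exact ⟨a, ha, hb⟩
  · rintro ⟨a, ha, hb⟩
    exact ⟨some a, ha, hb⟩

lemma proportional_apply [Fintype α] (w : α → ℝ≥0) (h : ∑ a, w a ≠ 0) (a : α) :
    proportional w h a = (w a : ℝ≥0∞) / ∑ b, (w b : ℝ≥0∞) := by
  rw [proportional, PMF.normalize_apply, tsum_fintype, div_eq_mul_inv]

lemma expect_sampleWeighted [Fintype α] {w : α → ℝ≥0} (h : ∑ a, w a ≠ 0)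
    (f : Option α → ℝ≥0∞) :
    expect (sampleWeighted w) f = ∑ a, (w a : ℝ≥0∞) / (∑ b, (w b : ℝ≥0∞)) * f (some a) := by
  rw [sampleWeighted, dif_pos h, expect_map, expect_fintype]
  simp_rw [proportional_apply]

lemma some_mem_support_sampleWeighted [Fintype α] {w : α → ℝ≥0} {a : α}
    (h : some a ∈ (sampleWeighted w).support) : w a ≠ 0 := by
  unfold sampleWeighted at h
  split_ifs at h with h0
  · rw [PMF.mem_support_map_iff] at h
    obtain ⟨b, hb, hba⟩ := h
    obtain rfl : b = a := by simpa using hba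
    rw [PMF.mem_support_iff, proportional_apply] at hb
    intro hw
    simp [hw] at hb
  · simp at h

lemma summable_toReal (p : PMF α) : Summable fun a => (p a).toReal :=
  ENNReal.summable_toReal (by rw [p.tsum_coe]; simp)

lemma tsum_toReal (p : PMF α) : ∑' a, (p a).toReal = 1 := by
  rw [← ENNReal.tsum_toReal_eq (fun a => p.apply_ne_top a), p.tsum_coe, ENNReal.toReal_one]

lemma toReal_expect (p : PMF α) {f : α → ℝ≥0∞} (hf : ∀ a, f a ≤ 1) :
    (expect p f).toReal = ∑' a, (p a).toReal * (f a).toReal := by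
  unfold expect
  rw [ENNReal.tsum_toReal_eq]
  · simp_rw [ENNReal.toReal_mul]
  · intro a
    exact ENNReal.mul_ne_top (p.apply_ne_top a) ((hf a).trans_lt ENNReal.one_lt_top).ne

lemma summable_toReal_mul (p : PMF α) {f : α → ℝ≥0∞} (hf : ∀ a, f a ≤ 1) :
    Summable fun a => (p a).toReal * (f a).toReal := by
  refine Summable.of_nonneg_of_le (fun a => by positivity) (fun a => ?_) (summable_toReal p)
  have : (f a).toReal ≤ 1 := ENNReal.toReal_le_of_le_ofReal zero_le_one (by simpa using hf a)
  exact mul_le_of_le_one_right ENNReal.toReal_nonneg this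

lemma summable_abs_sub (p q : PMF α) : Summable fun a => |(p a).toReal - (q a).toReal| :=
  ((summable_toReal p).sub (summable_toReal q)).abs

lemma tvDist_nonneg (p q : PMF α) : 0 ≤ tvDist p q :=
  div_nonneg (tsum_nonneg fun _ => abs_nonneg _) zero_le_two

/-- The expectations of a test function with values in `[0, 1]` differ by at most the total
variation distance. -/
lemma expect_le_of_tvDist_le {p q : PMF α} {δ : ℝ} (h : tvDist p q ≤ δ) {f : α → ℝ≥0∞}
    (hf : ∀ a, f a ≤ 1) : expect p f ≤ expect q f + ENNReal.ofReal δ := by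
  have hδ : 0 ≤ δ := (tvDist_nonneg p q).trans h
  have hp : expect p f ≠ ⊤ := ((expect_le_one hf).trans_lt ENNReal.one_lt_top).ne
  have hq : expect q f ≠ ⊤ := ((expect_le_one hf).trans_lt ENNReal.one_lt_top).ne
  rw [← ENNReal.ofReal_toReal hp, ← ENNReal.ofReal_toReal hq,
    ← ENNReal.ofReal_add ENNReal.toReal_nonneg hδ]
  refine ENNReal.ofReal_le_ofReal ?_
  rw [toReal_expect p hf, toReal_expect q hf]
  have h1 := summable_toReal_mul p hf
  have h2 := summable_toReal_mul q hf
  have h3 := (summable_toReal p).sub (summable_toReal q)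
  have h4 : ∑' a, ((p a).toReal - (q a).toReal) = 0 := by
    rw [(summable_toReal p).tsum_sub (summable_toReal q), tsum_toReal, tsum_toReal, sub_self]
  -- As `p - q` sums to zero, `f` may be replaced by `f - 1/2`, whose absolute value is at most
  -- `1/2`.
  have h5 : ∑' a, (((p a).toReal * (f a).toReal - (q a).toReal * (f a).toReal)
        - ((p a).toReal - (q a).toReal) / 2)
      ≤ ∑' a, |(p a).toReal - (q a).toReal| / 2 := by
    refine Summable.tsum_le_tsum (fun a => ?_) ((h1.sub h2).sub (h3.div_const 2))
      ((summable_abs_sub p q).div_const 2)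
    have hf1 : (f a).toReal ≤ 1 := ENNReal.toReal_le_of_le_ofReal zero_le_one (by simpa using hf a)
    have hf0 : 0 ≤ (f a).toReal := ENNReal.toReal_nonneg
    rcases abs_cases ((p a).toReal - (q a).toReal) with ⟨h, h'⟩ | ⟨h, h'⟩ <;> rw [h] <;> nlinarith
  rw [(h1.sub h2).tsum_sub (h3.div_const 2), tsum_div_const, h4, h1.tsum_sub h2,
    tsum_div_const] at h5
  unfold tvDist at h
  linarith

/-- The indicator of `q ≤ p` is the extremal test function: it picks the positive part of `p - q`,
which carries half of the `ℓ¹` norm because the total masses agree. -/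
lemma tvDist_le_of_expect_le {p q : PMF α} {ε : ℝ} (hε : 0 ≤ ε)
    (h : ∀ f : α → ℝ≥0∞, (∀ a, f a ≤ 1) → expect p f ≤ expect q f + ENNReal.ofReal ε) :
    tvDist p q ≤ ε := by
  set f : α → ℝ≥0∞ := fun a => if (q a).toReal ≤ (p a).toReal then 1 else 0 with hfdef
  have hf : ∀ a, f a ≤ 1 := fun a => by
    simp only [hfdef]; split_ifs <;> simp
  have hp : expect p f ≠ ⊤ := ((expect_le_one hf).trans_lt ENNReal.one_lt_top).ne
  have hq : expect q f ≠ ⊤ := ((expect_le_one hf).trans_lt ENNReal.one_lt_top).ne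
  have h0 := h f hf
  rw [← ENNReal.ofReal_toReal hp, ← ENNReal.ofReal_toReal hq,
    ← ENNReal.ofReal_add ENNReal.toReal_nonneg hε,
    ENNReal.ofReal_le_ofReal_iff (by positivity), toReal_expect p hf, toReal_expect q hf] at h0
  have h1 := summable_toReal_mul p hf
  have h2 := summable_toReal_mul q hf
  have h4 : ∑' a, ((p a).toReal - (q a).toReal) = 0 := by
    rw [(summable_toReal p).tsum_sub (summable_toReal q), tsum_toReal, tsum_toReal, sub_self]
  have h5 : ∑' a, |(p a).toReal - (q a).toReal| =
      ∑' a, (2 * ((p a).toReal * (f a).toReal - (q a).toReal * (f a).toReal)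
        - ((p a).toReal - (q a).toReal)) := by
    congr 1
    ext a
    simp only [hfdef]
    split_ifs with hc
    · rw [abs_of_nonneg (by linarith)]; simp; ring
    · rw [abs_of_neg (by linarith)]; simp
  rw [((h1.sub h2).mul_left 2).tsum_sub ((summable_toReal p).sub (summable_toReal q)), h4,
    tsum_mul_left, h1.tsum_sub h2] at h5
  unfold tvDist
  linarith

end Expectation

/-! ### Expectations over the trajectories of a Markov chain -/

section PathExpect

variable {X : Type u} [Fintype X]

/-- The expectation of a function of the first `k` steps of the Markov chain with transition
matrix `M` and start `x`. -/
def pathExpect (M : Matrix X X ℝ≥0) : ℕ → X → (List X → ℝ≥0∞) → ℝ≥0∞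
  | 0, x, F => F [x]
  | k + 1, x, F => ∑ y, (M x y : ℝ≥0∞) * pathExpect M k y fun l => F (x :: l)

/-- Consecutive entries of the list are joined by transitions of positive probability. -/
def Admissible (M : Matrix X X ℝ≥0) (l : List X) : Prop :=
  l.IsChain fun x y => M x y ≠ 0

lemma pathExpect_mono_on {M : Matrix X X ℝ≥0} {k : ℕ} {x : X} {F F' : List X → ℝ≥0∞}
    (h : ∀ l : List X, l.length = k → Admissible M (x :: l) → F (x :: l) ≤ F' (x :: l)) :
    pathExpect M k x F ≤ pathExpect M k x F' := by
  induction k generalizing x F F' with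
  | zero => exact h [] rfl (by simp [Admissible])
  | succ k ih =>
    refine Finset.sum_le_sum fun y _ => ?_
    by_cases hM : M x y = 0
    · simp [hM]
    · refine mul_le_mul_right (ih fun l hl hc => h (y :: l) (by simp [hl]) ?_) _
      exact List.isChain_cons_cons.2 ⟨hM, hc⟩

lemma pathExpect_mono {M : Matrix X X ℝ≥0} {k : ℕ} {x : X} {F F' : List X → ℝ≥0∞}
    (h : ∀ l, F l ≤ F' l) : pathExpect M k x F ≤ pathExpect M k x F' :=
  pathExpect_mono_on fun _ _ _ => h _

lemma pathExpect_congr_on {M : Matrix X X ℝ≥0} {k : ℕ} {x : X} {F F' : List X → ℝ≥0∞}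
    (h : ∀ l : List X, l.length = k → Admissible M (x :: l) → F (x :: l) = F' (x :: l)) :
    pathExpect M k x F = pathExpect M k x F' :=
  le_antisymm (pathExpect_mono_on fun l hl hc => (h l hl hc).le)
    (pathExpect_mono_on fun l hl hc => (h l hl hc).ge)

lemma pathExpect_sum_mul {ι : Type*} (s : Finset ι) (c : ι → ℝ≥0∞) (F : ι → List X → ℝ≥0∞)
    (M : Matrix X X ℝ≥0) (k : ℕ) (x : X) :
    pathExpect M k x (fun l => ∑ i ∈ s, c i * F i l) = ∑ i ∈ s, c i * pathExpect M k x (F i) := by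
  induction k generalizing x F with
  | zero => rfl
  | succ k ih =>
    simp only [pathExpect, ih, Finset.mul_sum]
    rw [Finset.sum_comm]
    refine Finset.sum_congr rfl fun i _ => Finset.sum_congr rfl fun y _ => ?_
    ring

lemma pathExpect_add (M : Matrix X X ℝ≥0) (k : ℕ) (x : X) (F F' : List X → ℝ≥0∞) :
    pathExpect M k x (fun l => F l + F' l) = pathExpect M k x F + pathExpect M k x F' := by
  have := pathExpect_sum_mul Finset.univ (fun _ => 1) (fun b : Bool => if b then F else F') M k x
  simpa using this

/-- All the rows of the matrix sum to one. -/
def Stochastic (M : Matrix X X ℝ≥0) : Prop :=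
  ∀ x, ∑ y, M x y = 1

lemma Stochastic.coe_sum {M : Matrix X X ℝ≥0} (hM : Stochastic M) (x : X) :
    ∑ y, (M x y : ℝ≥0∞) = 1 := by
  exact_mod_cast hM x

lemma Stochastic.mul {M N : Matrix X X ℝ≥0} (hM : Stochastic M) (hN : Stochastic N) :
    Stochastic (M * N) := by
  intro x
  simp only [Matrix.mul_apply]
  rw [Finset.sum_comm]
  simp_rw [← Finset.mul_sum]
  simp [hN _, hM x]

lemma Stochastic.pow {M : Matrix X X ℝ≥0} (hM : Stochastic M) (k : ℕ) : Stochastic (M ^ k) := by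
  induction k with
  | zero =>
    intro x
    simp [Matrix.one_apply]
  | succ k ih => rw [pow_succ]; exact ih.mul hM

lemma pathExpect_const {M : Matrix X X ℝ≥0} (hM : Stochastic M) (k : ℕ) (x : X) (c : ℝ≥0∞) :
    pathExpect M k x (fun _ => c) = c := by
  induction k generalizing x with
  | zero => rfl
  | succ k ih => simp only [pathExpect, ih, ← Finset.sum_mul, hM.coe_sum, one_mul]

lemma coe_mul_div_mul_cancel {a : ℝ≥0∞} (b c : ℝ≥0∞) (ha : a ≠ 0) (ha' : a ≠ ⊤) :
    a * (b / a * c) = b * c := by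
  rw [← mul_assoc, ENNReal.mul_div_cancel ha ha']

lemma sum_midpointWeight (H : Matrix X X ℝ≥0) (p q : X) :
    ∑ j, midpointWeight H (p, q) j = (H * H) p q := rfl

/-- Filling in the midpoints of the trajectory of the chain `H ^ 2` results in a trajectory of the
chain `H`. -/
lemma pathExpect_sampleMidpoints (H : Matrix X X ℝ≥0) (k : ℕ) (x : X) (c : ℝ≥0∞)
    (F : List X → ℝ≥0∞) :
    pathExpect (H * H) k x (fun y => expect (sampleMidpoints H (y.zip y.tail))
      fun o => o.elim c fun ms => F (interleave y ms)) = pathExpect H (2 * k) x F := by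
  induction k generalizing x F with
  | zero => simp [pathExpect, sampleMidpoints, expect_pure, interleave]
  | succ k ih =>
    have hstep : ∀ q, ((H * H) x q : ℝ≥0∞) * pathExpect (H * H) k q (fun l =>
        expect (sampleMidpoints H ((x :: l).zip l))
          fun o => o.elim c fun ms => F (interleave (x :: l) ms)) =
        ∑ j, ((H x j : ℝ≥0∞) * H j q) *
          pathExpect H (2 * k) q fun l => F (x :: j :: l) := by
      intro q
      -- A gap that the chain cannot cross contributes zero on both sides; on all others the
      -- sampling cannot fail, so `c` plays no role.
      by_cases h0 : (H * H) x q = 0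
      · have h1 : ∀ j, (H x j : ℝ≥0∞) * H j q = 0 := by
          intro j
          rw [Matrix.mul_apply, Finset.sum_eq_zero_iff] at h0
          exact_mod_cast h0 j (Finset.mem_univ j)
        simp [h0, h1]
      · have hcongr : pathExpect (H * H) k q (fun l =>
            expect (sampleMidpoints H ((x :: l).zip l))
              fun o => o.elim c fun ms => F (interleave (x :: l) ms)) =
            pathExpect (H * H) k q (fun l =>
              ∑ j, ((midpointWeight H (x, q) j : ℝ≥0∞) / ((H * H) x q : ℝ≥0∞)) *
                expect (sampleMidpoints H (l.zip l.tail))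
                  fun o => o.elim c fun ms => F (x :: j :: interleave l ms)) := by
          refine pathExpect_congr_on fun l _ _ => ?_
          simp only [List.zip_cons_cons, List.tail_cons, sampleMidpoints]
          have hsum : ∑ j, midpointWeight H (x, q) j ≠ 0 := h0
          have hsum' : ∑ j, (midpointWeight H (x, q) j : ℝ≥0∞) = ((H * H) x q : ℝ≥0∞) := by
            rw [← sum_midpointWeight]; push_cast; rfl
          rw [expect_andThen, expect_sampleWeighted hsum, hsum']
          refine Finset.sum_congr rfl fun j _ => ?_
          simp only [Option.elim]
          rw [expect_andThen]
          congr 2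
          ext o
          cases o <;> simp [expect_pure, interleave]
        rw [hcongr, pathExpect_sum_mul, Finset.mul_sum]
        refine Finset.sum_congr rfl fun j _ => ?_
        rw [ih q (fun l => F (x :: j :: l)),
          coe_mul_div_mul_cancel _ _ (by exact_mod_cast h0) ENNReal.coe_ne_top]
        simp [midpointWeight]
    simp only [pathExpect, List.tail_cons]
    rw [Finset.sum_congr rfl fun q _ => hstep q, Finset.sum_comm]
    simp only [show 2 * (k + 1) = 2 * k + 1 + 1 by ring, pathExpect, Finset.mul_sum, mul_assoc]

/-- A chain that, off `y`, contracts a function `h` which is at least one there is likely to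
hit `y`. -/
lemma pathExpect_notMem_le {M : Matrix X X ℝ≥0} {y : X} {h : X → ℝ≥0∞} {c : ℝ≥0∞}
    (h1 : ∀ x, x ≠ y → 1 ≤ h x) (hc : ∀ x, x ≠ y → ∑ z, (M x z : ℝ≥0∞) * h z ≤ c * h x)
    (k : ℕ) (x : X) :
    pathExpect M k x (fun l => if y ∈ l then 0 else 1) ≤ c ^ k * h x := by
  by_cases hx : x = y
  · subst hx
    -- The zero function is written as an empty sum, since `M` is not assumed stochastic and
    -- linearity then gives the expectation.
    refine (pathExpect_mono_on (F' := fun l => ∑ i ∈ (∅ : Finset X), 0 * 0) fun l _ _ => ?_).trans ?_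
    · simp
    · rw [pathExpect_sum_mul (∅ : Finset X) (fun _ => 0) (fun _ _ => 0)]; simp
  induction k generalizing x with
  | zero => simpa [pathExpect, Ne.symm hx] using h1 x hx
  | succ k ih =>
    calc pathExpect M (k + 1) x (fun l => if y ∈ l then 0 else 1)
        ≤ ∑ z, (M x z : ℝ≥0∞) * (c ^ k * h z) := by
          refine Finset.sum_le_sum fun z _ => mul_le_mul_right ?_ _
          have heq : (fun l => if y ∈ x :: l then (0 : ℝ≥0∞) else 1) =
              fun l => if y ∈ l then 0 else 1 := by
            ext l; simp [Ne.symm hx]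
          rw [heq]
          by_cases hz : z = y
          · subst hz
            refine (pathExpect_mono_on (F' := fun l => ∑ i ∈ (∅ : Finset X), 0 * 0)
              fun l _ _ => ?_).trans ?_
            · simp
            · rw [pathExpect_sum_mul (∅ : Finset X) (fun _ => 0) (fun _ _ => 0)]; simp
          · exact ih z hz
      _ = c ^ k * ∑ z, (M x z : ℝ≥0∞) * h z := by
          rw [Finset.mul_sum]
          exact Finset.sum_congr rfl fun z _ => by ring
      _ ≤ c ^ k * (c * h x) := mul_le_mul_right (hc x hx) _
      _ = c ^ (k + 1) * h x := by ring

end PathExpect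

/-! ### Truncation of walks -/

section Trunc

variable {X : Type u}

lemma card_take_mono (z : List X) {i j : ℕ} (h : i ≤ j) :
    (z.take i).toFinset.card ≤ (z.take j).toFinset.card := by
  refine Finset.card_le_card fun x hx => ?_
  rw [List.mem_toFinset] at hx ⊢
  exact (List.take_subset_take_left z h) hx

lemma truncLength_le (ρ : ℕ) (z : List X) : truncLength ρ z ≤ z.length :=
  min_le_left _ _

lemma truncLength_pos {ρ : ℕ} {z : List X} (hz : z ≠ []) : 1 ≤ truncLength ρ z := by
  have := List.length_pos_iff.2 hz
  unfold truncLength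
  omega

lemma truncLength_eq_or (ρ : ℕ) (z : List X) :
    truncLength ρ z = z.length ∨ ρ ≤ (z.take (truncLength ρ z)).toFinset.card := by
  by_cases h : (List.range z.length).findIdx
      (fun i => decide (ρ ≤ (z.take (i + 1)).toFinset.card)) < (List.range z.length).length
  · right
    have h1 := List.findIdx_getElem (w := h)
    simp only [List.getElem_range, decide_eq_true_eq] at h1
    have h2 : truncLength ρ z = (List.range z.length).findIdx
        (fun i => decide (ρ ≤ (z.take (i + 1)).toFinset.card)) + 1 := by
      unfold truncLength
      rw [List.length_range] at h
      omega
    rwa [h2]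
  · left
    rw [List.length_range] at h
    unfold truncLength
    omega

lemma card_take_lt_of_lt_truncLength {ρ : ℕ} {z : List X} {i : ℕ} (hi0 : 0 < i)
    (hi : i < truncLength ρ z) : (z.take i).toFinset.card < ρ := by
  obtain ⟨i, rfl⟩ : ∃ j, i = j + 1 := ⟨i - 1, by omega⟩
  have h1 : i < (List.range z.length).findIdx
      (fun i => decide (ρ ≤ (z.take (i + 1)).toFinset.card)) := by
    unfold truncLength at hi
    omega
  have h2 := List.not_of_lt_findIdx h1
  simpa using h2

/-- Replaces the search in the definition by two conditions on prefixes. The alternative `N = 1` is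
needed for `ρ = 0`, where the empty prefix already has enough vertices. -/
lemma truncLength_eq {ρ N : ℕ} {z : List X} (h1 : 1 ≤ N) (h2 : N ≤ z.length)
    (h3 : N = 1 ∨ (z.take (N - 1)).toFinset.card < ρ)
    (h4 : N = z.length ∨ ρ ≤ (z.take N).toFinset.card) : truncLength ρ z = N := by
  have hz : z ≠ [] := by rintro rfl; simp at h2; omega
  rcases lt_trichotomy (truncLength ρ z) N with h | h | h
  · exfalso
    have hp := truncLength_pos (ρ := ρ) hz
    rcases truncLength_eq_or ρ z with h5 | h5
    · omega
    · rcases h3 with h3 | h3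
      · omega
      · have := card_take_mono z (show truncLength ρ z ≤ N - 1 by omega)
        omega
  · exact h
  · exfalso
    have := card_take_lt_of_lt_truncLength (by omega) h
    have := truncLength_le ρ z
    omega

/-- The walk up to the first occurrence of its `ρ`-th distinct vertex. -/
def truncate (ρ : ℕ) (z : List X) : List X :=
  z.take (truncLength ρ z)

lemma length_truncate (ρ : ℕ) (z : List X) : (truncate ρ z).length = truncLength ρ z := by
  simp [truncate, truncLength_le]

lemma truncate_cons_ne_nil (ρ : ℕ) (x : X) (l : List X) : truncate ρ (x :: l) ≠ [] := by
  rw [← List.length_pos_iff, length_truncate]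
  exact truncLength_pos (by simp)

lemma truncate_of_prefix {ρ m : ℕ} {z : List X} (hm : 1 ≤ m)
    (h : z.length ≤ m ∨ ρ ≤ (z.take m).toFinset.card) :
    truncate ρ (z.take m) = truncate ρ z := by
  rcases h with h | h
  · rw [List.take_of_length_le h]
  rcases eq_or_ne z [] with rfl | hz
  · simp
  have hpos := truncLength_pos (ρ := ρ) hz
  rcases le_or_gt z.length m with hlen | hlen
  · rw [List.take_of_length_le hlen]
  have hle : truncLength ρ z ≤ m := by
    by_contra hcon
    have := card_take_lt_of_lt_truncLength (by omega) (not_le.1 hcon)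
    omega
  have : truncLength ρ (z.take m) = truncLength ρ z := by
    refine truncLength_eq hpos (by rw [List.length_take]; have := truncLength_le ρ z; omega) ?_ ?_
    · by_cases h1 : truncLength ρ z = 1
      · exact Or.inl h1
      · right
        rw [List.take_take, min_eq_left (by omega)]
        exact card_take_lt_of_lt_truncLength (by omega) (by omega)
    · right
      rw [List.take_take, min_eq_left hle]
      rcases truncLength_eq_or ρ z with h5 | h5
      · omega
      · exact h5
  rw [truncate, truncate, this, List.take_take, min_eq_left hle]

/-- Because of this a covering trajectory passes the final test of a phase. -/
lemma min_le_card_truncate {ρ : ℕ} (z : List X) :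
    min ρ z.toFinset.card ≤ (truncate ρ z).toFinset.card := by
  rcases truncLength_eq_or ρ z with h | h
  · rw [truncate, h, List.take_length]; exact min_le_right _ _
  · exact (min_le_left _ _).trans h

/-! ### Interleaving -/

lemma interleave_nil (xs : List X) : interleave xs [] = xs := by
  cases xs <;> rfl

lemma interleave_cons_cons (x m : X) (xs ms : List X) :
    interleave (x :: xs) (m :: ms) = x :: m :: interleave xs ms := rfl

lemma length_interleave {xs ms : List X} (h : ms.length ≤ xs.length) :
    (interleave xs ms).length = xs.length + ms.length := by
  induction xs generalizing ms with
  | nil =>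
    obtain rfl : ms = [] := by simpa using h
    rfl
  | cons x xs ih =>
    cases ms with
    | nil => simp [interleave_nil]
    | cons m ms =>
      simp only [interleave_cons_cons, List.length_cons]
      rw [ih (by simpa using h)]
      omega

/-- Known entries and midpoints alternate, beginning with an entry, so among the first `n` places `n
/ 2` hold midpoints. -/
lemma take_interleave {xs ms : List X} (h : xs.length = ms.length + 1) (n : ℕ) :
    (interleave xs ms).take n = interleave (xs.take (n - n / 2)) (ms.take (n / 2)) := by
  induction ms generalizing xs n with
  | nil =>
    obtain ⟨x, rfl⟩ := List.length_eq_one_iff.1 h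
    rcases n with _ | n
    · simp [interleave]
    · have : n + 1 - (n + 1) / 2 = (n - (n + 1) / 2) + 1 := by omega
      simp [interleave_nil, this]
  | cons m ms ih =>
    cases xs with
    | nil => simp at h
    | cons x xs =>
      rcases n with _ | _ | n
      · simp [interleave]
      · simp [interleave]
      · have e1 : n + 1 + 1 - (n + 1 + 1) / 2 = (n - n / 2) + 1 := by omega
        have e2 : (n + 1 + 1) / 2 = n / 2 + 1 := by omega
        rw [interleave_cons_cons, e1, e2, List.take_succ_cons, List.take_succ_cons,
          List.take_succ_cons, List.take_succ_cons, interleave_cons_cons,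
          ih (by simpa using h)]

lemma toFinset_interleave {xs ms : List X} (h : ms.length ≤ xs.length) :
    (interleave xs ms).toFinset = xs.toFinset ∪ ms.toFinset := by
  induction xs generalizing ms with
  | nil =>
    obtain rfl : ms = [] := by simpa using h
    rfl
  | cons x xs ih =>
    cases ms with
    | nil => simp [interleave_nil]
    | cons m ms =>
      rw [interleave_cons_cons, List.toFinset_cons, List.toFinset_cons, ih (by simpa using h)]
      ext a
      simp only [Finset.mem_insert, Finset.mem_union, List.toFinset_cons]
      tauto

/-- Truncating a partial walk before its midpoints are filled in does not change the truncation of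
the filled-in walk. -/
lemma truncate_interleave_truncate {ρ : ℕ} {W ms : List X} (h : W.length = ms.length + 1) :
    truncate ρ (interleave (truncate ρ W) (ms.take (truncLength ρ W - 1))) =
      truncate ρ (interleave W ms) := by
  have hW : W ≠ [] := by rintro rfl; simp at h
  have hpos := truncLength_pos (ρ := ρ) hW
  have hle := truncLength_le ρ W
  set k := truncLength ρ W with hk
  -- The `k` kept entries and the `k - 1` midpoints between them form a prefix, which is either the
  -- whole walk or already has `ρ` distinct vertices.
  have e : interleave (truncate ρ W) (ms.take (k - 1)) = (interleave W ms).take (2 * k - 1) := by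
    rw [take_interleave h, truncate, ← hk]
    congr 2 <;> omega
  rw [e]
  refine truncate_of_prefix (by omega) ?_
  rcases truncLength_eq_or ρ W with h1 | h1
  · left
    rw [length_interleave (by omega)]
    omega
  · right
    rw [← e, toFinset_interleave (by rw [length_truncate, List.length_take]; omega)]
    exact h1.trans (Finset.card_le_card Finset.subset_union_left)

/-- The truncation length does not depend on the order of the midpoints before the last one that
is kept. -/
lemma truncLength_interleave_perm {ρ : ℕ} {W a a' b : List X} (h : W.length = (a ++ b).length + 1)
    (hp : a.Perm a') (hK : truncLength ρ (interleave W (a ++ b)) / 2 = a.length + 1) :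
    truncLength ρ (interleave W (a' ++ b)) = truncLength ρ (interleave W (a ++ b)) := by
  have hl := hp.length_eq
  have h' : W.length = (a' ++ b).length + 1 := by simp only [List.length_append] at h ⊢; omega
  set N := truncLength ρ (interleave W (a ++ b)) with hN
  have hNle := truncLength_le ρ (interleave W (a ++ b))
  rw [← hN, length_interleave (by omega)] at hNle
  -- A prefix that contains all of `a` keeps its vertex set when `a` is permuted. The lengths `N`
  -- and `N - 1`, which decide the truncation, both qualify because the last kept midpoint is not in
  -- `a`.
  have hset : ∀ n, a.length ≤ n / 2 → ((interleave W (a' ++ b)).take n).toFinset =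
      ((interleave W (a ++ b)).take n).toFinset := by
    intro n hn
    have ea : a.take (n / 2) = a := List.take_of_length_le hn
    have ea' : a'.take (n / 2) = a' := List.take_of_length_le (by omega)
    rw [take_interleave h, take_interleave h', toFinset_interleave, toFinset_interleave,
      List.take_append, List.take_append, ea, ea']
    · simp only [List.toFinset_append, hl]
      rw [List.toFinset_eq_of_perm _ _ hp]
    all_goals simp only [List.length_take]; omega
  refine truncLength_eq (by omega) (by rw [length_interleave (by omega)]; simp at hNle ⊢; omega) ?_ ?_
  · right
    rw [hset _ (by omega)]
    exact card_take_lt_of_lt_truncLength (by omega) (by omega)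
  · rcases truncLength_eq_or ρ (interleave W (a ++ b)) with h5 | h5
    · left
      rw [← hN] at h5
      rw [h5, length_interleave (by omega), length_interleave (by omega)]
      simp [hl]
    · right
      rw [hset _ (by omega)]
      exact h5

end Trunc

/-! ### Resampling the midpoints by a random matching -/

/-- Resampling the arrangement of the coordinates with probability proportional to the weight leaves
the weighted sum invariant. -/
lemma sum_mul_sum_perm_div {ι Y : Type*} [Fintype ι] [DecidableEq ι] [Fintype Y]
    (w G : (ι → Y) → ℝ≥0∞) (hw : ∀ m, w m ≠ ⊤) :
    ∑ m, w m * ∑ σ : Equiv.Perm ι, w (m ∘ σ) / (∑ τ : Equiv.Perm ι, w (m ∘ τ)) * G (m ∘ σ) =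
      ∑ m, w m * G m := by
  have hinv : ∀ (m : ι → Y) (σ : Equiv.Perm ι),
      ∑ τ : Equiv.Perm ι, w ((m ∘ σ) ∘ τ) = ∑ τ : Equiv.Perm ι, w (m ∘ τ) := fun m σ =>
    Fintype.sum_equiv (Equiv.mulLeft σ) _ _ fun τ => by simp [Function.comp_assoc]
  simp_rw [Finset.mul_sum]
  rw [Finset.sum_comm]
  -- Substituting `m ∘ σ⁻¹` for `m` leaves the normalizing sum unchanged, as it depends only on the
  -- orbit. The sum over `σ` of the transported weights then cancels it.
  have hre : ∀ σ : Equiv.Perm ι,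
      ∑ m, w m * (w (m ∘ σ) / (∑ τ : Equiv.Perm ι, w (m ∘ τ)) * G (m ∘ σ)) =
      ∑ m, w (m ∘ ⇑σ⁻¹) * (w m / (∑ τ : Equiv.Perm ι, w (m ∘ τ)) * G m) := fun σ =>
    Fintype.sum_equiv (Equiv.arrowCongr σ.symm (Equiv.refl Y)) _ _ fun m => by
      have e : (Equiv.arrowCongr σ.symm (Equiv.refl Y)) m = m ∘ σ := by
        ext i; simp [Equiv.arrowCongr]
      rw [e, hinv]
      congr 2
      ext i
      simp
  rw [Finset.sum_congr rfl fun σ _ => hre σ, Finset.sum_comm]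
  refine Finset.sum_congr rfl fun m _ => ?_
  rw [← Finset.sum_mul]
  have hsum : ∑ σ : Equiv.Perm ι, w (m ∘ ⇑σ⁻¹) = ∑ τ : Equiv.Perm ι, w (m ∘ τ) :=
    Fintype.sum_equiv (Equiv.inv _) _ _ fun σ => rfl
  rw [hsum]
  by_cases h0 : ∑ τ : Equiv.Perm ι, w (m ∘ τ) = 0
  · have : w m = 0 := by
      have := (Finset.sum_eq_zero_iff.1 h0) 1 (Finset.mem_univ _)
      simpa using this
    simp [this]
  · exact coe_mul_div_mul_cancel _ _ h0 (by simpa [ENNReal.sum_eq_top] using fun τ => hw _)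

/-- Both functions take each value equally often, so their fibres can be identified. -/
lemma exists_perm_of_ofFn_perm {Y : Type*} {k : ℕ} {f g : Fin k → Y}
    (h : (List.ofFn f).Perm (List.ofFn g)) : ∃ π : Equiv.Perm (Fin k), f = g ∘ π := by
  have hcard : ∀ y, Fintype.card {i // f i = y} = Fintype.card {i // g i = y} := by
    intro y
    have key : ∀ f : Fin k → Y, Fintype.card {i // f i = y} = (List.ofFn f).count y := by
      intro f
      rw [Fintype.card_subtype, List.ofFn_eq_map, List.count, List.countP_map,
        List.countP_eq_length_filter]
      rw [Finset.card_def, Finset.filter_val]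
      change Multiset.card (Multiset.filter _ (↑(List.finRange k) : Multiset (Fin k))) = _
      rw [Multiset.filter_coe, Multiset.coe_card]
      congr 1
    rw [key, key, h.count_eq]
  refine ⟨Equiv.ofFiberEquiv fun y => Fintype.equivOfCardEq (hcard y), ?_⟩
  ext i
  exact (Equiv.ofFiberEquiv_map _ i).symm

/-! ### Labelled midpoints and their matching weights -/

section Placement

variable {X : Type u}

lemma ofFn_getD {Y : Type*} {k : ℕ} {L : List Y} (hL : L.length = k) (d : Y) :
    List.ofFn (fun i : Fin k => L.getD i d) = L := by
  subst hL
  conv_rhs => rw [← List.ofFn_getElem (xs := L)]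
  congr 1
  ext i
  simp

/-- Labelling the entries of a list by the entries of its multiset. -/
lemma exists_perm_toList {k : ℕ} (m : Fin k → X) (d : X) :
    ∃ π : Equiv.Perm (Fin k), ∀ i : Fin k,
      (Multiset.toList (↑(List.ofFn m) : Multiset X)).getD i d = m (π i) := by
  set L := Multiset.toList (↑(List.ofFn m) : Multiset X) with hL
  have hp : L.Perm (List.ofFn m) := by
    rw [← Multiset.coe_eq_coe, hL, Multiset.coe_toList]
  have hlen : L.length = k := by rw [hp.length_eq, List.length_ofFn]
  have h : (List.ofFn fun i : Fin k => L.getD i d).Perm (List.ofFn m) := by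
    rw [ofFn_getD hlen]
    exact hp
  obtain ⟨π, hπ⟩ := exists_perm_of_ofFn_perm h
  exact ⟨π, fun i => congrFun hπ i⟩

/-- With labels `m ∘ π`, the matching `σ` produces the arrangement `m ∘ (π * σ⁻¹)`. As `σ` varies
all arrangements occur once per permutation, so the labelling does not matter. -/
lemma matchingWeight_placementWeights {H : Matrix X X ℝ≥0} {gs : List (X × X)} {d : X}
    {m : Fin gs.length → X} {L : List X} {π : Equiv.Perm (Fin gs.length)}
    (hπ : ∀ i : Fin gs.length, L.getD i d = m (π i)) (σ : Equiv.Perm (Fin gs.length)) :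
    matchingWeight (placementWeights H L gs d gs.length) σ =
      ∏ i, midpointWeight H (gs.get i) ((m ∘ ⇑(π * σ⁻¹)) i) := by
  rw [matchingWeight,
    ← Equiv.prod_comp σ fun i => midpointWeight H (gs.get i) ((m ∘ ⇑(π * σ⁻¹)) i)]
  refine Finset.prod_congr rfl fun i _ => ?_
  simp [placementWeights, ← hπ]

lemma placementWeights_congr {H : Matrix X X ℝ≥0} {L : List X} {gs gs' : List (X × X)} {d d' : X}
    {k : ℕ} (hL : k ≤ L.length) (hgs : k ≤ gs.length) (h : gs.take k = gs'.take k) :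
    placementWeights H L gs d k = placementWeights H L gs' d' k := by
  ext i j
  have h1 : ∀ gs : List (X × X), ∀ d, gs.getD j d = (gs.take k).getD j d := by
    intro gs d
    simp [List.getD_eq_getElem?_getD]
  have h2 : (j : ℕ) < (gs'.take k).length := by
    rw [← h, List.length_take]; omega
  have hi : (i : ℕ) < L.length := by omega
  simp only [placementWeights]
  rw [h1, h, h1 gs']
  simp [List.getD_eq_getElem?_getD, List.getElem?_eq_getElem h2, hi]

/-- The expectation of a function of the list of midpoints after the first `j` of them have been
rearranged by a random matching. -/
def rearrange (H : Matrix X X ℝ≥0) (gs : List (X × X)) (d : X) (j : ℕ) (F : List X → ℝ≥0∞)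
    (ms : List X) : ℝ≥0∞ :=
  let L : List X := Multiset.toList (↑(ms.take j) : Multiset X)
  let A := placementWeights H L gs d j
  ∑ σ, (matchingWeight A σ : ℝ≥0∞) / (∑ τ, (matchingWeight A τ : ℝ≥0∞)) *
    F (List.ofFn (fun i => L.getD (σ.symm i) d) ++ ms.drop j)

lemma rearrange_append {H : Matrix X X ℝ≥0} {gs gs' : List (X × X)} (d : X) {a : List X}
    (b : List X) (ha : a.length = gs.length) (F : List X → ℝ≥0∞) :
    rearrange H (gs ++ gs') d gs.length F (a ++ b) =
      rearrange H gs d gs.length (fun a => F (a ++ b)) a := by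
  have h1 : (a ++ b).take gs.length = a := by rw [← ha, List.take_left]
  have h2 : (a ++ b).drop gs.length = b := by rw [← ha, List.drop_left]
  have h3 : a.take gs.length = a := List.take_of_length_le ha.le
  have h4 : a.drop gs.length = [] := List.drop_of_length_le ha.le
  have h5 : placementWeights H (Multiset.toList (↑a : Multiset X)) (gs ++ gs') d gs.length =
      placementWeights H (Multiset.toList (↑a : Multiset X)) gs d gs.length :=
    placementWeights_congr (by simp [ha]) (by simp) (by simp)
  simp only [rearrange, h1, h2, h3, h4, h5, List.append_nil]

end Placement

/-! ### Expectations over independent midpoints -/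

section Midpoints

variable {X : Type u} [Fintype X]

/-- The expectation of a function of independent midpoints for the gaps in a list. -/
def midExpect (H : Matrix X X ℝ≥0) : List (X × X) → (List X → ℝ≥0∞) → ℝ≥0∞
  | [], F => F []
  | g :: gs, F => ∑ j, (midpointWeight H g j : ℝ≥0∞) / (∑ i, (midpointWeight H g i : ℝ≥0∞)) *
      midExpect H gs fun ms => F (j :: ms)

lemma expect_sampleMidpoints {H : Matrix X X ℝ≥0} {gs : List (X × X)}
    (hgs : ∀ g ∈ gs, ∑ j, midpointWeight H g j ≠ 0) (f : Option (List X) → ℝ≥0∞) :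
    expect (sampleMidpoints H gs) f = midExpect H gs fun ms => f (some ms) := by
  induction gs generalizing f with
  | nil => simp [sampleMidpoints, expect_pure, midExpect]
  | cons g gs ih =>
    rw [sampleMidpoints, expect_andThen, expect_sampleWeighted (hgs g (by simp)), midExpect]
    refine Finset.sum_congr rfl fun j _ => ?_
    simp only [Option.elim]
    rw [expect_andThen, ih fun g hg => hgs g (by simp [hg])]
    simp [expect_pure]

lemma midExpect_mono_on {H : Matrix X X ℝ≥0} {gs : List (X × X)} {F F' : List X → ℝ≥0∞}
    (h : ∀ ms, List.Forall₂ (fun g j => midpointWeight H g j ≠ 0) gs ms → F ms ≤ F' ms) :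
    midExpect H gs F ≤ midExpect H gs F' := by
  induction gs generalizing F F' with
  | nil => exact h [] .nil
  | cons g gs ih =>
    refine Finset.sum_le_sum fun j _ => ?_
    by_cases hj : midpointWeight H g j = 0
    · simp [hj]
    · exact mul_le_mul_right (ih fun ms hms => h _ (.cons hj hms)) _

lemma midExpect_congr_on {H : Matrix X X ℝ≥0} {gs : List (X × X)} {F F' : List X → ℝ≥0∞}
    (h : ∀ ms, List.Forall₂ (fun g j => midpointWeight H g j ≠ 0) gs ms → F ms = F' ms) :
    midExpect H gs F = midExpect H gs F' :=
  le_antisymm (midExpect_mono_on fun ms hms => (h ms hms).le)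
    (midExpect_mono_on fun ms hms => (h ms hms).ge)

lemma midExpect_sum_mul {ι : Type*} (s : Finset ι) (c : ι → ℝ≥0∞) (F : ι → List X → ℝ≥0∞)
    (H : Matrix X X ℝ≥0) (gs : List (X × X)) :
    midExpect H gs (fun l => ∑ i ∈ s, c i * F i l) = ∑ i ∈ s, c i * midExpect H gs (F i) := by
  induction gs generalizing F with
  | nil => rfl
  | cons g gs ih =>
    simp only [midExpect, ih, Finset.mul_sum]
    rw [Finset.sum_comm]
    refine Finset.sum_congr rfl fun i _ => Finset.sum_congr rfl fun y _ => ?_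
    ring

lemma midExpect_sum {ι : Type*} (s : Finset ι) (F : ι → List X → ℝ≥0∞)
    (H : Matrix X X ℝ≥0) (gs : List (X × X)) :
    midExpect H gs (fun l => ∑ i ∈ s, F i l) = ∑ i ∈ s, midExpect H gs (F i) := by
  simpa using midExpect_sum_mul s (fun _ => 1) F H gs

lemma midExpect_add (H : Matrix X X ℝ≥0) (gs : List (X × X)) (F F' : List X → ℝ≥0∞) :
    midExpect H gs (fun l => F l + F' l) = midExpect H gs F + midExpect H gs F' := by
  simpa using midExpect_sum Finset.univ (fun b : Bool => if b then F else F') H gs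

lemma midExpect_append (H : Matrix X X ℝ≥0) (gs gs' : List (X × X)) (F : List X → ℝ≥0∞) :
    midExpect H (gs ++ gs') F =
      midExpect H gs fun a => midExpect H gs' fun b => F (a ++ b) := by
  induction gs generalizing F with
  | nil => rfl
  | cons g gs ih => simp only [List.cons_append, midExpect, ih]

lemma midExpect_const {H : Matrix X X ℝ≥0} {gs : List (X × X)}
    (hgs : ∀ g ∈ gs, ∑ j, midpointWeight H g j ≠ 0) (c : ℝ≥0∞) :
    midExpect H gs (fun _ => c) = c := by
  rw [← expect_sampleMidpoints hgs fun _ => c, expect_const]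

/-- The midpoints of the first `j` gaps only. -/
lemma midExpect_take {H : Matrix X X ℝ≥0} {gs : List (X × X)}
    (hgs : ∀ g ∈ gs, ∑ j, midpointWeight H g j ≠ 0) (j : ℕ) (F : List X → ℝ≥0∞) :
    midExpect H (gs.take j) F = midExpect H gs fun ms => F (ms.take j) := by
  conv_rhs => rw [← List.take_append_drop j gs]
  rw [midExpect_append]
  refine midExpect_congr_on fun a ha => ?_
  have hl : a.length = (gs.take j).length := ha.length_eq.symm
  rw [← midExpect_const (fun g hg => hgs g (List.mem_of_mem_drop hg)) (F a)]
  refine midExpect_congr_on fun b hb => ?_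
  have hl' : b.length = (gs.drop j).length := hb.length_eq.symm
  rw [List.length_take] at hl
  rw [List.length_drop] at hl'
  rw [List.take_append, List.take_of_length_le (by omega)]
  rcases le_or_gt j gs.length with hj | hj
  · simp [show j - a.length = 0 by omega]
  · obtain rfl : b = [] := List.length_eq_zero_iff.1 (by omega)
    simp

/-- The normalizations of the gaps do not depend on the midpoints and come out as a factor, which
leaves a sum to which `sum_mul_sum_perm_div` applies. -/
lemma midExpect_eq_sum (H : Matrix X X ℝ≥0) (gs : List (X × X)) (F : List X → ℝ≥0∞) :
    midExpect H gs F = (∏ i : Fin gs.length, (∑ x, (midpointWeight H (gs.get i) x : ℝ≥0∞))⁻¹) *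
      ∑ m : Fin gs.length → X, (∏ i, (midpointWeight H (gs.get i) (m i) : ℝ≥0∞)) *
        F (List.ofFn m) := by
  induction gs generalizing F with
  | nil => simp [midExpect]
  | cons g gs ih =>
    rw [midExpect]
    simp only [ih, List.length_cons]
    rw [Fin.prod_univ_succ, ← (Fin.consEquiv fun _ => X).sum_comp, Fintype.sum_prod_type,
      Finset.mul_sum]
    refine Finset.sum_congr rfl fun j _ => ?_
    simp only [Fin.consEquiv_apply, Fin.prod_univ_succ, Fin.cons_zero, Fin.cons_succ, List.ofFn_succ,
      List.get_cons_zero, Finset.mul_sum]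
    refine Finset.sum_congr rfl fun m _ => ?_
    rw [ENNReal.div_eq_inv_mul]
    simp only [List.get_eq_getElem, Fin.val_succ, List.getElem_cons_succ]
    ring

/-- The weight of a matching is the joint weight of the midpoints in their new gaps. Resampling the
order of independent midpoints by this weight is thus resampling from the conditional law given
their multiset. -/
lemma midExpect_rearrange_length (H : Matrix X X ℝ≥0) (gs : List (X × X)) (d : X)
    (F : List X → ℝ≥0∞) :
    midExpect H gs (rearrange H gs d gs.length F) = midExpect H gs F := by
  rw [midExpect_eq_sum, midExpect_eq_sum]
  congr 1
  set w : (Fin gs.length → X) → ℝ≥0∞ :=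
    fun m => ∏ i, (midpointWeight H (gs.get i) (m i) : ℝ≥0∞) with hw
  have hwtop : ∀ m, w m ≠ ⊤ := fun m => ENNReal.prod_ne_top fun i _ => ENNReal.coe_ne_top
  rw [← sum_mul_sum_perm_div w (fun m => F (List.ofFn m)) hwtop]
  refine Finset.sum_congr rfl fun m _ => ?_
  congr 1
  obtain ⟨π, hπ⟩ := exists_perm_toList m d
  have htake : (List.ofFn m).take gs.length = List.ofFn m :=
    List.take_of_length_le (by simp)
  have hdrop : (List.ofFn m).drop gs.length = [] := List.drop_of_length_le (by simp)
  have hmw : ∀ σ, ((matchingWeight (placementWeights H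
      (Multiset.toList (↑(List.ofFn m) : Multiset X)) gs d gs.length) σ : ℝ≥0) : ℝ≥0∞) =
      w (m ∘ ⇑(π * σ⁻¹)) := by
    intro σ
    rw [matchingWeight_placementWeights hπ]
    push_cast
    rfl
  have hsum : ∑ τ : Equiv.Perm (Fin gs.length), w (m ∘ ⇑(π * τ⁻¹)) =
      ∑ τ : Equiv.Perm (Fin gs.length), w (m ∘ ⇑τ) :=
    Fintype.sum_equiv ((Equiv.inv _).trans (Equiv.mulLeft π)) _ _ fun τ => rfl
  simp only [rearrange, htake, hdrop, List.append_nil, hmw, hsum]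
  refine Fintype.sum_equiv ((Equiv.inv _).trans (Equiv.mulLeft π)) _ _ fun σ => ?_
  simp only [Equiv.trans_apply, Equiv.inv_apply, Equiv.coe_mulLeft]
  congr 3
  ext i
  rw [hπ]
  rfl

/-- Rearranging the first `j` midpoints by a random matching does not change their law. -/
lemma midExpect_rearrange (H : Matrix X X ℝ≥0) {gs : List (X × X)} (d : X) {j : ℕ}
    (hj : j ≤ gs.length) (F : List X → ℝ≥0∞) :
    midExpect H gs (rearrange H gs d j F) = midExpect H gs F := by
  obtain ⟨g₁, g₂, rfl, rfl⟩ : ∃ g₁ g₂, gs = g₁ ++ g₂ ∧ g₁.length = j :=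
    ⟨gs.take j, gs.drop j, (List.take_append_drop j gs).symm, by simp [hj]⟩
  rw [midExpect_append, midExpect_append,
    ← midExpect_rearrange_length H g₁ d fun a => midExpect H g₂ fun b => F (a ++ b)]
  refine midExpect_congr_on fun a ha => ?_
  have hl : a.length = g₁.length := ha.length_eq.symm
  simp_rw [rearrange_append d _ hl]
  simp only [rearrange]
  rw [midExpect_sum_mul]

end Midpoints

/-! ### One level of the walk -/

section Level

variable {X : Type u}

lemma length_zip_tail {Y : Type*} (W : List Y) : (W.zip W.tail).length = W.length - 1 := by
  simp

/-- The multiset of the first midpoints admits a matching of positive weight. -/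
lemma sum_matchingWeight_ne_zero {H : Matrix X X ℝ≥0} {gs : List (X × X)} {a : List X} (d : X)
    (h : List.Forall₂ (fun g j => midpointWeight H g j ≠ 0) gs a) :
    ∑ σ, matchingWeight (placementWeights H (Multiset.toList (↑a : Multiset X)) gs d gs.length) σ
      ≠ 0 := by
  have hl : a.length = gs.length := h.length_eq.symm
  have ha : List.ofFn (fun i : Fin gs.length => a.getD i d) = a := ofFn_getD hl d
  obtain ⟨π, hπ⟩ := exists_perm_toList (fun i : Fin gs.length => a.getD i d) d
  rw [ha] at hπ
  intro h0
  -- The matching `π` restores the original arrangement, which has positive weight.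
  have := (Finset.sum_eq_zero_iff.1 h0) π (Finset.mem_univ _)
  rw [matchingWeight_placementWeights (m := fun i => a.getD i d) hπ, Finset.prod_eq_zero_iff] at this
  obtain ⟨i, -, hi⟩ := this
  rw [List.forall₂_iff_get] at h
  refine h.2 i i.2 (by rw [hl]; exact i.2) ?_
  simpa [hl] using hi

lemma toList_perm {Y : Type*} (a : List Y) : (Multiset.toList (↑a : Multiset Y)).Perm a := by
  rw [← Multiset.coe_eq_coe, Multiset.coe_toList]

lemma ofFn_getD_perm {Y : Type*} {k : ℕ} {L : List Y} (hL : L.length = k)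
    (σ : Equiv.Perm (Fin k)) (d : Y) :
    (List.ofFn fun i : Fin k => L.getD (σ i) d).Perm L := by
  conv_rhs => rw [← ofFn_getD hL d]
  exact Equiv.Perm.ofFn_comp_perm σ fun i : Fin k => L.getD i d

/-- What a level does after the midpoints `ms` have been drawn, if `N` entries of the walk, among
them `K` midpoints, are kept. -/
def placeMidpoints (sampler : MatchingSampler) (H : Matrix X X ℝ≥0) (W ms : List X) (N K : ℕ) :
    PMF (Option (List X)) :=
  let gs : List (X × X) := W.zip W.tail
  let W' := W.take (N - K)
  match (ms.take K).getLast? with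
  | none => PMF.pure (some W')
  | some mf =>
    let L : List X := Multiset.toList (↑(ms.take (K - 1)) : Multiset X)
    let A := placementWeights H L gs mf (K - 1)
    (sampler (K - 1) A).bind fun σ =>
      if matchingWeight A σ = 0 then PMF.pure none
      else PMF.pure (some (interleave W' (List.ofFn (fun j => L.getD (σ.symm j) mf) ++ [mf])))

lemma getLast?_take_succ {Y : Type*} {l : List Y} {j : ℕ} (h : j < l.length) :
    (l.take (j + 1)).getLast? = some l[j] := by
  rw [List.take_succ_eq_append_getElem h, List.getLast?_concat]

lemma placeMidpoints_succ (sampler : MatchingSampler) (H : Matrix X X ℝ≥0) (W : List X) {ms : List X}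
    (N : ℕ) {j : ℕ} (hj : j < ms.length) :
    placeMidpoints sampler H W ms N (j + 1) =
      let L : List X := Multiset.toList (↑(ms.take j) : Multiset X)
      let A := placementWeights H L (W.zip W.tail) ms[j] j
      (sampler j A).bind fun σ =>
        if matchingWeight A σ = 0 then PMF.pure none
        else PMF.pure (some (interleave (W.take (N - (j + 1)))
          (List.ofFn (fun i => L.getD (σ.symm i) ms[j]) ++ [ms[j]]))) := by
  simp only [placeMidpoints, getLast?_take_succ hj]
  rfl

/-- Truncating the filled-in walk after its midpoints have been rearranged. -/
lemma truncate_interleave_rearranged {ρ : ℕ} {W ms a : List X} {j : ℕ}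
    (hW : W.length = ms.length + 1) (ha : (ms.take j).Perm a) (hj : j < ms.length)
    (hK : truncLength ρ (interleave W ms) / 2 = j + 1) :
    truncLength ρ (interleave W (a ++ ms.drop j)) = truncLength ρ (interleave W ms) ∧
    truncate ρ (interleave W (a ++ ms.drop j)) =
      interleave (W.take (truncLength ρ (interleave W ms) - (j + 1))) (a ++ [ms[j]]) := by
  have hlen : (ms.take j).length = j := by simp; omega
  have hla : a.length = j := by rw [← ha.length_eq, hlen]
  have hsplit : ms.take j ++ ms.drop j = ms := List.take_append_drop j ms
  have h1 : truncLength ρ (interleave W (a ++ ms.drop j)) = truncLength ρ (interleave W ms) := by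
    have := truncLength_interleave_perm (ρ := ρ) (W := W) (a := ms.take j) (a' := a)
      (b := ms.drop j) (by rw [hsplit]; exact hW) ha (by rw [hsplit, hlen]; exact hK)
    rwa [hsplit] at this
  refine ⟨h1, ?_⟩
  have hWlen : W.length = (a ++ ms.drop j).length + 1 := by
    simp only [List.length_append, List.length_drop]; omega
  have hta : a.take (j + 1) = a := List.take_of_length_le (by omega)
  rw [truncate, h1, take_interleave hWlen, hK, List.take_append, hla, hta, show j + 1 - j = 0 + 1 by omega, List.drop_eq_getElem_cons hj,
    List.take_succ_cons, List.take_zero]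

/-- The only approximate ingredient of a level is the matching, so passing to the exact matching law
costs `δ`. Under that law a matching of weight zero has probability zero, and this failure
disappears. -/
lemma expect_placeMidpoints_le {sampler : MatchingSampler} {δ : ℝ} (hs : sampler.ErrorAtMost δ)
    (ρ : ℕ) {H : Matrix X X ℝ≥0} {W ms : List X} {d : X} (hW : W ≠ [])
    (hms : List.Forall₂ (fun g j => midpointWeight H g j ≠ 0) (W.zip W.tail) ms)
    {f : Option (List X) → ℝ≥0∞} (hf : ∀ o, f o ≤ 1) :
    expect (placeMidpoints sampler H W ms (truncLength ρ (interleave W ms))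
        (truncLength ρ (interleave W ms) / 2)) f ≤
      (match truncLength ρ (interleave W ms) / 2 with
        | 0 => f (some (truncate ρ (interleave W ms)))
        | j + 1 => rearrange H (W.zip W.tail) d j
            (fun ms => f (some (truncate ρ (interleave W ms)))) ms) + ENNReal.ofReal δ := by
  have hgl := length_zip_tail W
  have hml : (W.zip W.tail).length = ms.length := hms.length_eq
  have hWpos := List.length_pos_iff.2 hW
  have hlen : W.length = ms.length + 1 := by omega
  have hN := truncLength_le ρ (interleave W ms)
  rw [length_interleave (by omega)] at hN
  rcases hK : truncLength ρ (interleave W ms) / 2 with _ | j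
  · simp only [placeMidpoints, List.take_zero, List.getLast?_nil, expect_pure]
    refine le_add_right (le_of_eq ?_)
    rw [truncate, take_interleave hlen, hK, List.take_zero, interleave_nil]
  · have hj : j < ms.length := by omega
    rw [placeMidpoints_succ _ _ _ _ hj]
    dsimp only
    set L := Multiset.toList (↑(ms.take j) : Multiset X) with hL
    have hLp : L.Perm (ms.take j) := toList_perm _
    have hLlen : L.length = j := by rw [hLp.length_eq]; simp; omega
    have hA : placementWeights H L (W.zip W.tail) ms[j] j =
        placementWeights H L (W.zip W.tail) d j :=
      placementWeights_congr hLlen.ge (by omega) rfl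
    set A := placementWeights H L (W.zip W.tail) d j with hAdef
    have hA0 : ∑ σ, matchingWeight A σ ≠ 0 := by
      have h1 := sum_matchingWeight_ne_zero d (List.forall₂_take j hms)
      have h2 : ((W.zip W.tail).take j).length = j := by simp only [List.length_take]; omega
      rw [h2] at h1
      have h3 : placementWeights H L ((W.zip W.tail).take j) d j = A :=
        placementWeights_congr hLlen.ge (by omega) (by simp)
      rwa [← hL, h3] at h1
    rw [hA, expect_bind]
    refine (expect_le_of_tvDist_le (hs j A hA0) fun σ => expect_le_one hf).trans ?_
    refine add_le_add ?_ le_rfl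
    rw [expect_fintype]
    simp only [rearrange, ← hL, ← hAdef]
    refine Finset.sum_le_sum fun σ _ => ?_
    rw [proportional_apply]
    by_cases hσ : matchingWeight A σ = 0
    · simp [hσ]
    · refine mul_le_mul_right (le_of_eq ?_) _
      rw [if_neg hσ, expect_pure]
      have hd : ∀ i : Fin j, L.getD (σ.symm i) ms[j] = L.getD (σ.symm i) d := by
        intro i
        have : ((σ.symm i : Fin j) : ℕ) < L.length := by omega
        simp [this]
      simp only [hd]
      rw [(truncate_interleave_rearranged hlen
        ((ofFn_getD_perm hLlen σ.symm d).trans hLp).symm hj hK).2]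

variable [Fintype X]

lemma Admissible.sum_midpointWeight_ne_zero {H : Matrix X X ℝ≥0} {W : List X}
    (hW : Admissible (H * H) W) : ∀ g ∈ W.zip W.tail, ∑ j, midpointWeight H g j ≠ 0 := by
  induction W with
  | nil => simp
  | cons x W ih =>
    cases W with
    | nil => simp
    | cons y W =>
      obtain ⟨h1, h2⟩ := List.isChain_cons_cons.1 hW
      intro g hg
      simp only [List.tail_cons, List.zip_cons_cons, List.mem_cons] at hg
      rcases hg with rfl | hg
      · exact h1
      · exact ih h2 g hg

lemma forall₂_of_mem_support_sampleMidpoints {H : Matrix X X ℝ≥0} {gs : List (X × X)} {ms : List X}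
    (h : some ms ∈ (sampleMidpoints H gs).support) :
    List.Forall₂ (fun g j => midpointWeight H g j ≠ 0) gs ms := by
  induction gs generalizing ms with
  | nil =>
    obtain rfl : ms = [] := by simpa [sampleMidpoints] using h
    exact .nil
  | cons g gs ih =>
    rw [sampleMidpoints, some_mem_support_andThen] at h
    obtain ⟨j, hj, h⟩ := h
    rw [some_mem_support_andThen] at h
    obtain ⟨ms', hms', h⟩ := h
    obtain rfl : ms = j :: ms' := by simpa using h
    exact .cons (some_mem_support_sampleWeighted hj) (ih hms')

lemma level_eq (sampler : MatchingSampler) (ρ : ℕ) (H : Matrix X X ℝ≥0) (W : List X) :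
    level sampler ρ H W = andThen (sampleMidpoints H (W.zip W.tail)) fun ms =>
      placeMidpoints sampler H W ms (truncLength ρ (interleave W ms))
        (truncLength ρ (interleave W ms) / 2) :=
  rfl

/-- One level of the walk with a matching sampler of error `δ`, compared with filling in the
midpoints and truncating. -/
lemma expect_level_le {sampler : MatchingSampler} {δ : ℝ} (hs : sampler.ErrorAtMost δ)
    (ρ : ℕ) {H : Matrix X X ℝ≥0} {W : List X} (hW : W ≠ []) (hadm : Admissible (H * H) W)
    {f : Option (List X) → ℝ≥0∞} (hf : ∀ o, f o ≤ 1) :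
    expect (level sampler ρ H W) f ≤
      midExpect H (W.zip W.tail) (fun ms => f (some (truncate ρ (interleave W ms)))) +
        ENNReal.ofReal δ := by
  obtain ⟨d, -⟩ := List.exists_mem_of_ne_nil W hW
  have hgs := hadm.sum_midpointWeight_ne_zero
  have hgl := length_zip_tail W
  have hWpos := List.length_pos_iff.2 hW
  set gs := W.zip W.tail with hgsdef
  set F : List X → ℝ≥0∞ := fun ms => f (some (truncate ρ (interleave W ms))) with hF
  set K : List X → ℕ := fun ms => truncLength ρ (interleave W ms) / 2 with hKdef
  rw [level_eq, expect_andThen, expect_sampleMidpoints hgs]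
  simp only [Option.elim]
  -- The number of rearranged midpoints is itself random. It is fixed by splitting into the events
  -- `K ms = j + 1`; these are invariant under the rearrangement of the first `j` midpoints, so
  -- their indicators can go inside `rearrange`.
  calc midExpect H gs (fun ms => expect (placeMidpoints sampler H W ms
          (truncLength ρ (interleave W ms)) (truncLength ρ (interleave W ms) / 2)) f)
      ≤ midExpect H gs (fun ms => ((if K ms = 0 then F ms else 0) +
          ∑ j ∈ Finset.range gs.length,
            rearrange H gs d j (fun ms => if K ms = j + 1 then F ms else 0) ms) +
          ENNReal.ofReal δ) := by
        refine midExpect_mono_on fun ms hms => ?_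
        refine (expect_placeMidpoints_le (d := d) hs ρ hW hms hf).trans (add_le_add ?_ le_rfl)
        have hml : gs.length = ms.length := hms.length_eq
        have hlen : W.length = ms.length + 1 := by omega
        have hN := truncLength_le ρ (interleave W ms)
        rw [length_interleave (by omega)] at hN
        rcases hK : truncLength ρ (interleave W ms) / 2 with _ | j
        · have : K ms = 0 := hK
          rw [if_pos this]
          exact le_add_right le_rfl
        · have hj : j < ms.length := by omega
          refine le_add_left ((le_of_eq ?_).trans (Finset.single_le_sum
            (f := fun j => rearrange H gs d j (fun ms => if K ms = j + 1 then F ms else 0) ms)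
            (fun _ _ => zero_le) (Finset.mem_range.2 (hml ▸ hj))))
          simp only [rearrange]
          refine Finset.sum_congr rfl fun σ _ => ?_
          have hLp := toList_perm (ms.take j)
          have hLlen : (Multiset.toList (↑(ms.take j) : Multiset X)).length = j := by
            rw [hLp.length_eq]; simp; omega
          have := (truncate_interleave_rearranged hlen
            ((ofFn_getD_perm hLlen σ.symm d).trans hLp).symm hj hK).1
          rw [if_pos]
          rw [hKdef]
          simp only
          rw [this, hK]
    _ = midExpect H gs (fun ms => (if K ms = 0 then F ms else 0) +
          ∑ j ∈ Finset.range gs.length, if K ms = j + 1 then F ms else 0) +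
          ENNReal.ofReal δ := by
        rw [midExpect_add, midExpect_add, midExpect_add, midExpect_const hgs, midExpect_sum,
          midExpect_sum]
        congr 2
        refine Finset.sum_congr rfl fun j hj => ?_
        -- On each event a fixed number of midpoints is rearranged, which preserves their law.
        exact midExpect_rearrange H d (Finset.mem_range.1 hj).le _
    _ ≤ midExpect H gs F + ENNReal.ofReal δ := by
        refine add_le_add (midExpect_mono_on fun ms _ => ?_) le_rfl
        rcases hK : K ms with _ | j
        · simp
        · simp only [Nat.add_eq_zero_iff, one_ne_zero, and_false, if_false, zero_add,
            Nat.add_right_cancel_iff]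
          rw [Finset.sum_ite_eq]
          split_ifs <;> simp

lemma Admissible.truncate {Y : Type*} {M : Matrix Y Y ℝ≥0} {z : List Y} (h : Admissible M z) (ρ : ℕ) :
    Admissible M (truncate ρ z) :=
  List.IsChain.take h _

lemma zip_tail_take {Y : Type*} (W : List Y) (k : ℕ) :
    (W.take k).zip (W.take k).tail = (W.zip W.tail).take (k - 1) := by
  induction W generalizing k with
  | nil => simp
  | cons x W ih =>
    rcases k with _ | _ | k
    · simp
    · simp
    · cases W with
      | nil => simp
      | cons y W =>
        have := ih (k + 1)
        simp only [List.take_succ_cons, List.tail_cons, List.zip_cons_cons, Nat.add_sub_cancel]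
          at this ⊢
        rw [this]

/-- The levels of the walk, compared with the truncated trajectory of the Markov chain. -/
lemma pathExpect_fillLevels_le {sampler : MatchingSampler} {δ : ℝ} (hs : sampler.ErrorAtMost δ)
    (ρ : ℕ) {M : Matrix X X ℝ≥0} (hM : Stochastic M) (r k : ℕ) (x : X)
    {f : Option (List X) → ℝ≥0∞} (hf : ∀ o, f o ≤ 1) :
    pathExpect (M ^ 2 ^ r) k x (fun y => expect (fillLevels sampler ρ M r (truncate ρ y)) f) ≤
      pathExpect M (2 ^ r * k) x (fun y => f (some (truncate ρ y))) + r * ENNReal.ofReal δ := by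
  induction r generalizing k with
  | zero => simp [fillLevels, expect_pure]
  | succ r ih =>
    set H := M ^ 2 ^ r with hH
    have hpow : M ^ 2 ^ (r + 1) = H * H := by rw [hH, ← pow_add]; ring_nf
    set f' : Option (List X) → ℝ≥0∞ :=
      fun o => o.elim (f none) fun W => expect (fillLevels sampler ρ M r W) f with hf'
    have hf'1 : ∀ o, f' o ≤ 1 := by
      rintro (_ | W)
      · exact hf none
      · exact expect_le_one hf
    rw [hpow]
    have hHH : Stochastic (H * H) := (hM.pow _).mul (hM.pow _)
    calc pathExpect (H * H) k x
          (fun y => expect (fillLevels sampler ρ M (r + 1) (truncate ρ y)) f)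
        ≤ pathExpect (H * H) k x (fun y => expect (sampleMidpoints H (y.zip y.tail))
            (fun o => o.elim 0 fun ms => f' (some (truncate ρ (interleave y ms)))) +
              ENNReal.ofReal δ) := by
          refine pathExpect_mono_on fun l hl hadm => ?_
          rw [fillLevels, expect_andThen]
          refine (expect_level_le hs ρ (truncate_cons_ne_nil ρ x l) (hadm.truncate ρ) hf'1).trans ?_
          refine add_le_add (le_of_eq ?_) le_rfl
          have hgs := hadm.sum_midpointWeight_ne_zero
          -- Midpoints for the gaps beyond the truncation point may be drawn as well: they are
          -- independent of the others and are cut off again.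
          rw [expect_sampleMidpoints hgs, truncate, zip_tail_take, midExpect_take hgs]
          refine midExpect_congr_on fun ms hms => ?_
          have h1 : ((x :: l).zip (x :: l).tail).length = ms.length := hms.length_eq
          rw [length_zip_tail] at h1
          have := truncate_interleave_truncate (ρ := ρ) (W := x :: l) (ms := ms)
            (by simp at h1 ⊢; omega)
          simp only [Option.elim]
          rw [← this]
          rfl
      _ = pathExpect H (2 * k) x (fun y => expect (fillLevels sampler ρ M r (truncate ρ y)) f) +
            ENNReal.ofReal δ := by
          rw [pathExpect_add, pathExpect_const hHH,
            pathExpect_sampleMidpoints H k x 0 fun y => f' (some (truncate ρ y))]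
          rfl
      _ ≤ (pathExpect M (2 ^ r * (2 * k)) x (fun y => f (some (truncate ρ y))) +
            r * ENNReal.ofReal δ) + ENNReal.ofReal δ := add_le_add (ih (2 * k)) le_rfl
      _ = _ := by
          rw [add_assoc, show 2 ^ r * (2 * k) = 2 ^ (r + 1) * k by ring]
          push_cast
          ring

/-- The walk of a phase, compared with the truncated trajectory of the Markov chain. -/
lemma expect_phaseWalk_le {sampler : MatchingSampler} {δ : ℝ} (hs : sampler.ErrorAtMost δ)
    {ρ : ℕ} (hρ : 2 ≤ ρ) {M : Matrix X X ℝ≥0} (hM : Stochastic M) (r : ℕ) (x : X)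
    {f : Option (List X) → ℝ≥0∞} (hf : ∀ o, f o ≤ 1) :
    expect (phaseWalk sampler ρ r M x) f ≤
      pathExpect M (2 ^ r) x (fun y =>
        if min ρ (Fintype.card X) ≤ (truncate ρ y).toFinset.card then f (some (truncate ρ y))
        else f none) + r * ENNReal.ofReal δ := by
  set f' : Option (List X) → ℝ≥0∞ := fun o => o.elim (f none) fun W =>
    if min ρ (Fintype.card X) ≤ W.toFinset.card then f (some W) else f none with hf'
  have hf'1 : ∀ o, f' o ≤ 1 := by
    rintro (_ | W)
    · exact hf none
    · simp only [hf', Option.elim]; split_ifs <;> exact hf _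
  have h := pathExpect_fillLevels_le hs ρ hM r 1 x hf'1
  rw [mul_one] at h
  refine le_trans (le_of_eq ?_) h
  rw [phaseWalk, expect_andThen, expect_sampleWeighted (by rw [hM.pow]; exact one_ne_zero)]
  simp only [pathExpect, (hM.pow (2 ^ r)).coe_sum, div_one, Option.elim]
  refine Finset.sum_congr rfl fun y _ => ?_
  -- As `2 ≤ ρ`, the two end points are never truncated.
  have htr : truncate ρ [x, y] = [x, y] := by
    have : truncLength ρ [x, y] = 2 :=
      truncLength_eq one_le_two (by simp) (Or.inr (by simp; omega)) (Or.inl rfl)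
    simp [truncate, this]
  rw [htr, expect_andThen]
  congr 2
  ext o
  rcases o with _ | W
  · rfl
  · simp only [hf', Option.elim]
    split_ifs <;> rw [expect_pure]

end Level

/-! ### Rooted trees as parent functions -/

section RootedTree

variable {V : Type u}

/-- `φ` maps each vertex other than `v` to its parent in a spanning tree of `G` with root `v`. -/
structure IsParentMap (G : SimpleGraph V) (v : V) (φ : V → V) : Prop where
  root : φ v = v
  adj : ∀ u, u ≠ v → G.Adj u (φ u)
  exists_rank : ∃ rk : V → ℕ, ∀ u, u ≠ v → rk (φ u) < rk u

/-- The graph formed by the edges from the vertices other than `v` to their parents. -/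
def parentGraph (v : V) (φ : V → V) : SimpleGraph V :=
  SimpleGraph.fromEdgeSet {e | ∃ u, u ≠ v ∧ e = s(u, φ u)}

lemma IsParentMap.adj_parentGraph {G : SimpleGraph V} {v : V} {φ : V → V} (h : IsParentMap G v φ)
    {u : V} (hu : u ≠ v) : (parentGraph v φ).Adj u (φ u) :=
  (SimpleGraph.fromEdgeSet_adj _).2 ⟨⟨u, hu, rfl⟩, (h.adj u hu).ne⟩

lemma IsParentMap.reachable {G : SimpleGraph V} {v : V} {φ : V → V} (h : IsParentMap G v φ)
    (u : V) : (parentGraph v φ).Reachable u v := by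
  obtain ⟨rk, hrk⟩ := h.exists_rank
  induction hn : rk u using Nat.strong_induction_on generalizing u with
  | _ n ih =>
    by_cases hu : u = v
    · rw [hu]
    · exact (h.adj_parentGraph hu).reachable.trans (ih _ (hn ▸ hrk u hu) _ rfl)

lemma IsParentMap.connected {G : SimpleGraph V} {v : V} {φ : V → V} (h : IsParentMap G v φ) :
    (parentGraph v φ).Connected :=
  haveI : Nonempty V := ⟨v⟩
  ⟨fun a b => (h.reachable a).trans (h.reachable b).symm⟩

/-- A tree determines its orientation towards a root. -/
lemma IsParentMap.eq_of_parentGraph_eq {G : SimpleGraph V} {v : V} {φ ψ : V → V}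
    (hφ : IsParentMap G v φ) (hψ : IsParentMap G v ψ)
    (h : parentGraph v φ = parentGraph v ψ) : φ = ψ := by
  obtain ⟨rk, hrk⟩ := hφ.exists_rank
  funext u
  induction hn : rk u using Nat.strong_induction_on generalizing u with
  | _ n ih =>
    by_cases hu : u = v
    · rw [hu, hφ.root, hψ.root]
    · have h1 := hφ.adj_parentGraph hu
      rw [h] at h1
      obtain ⟨⟨a, ha, hae⟩, -⟩ := (SimpleGraph.fromEdgeSet_adj _).1 h1
      rcases Sym2.eq_iff.1 hae with ⟨rfl, h2⟩ | ⟨h2, rfl⟩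
      · exact h2
      -- If the common edge were oriented from `φ u` to `u` by `ψ`, the induction hypothesis at `φ
      -- u` would give `φ (φ u) = u`, against the decrease of the rank.
      · exfalso
        have h3 := ih _ (hn ▸ hrk u hu) (φ u) rfl
        rw [← h2] at h3
        have h4 := hrk u hu
        have h5 := hrk (φ u) ha
        rw [h3] at h5
        omega

/-- Parents are chosen closer to `v`. Their graph is a connected subgraph of `T`, hence all of it,
since a tree is minimal among connected graphs. -/
lemma exists_isParentMap {G T : SimpleGraph V} (hT : IsSpanningTree G T) (v : V) :
    ∃ φ, IsParentMap G v φ ∧ parentGraph v φ = T := by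
  obtain ⟨hTG, hTree⟩ := hT
  have hstep : ∀ u, ∃ w, u ≠ v → T.Adj u w ∧ T.dist w v < T.dist u v := by
    intro u
    by_cases hu : u = v
    · exact ⟨u, fun h => absurd hu h⟩
    · obtain ⟨p, hp⟩ := (hTree.connected u v).exists_walk_length_eq_dist
      cases p with
      | nil => exact absurd rfl hu
      | cons hadj q =>
        refine ⟨_, fun _ => ⟨hadj, ?_⟩⟩
        rw [SimpleGraph.Walk.length_cons] at hp
        have := SimpleGraph.dist_le q
        omega
  choose w hw using hstep
  refine ⟨fun u => if u = v then v else w u, ?_⟩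
  have hpar : IsParentMap G v fun u => if u = v then v else w u := by
    refine ⟨by simp, fun u hu => ?_, fun u => T.dist u v, fun u hu => ?_⟩
    · simpa [hu] using hTG (hw u hu).1
    · simpa [hu] using (hw u hu).2
  refine ⟨hpar, ?_⟩
  have hmin := (SimpleGraph.isTree_iff_minimal_connected.1 hTree)
  refine le_antisymm ?_ (hmin.2 hpar.connected ?_)
  all_goals
    intro a b hab
    obtain ⟨⟨c, hc, hce⟩, -⟩ := (SimpleGraph.fromEdgeSet_adj _).1 hab
    simp only [hc, if_false] at hce
    have h1 := (hw c hc).1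
    rcases Sym2.eq_iff.1 hce with ⟨rfl, rfl⟩ | ⟨rfl, rfl⟩
    · exact h1
    · exact h1.symm

/-- Moving the root from `y` to its neighbour `x`. -/
def moveRoot (φ : V → V) (y x : V) : V → V :=
  Function.update (Function.update φ y x) x x

lemma moveRoot_apply (φ : V → V) (y x u : V) :
    moveRoot φ y x u = if u = x then x else if u = y then x else φ u := by
  simp [moveRoot, Function.update_apply]

/-- The edge from `x` to its old parent is exchanged for the edge `xy`. Ranks stay valid after `x`
is put at the bottom and all others are raised by one. -/
lemma IsParentMap.moveRoot {G : SimpleGraph V} {x y : V} {φ : V → V} (h : IsParentMap G y φ)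
    (hxy : G.Adj x y) : IsParentMap G x (moveRoot φ y x) := by
  obtain ⟨rk, hrk⟩ := h.exists_rank
  refine ⟨by simp [moveRoot_apply], fun u hu => ?_, fun u => if u = x then 0 else rk u + 1,
    fun u hu => ?_⟩
  · rw [moveRoot_apply, if_neg hu]
    split_ifs with huy
    · exact huy ▸ hxy.symm
    · exact h.adj u huy
  · simp only [moveRoot_apply, if_neg hu]
    split_ifs with h1 h2 h3
    · omega
    · exact absurd rfl h2
    · omega
    · have := hrk u h1
      omega

/-- The tree before the root was moved to `v` is determined by the parent of `v` in it. -/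
lemma moveRoot_inj {G : SimpleGraph V} {v y y' : V} {φ φ' : V → V} (hφ : IsParentMap G y φ)
    (hφ' : IsParentMap G y' φ') (hv : v ≠ y) (hv' : v ≠ y')
    (h : moveRoot φ y v = moveRoot φ' y' v) (hp : φ v = φ' v) : y = y' ∧ φ = φ' := by
  have happ : ∀ u, u ≠ v → (if u = y then v else φ u) = if u = y' then v else φ' u := by
    intro u hu
    have := congrFun h u
    simpa [moveRoot_apply, hu] using this
  have hyy : y = y' := by
    -- If `y ≠ y'`, then `φ y' = v`. The `φ'`-path from the common parent of `v` ends at `y'`, and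
    -- up to there `φ` agrees with `φ'`. So under `φ` the vertex `v` would be an ancestor of its own
    -- parent.
    by_contra hne
    obtain ⟨rk, hrk⟩ := hφ.exists_rank
    obtain ⟨rk', hrk'⟩ := hφ'.exists_rank
    have hy1 : φ y' = v := by
      have := happ y' (Ne.symm hv')
      rwa [if_neg (Ne.symm hne), if_pos rfl] at this
    have hy2 : φ' y = v := by
      have := happ y (Ne.symm hv)
      rw [if_pos rfl, if_neg hne] at this
      exact this.symm
    have key : ∀ n u, rk' u = n → rk' u < rk' v → rk v < rk u := by
      intro n
      induction n using Nat.strong_induction_on with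
      | _ n ih =>
        intro u hn hu
        by_cases huy' : u = y'
        · have := hrk y' (Ne.symm hne)
          rw [hy1] at this
          rwa [huy']
        · have huv : u ≠ v := by rintro rfl; exact lt_irrefl _ hu
          have huy : u ≠ y := by
            rintro rfl
            have := hrk' u huy'
            rw [hy2] at this
            omega
          have he := happ u huv
          rw [if_neg huy, if_neg huy'] at he
          have h1 := hrk' u huy'
          have h2 := ih _ (by omega) (φ' u) rfl (by omega)
          have h3 := hrk u huy
          rw [he] at h3
          omega
    have h1 := key _ _ rfl (hrk' v hv')
    have h2 := hrk v hv
    rw [hp] at h2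
    omega
  subst hyy
  refine ⟨rfl, funext fun u => ?_⟩
  by_cases hu : u = v
  · rw [hu, hp]
  · by_cases huy : u = y
    · rw [huy, hφ.root, hφ'.root]
    · simpa [huy] using happ u hu

end RootedTree

/-! ### The first-visit tree of the simple random walk -/

section FirstVisitTree

variable {V : Type u} [Fintype V]

lemma simpleWalk_apply (G : SimpleGraph V) (x y : V) :
    simpleWalk G x y = (if G.Adj x y then 1 else 0) / (G.degree x : ℝ≥0) := by
  simp only [simpleWalk, transition]
  congr 1
  rw [Finset.sum_boole, ← SimpleGraph.card_neighborFinset_eq_degree,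
    SimpleGraph.neighborFinset_eq_filter]

lemma stochastic_simpleWalk {G : SimpleGraph V} (hG : ∀ x, G.degree x ≠ 0) :
    Stochastic (simpleWalk G) := by
  intro x
  have hd : (G.degree x : ℝ≥0) ≠ 0 := by exact_mod_cast hG x
  simp_rw [simpleWalk_apply, ← Finset.sum_div]
  rw [Finset.sum_boole, ← SimpleGraph.neighborFinset_eq_filter,
    SimpleGraph.card_neighborFinset_eq_degree, div_self hd]

/-- The probability that the walk of length `t` from `x` completes the visited set `U` and the
first-visit edges `E` to all of the vertices and the tree `T`. -/
def treeProb (G T : SimpleGraph V) : ℕ → Finset V → V → Finset (Sym2 V) → ℝ≥0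
  | 0, U, _, E => if U = Finset.univ ∧ SimpleGraph.fromEdgeSet (E : Set (Sym2 V)) = T then 1 else 0
  | t + 1, U, x, E => ∑ y, simpleWalk G x y *
      if y ∈ U then treeProb G T t U y E
      else treeProb G T t (insert y U) y (insert s(x, y) E)

/-- The expected number of rooted trees which are turned into `φ` by a walk of length `t` with
start `v` that moves the root to `v` in reverse. -/
def moveCount (G : SimpleGraph V) : ℕ → V → (V → V) → ℝ≥0
  | 0, _, _ => 1
  | t + 1, v, φ => ∑ y, simpleWalk G v y *
      ∑ φ' with IsParentMap G y φ' ∧ moveRoot φ' y v = φ, moveCount G t y φ'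

/-- The pairs of a root `y` adjacent to `v` and a tree `φ'` that turn into `φ` are distinguished by
the neighbour `φ' v` of `v` (`moveRoot_inj`). So there are at most `degree v` of them, each with
step probability `1 / degree v`. -/
lemma moveCount_le_one (G : SimpleGraph V) (t : ℕ) (v : V) (φ : V → V) :
    moveCount G t v φ ≤ 1 := by
  induction t generalizing v φ with
  | zero => exact le_rfl
  | succ t ih =>
    set s : Finset (Σ _ : V, V → V) := (G.neighborFinset v).sigma fun y =>
      Finset.univ.filter fun φ' => IsParentMap G y φ' ∧ moveRoot φ' y v = φ with hs
    have hcard : s.card ≤ G.degree v := by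
      rw [← SimpleGraph.card_neighborFinset_eq_degree]
      refine Finset.card_le_card_of_injOn (fun p => p.2 v) ?_ ?_
      · rintro ⟨y, φ'⟩ hp
        simp only [hs, Finset.coe_sigma, Set.mem_sigma_iff, Finset.mem_coe,
          SimpleGraph.mem_neighborFinset, Finset.mem_filter, Finset.mem_univ, true_and] at hp ⊢
        exact hp.2.1.adj v hp.1.ne
      · rintro ⟨y, φ'⟩ hp ⟨y', ψ⟩ hp' heq
        simp only [hs, Finset.coe_sigma, Set.mem_sigma_iff, Finset.mem_coe,
          SimpleGraph.mem_neighborFinset, Finset.mem_filter, Finset.mem_univ, true_and] at hp hp'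
        obtain ⟨rfl, rfl⟩ := moveRoot_inj hp.2.1 hp'.2.1 hp.1.ne hp'.1.ne
          (hp.2.2.trans hp'.2.2.symm) heq
        rfl
    calc moveCount G (t + 1) v φ
        ≤ ∑ y, simpleWalk G v y *
            ∑ φ' with IsParentMap G y φ' ∧ moveRoot φ' y v = φ, 1 := by
          rw [moveCount]
          gcongr
          exact ih _ _
      _ = (s.card : ℝ≥0) / G.degree v := by
          rw [hs, Finset.card_sigma, SimpleGraph.neighborFinset_eq_filter, Finset.sum_filter]
          push_cast
          rw [Finset.sum_div]
          refine Finset.sum_congr rfl fun y _ => ?_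
          rw [simpleWalk_apply]
          split_ifs
          · simp [div_eq_mul_inv, mul_comm]
          · simp
      _ ≤ 1 := by
          refine div_le_one_of_le₀ ?_ (by simp)
          exact_mod_cast hcard

/-- The recorded parents of the visited vertices, and the parents in the tree `φ'` of the other
ones. -/
def mixParents (U : Finset V) (φ φ' : V → V) : V → V :=
  fun u => if u ∈ U then φ u else φ' u

/-- The number of spanning trees. -/
def treeCount (G : SimpleGraph V) : ℕ :=
  (Finset.univ.filter (IsSpanningTree G)).card

lemma treeCount_le (G : SimpleGraph V) (v : V) :
    treeCount G ≤ (Finset.univ.filter (IsParentMap G v)).card := by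
  refine Finset.card_le_card_of_surjOn (parentGraph v) fun T hT => ?_
  simp only [Finset.coe_filter, Finset.mem_univ, true_and, Set.mem_ofPred_eq] at hT
  obtain ⟨φ, h1, h2⟩ := exists_isParentMap hT v
  exact ⟨φ, by simpa using h1, h2⟩

/-- An arbitrary spanning tree rooted at the end of the walk is added, and its root is moved back
along the walk. The last move that sets the parent of a vertex is the one at its first visit, so a
covering walk yields its first-visit tree whatever tree was added; this accounts for the factor
`treeCount G`. The induction removes the first step of the walk. -/
lemma treeCount_mul_treeProb_le (G T : SimpleGraph V) (v : V) (t : ℕ) {U : Finset V} {x : V}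
    {E : Finset (Sym2 V)} {φ : V → V} (hx : x ∈ U) (hv : v ∈ U)
    (hE : (E : Set (Sym2 V)) = {e | ∃ u ∈ U, u ≠ v ∧ e = s(u, φ u)}) :
    treeCount G * treeProb G T t U x E ≤
      ∑ φ' with IsParentMap G x φ' ∧ parentGraph v (mixParents U φ φ') = T, moveCount G t x φ' := by
  induction t generalizing U x E φ with
  | zero =>
    rw [treeProb]
    split_ifs with h
    · obtain ⟨rfl, hT⟩ := h
      have hmix : ∀ φ', parentGraph v (mixParents Finset.univ φ φ') = T := by
        intro φ'
        rw [← hT, hE, parentGraph]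
        simp [mixParents]
      simp only [hmix, and_true, moveCount, Finset.sum_const, mul_one, nsmul_eq_mul]
      exact_mod_cast treeCount_le G x
    · simp
  | succ t ih =>
    calc (treeCount G : ℝ≥0) * treeProb G T (t + 1) U x E
        = ∑ y, simpleWalk G x y * (treeCount G * if y ∈ U then treeProb G T t U y E
            else treeProb G T t (insert y U) y (insert s(x, y) E)) := by
          rw [treeProb, Finset.mul_sum]
          exact Finset.sum_congr rfl fun y _ => by ring
      _ ≤ ∑ y, simpleWalk G x y * ∑ φ' with IsParentMap G y φ' ∧
            parentGraph v (mixParents U φ (moveRoot φ' y x)) = T, moveCount G t y φ' := by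
          refine Finset.sum_le_sum fun y _ => mul_le_mul_right ?_ _
          split_ifs with hy
          -- The move changes parents of visited vertices only, and those are overridden by the
          -- recorded ones.
          · have hmix : ∀ φ', mixParents U φ (moveRoot φ' y x) = mixParents U φ φ' := by
              intro φ'
              funext u
              simp only [mixParents, moveRoot_apply]
              split_ifs with h1 h2 h3
              · rfl
              · exact absurd (h2 ▸ hx) h1
              · exact absurd (h3 ▸ hy) h1
              · rfl
            simp only [hmix]
            exact ih hy hv hE
          -- Here the move gives `y` the parent `x`, which is the first-visit edge now recorded.
          · have hmix : ∀ φ', mixParents U φ (moveRoot φ' y x) =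
                mixParents (insert y U) (Function.update φ y x) φ' := by
              intro φ'
              funext u
              simp only [mixParents, moveRoot_apply, Finset.mem_insert, Function.update_apply]
              by_cases h1 : u = y
              · subst h1
                have : u ≠ x := by rintro rfl; exact hy hx
                simp [hy, this]
              · by_cases h2 : u ∈ U
                · simp [h1, h2]
                · have : u ≠ x := by rintro rfl; exact h2 hx
                  simp [h1, h2, this]
            simp only [hmix]
            refine ih (Finset.mem_insert_self _ _) (Finset.mem_insert_of_mem hv) ?_
            have hyv : y ≠ v := by rintro rfl; exact hy hv
            ext e
            simp only [Finset.coe_insert, Set.mem_insert_iff, hE, Set.mem_ofPred_eq,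
              Finset.mem_insert]
            constructor
            · rintro (rfl | ⟨u, hu, huv, rfl⟩)
              · exact ⟨y, Or.inl rfl, hyv, by simp [Sym2.eq_swap]⟩
              · have : u ≠ y := by rintro rfl; exact hy hu
                exact ⟨u, Or.inr hu, huv, by simp [Function.update_of_ne this]⟩
            · rintro ⟨u, rfl | hu, huv, rfl⟩
              · left; simp [Sym2.eq_swap]
              · right
                have : u ≠ y := by rintro rfl; exact hy hu
                exact ⟨u, hu, huv, by simp [Function.update_of_ne this]⟩
      _ ≤ ∑ φ'' with IsParentMap G x φ'' ∧ parentGraph v (mixParents U φ φ'') = T,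
            moveCount G (t + 1) x φ'' := by
          simp only [moveCount]
          rw [Finset.sum_comm]
          refine Finset.sum_le_sum fun y _ => ?_
          rw [← Finset.mul_sum]
          by_cases hxy : G.Adj x y
          · refine mul_le_mul_right ?_ _
            -- The trees `φ'` are grouped by the tree into which they are moved.
            rw [← Finset.sum_biUnion]
            · refine Finset.sum_le_sum_of_subset fun φ' hφ' => ?_
              simp only [Finset.mem_filter, Finset.mem_univ, true_and] at hφ'
              simp only [Finset.mem_biUnion, Finset.mem_filter, Finset.mem_univ, true_and]
              exact ⟨_, ⟨hφ'.1.moveRoot hxy, hφ'.2⟩, hφ'.1, rfl⟩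
            · intro a _ b _ hab
              rw [Function.onFun, Finset.disjoint_left]
              intro φ' h1 h2
              simp only [Finset.mem_filter, Finset.mem_univ, true_and] at h1 h2
              exact hab (h1.2.symm.trans h2.2)
          · simp [simpleWalk_apply, hxy]

/-- The first-visit tree of the walk equals `T` with probability at most one over the number of
spanning trees. -/
lemma treeCount_mul_treeProb_le_one (G T : SimpleGraph V) (v : V) (t : ℕ) :
    treeCount G * treeProb G T t {v} v ∅ ≤ 1 := by
  refine (treeCount_mul_treeProb_le G T v t (φ := id) (Finset.mem_singleton_self v)
    (Finset.mem_singleton_self v) ?_).trans ?_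
  · ext e
    simp only [Finset.coe_empty, Set.mem_empty_iff_false, Finset.mem_singleton, Set.mem_ofPred_eq,
      false_iff, not_exists]
    rintro u ⟨h1, h2, -⟩
    exact h2 h1
  · refine (Finset.sum_le_sum fun φ' _ => moveCount_le_one G t v φ').trans ?_
    rw [Finset.sum_const, nsmul_eq_mul, mul_one]
    have hmix : ∀ φ', IsParentMap G v φ' → mixParents {v} id φ' = φ' := by
      intro φ' h
      funext u
      simp only [mixParents, Finset.mem_singleton]
      split_ifs with hu
      · rw [hu, h.root]; rfl
      · rfl
    have : (Finset.univ.filter fun φ' => IsParentMap G v φ' ∧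
        parentGraph v (mixParents {v} id φ') = T).card ≤ 1 := by
      rw [Finset.card_le_one]
      intro a ha b hb
      simp only [Finset.mem_filter, Finset.mem_univ, true_and] at ha hb
      rw [hmix a ha.1] at ha
      rw [hmix b hb.1] at hb
      exact ha.1.eq_of_parentGraph_eq hb.1 (ha.2.trans hb.2.symm)
    exact_mod_cast this

end FirstVisitTree

/-! ### Letting the length of the walk tend to infinity -/

section TreeLimit

variable {V : Type u} [Fintype V]

lemma treeProb_le_one {G : SimpleGraph V} (hG : ∀ x, G.degree x ≠ 0) (T : SimpleGraph V) (t : ℕ)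
    (U : Finset V) (x : V) (E : Finset (Sym2 V)) : treeProb G T t U x E ≤ 1 := by
  induction t generalizing U x E with
  | zero => rw [treeProb]; split_ifs <;> simp
  | succ t ih =>
    rw [treeProb, ← stochastic_simpleWalk hG x]
    refine Finset.sum_le_sum fun y _ => mul_le_of_le_one_right' ?_
    split_ifs <;> exact ih _ _ _

lemma treeProb_univ {G : SimpleGraph V} (hG : ∀ x, G.degree x ≠ 0) (T : SimpleGraph V) (t : ℕ)
    (x : V) (E : Finset (Sym2 V)) :
    treeProb G T t Finset.univ x E =
      if SimpleGraph.fromEdgeSet (E : Set (Sym2 V)) = T then 1 else 0 := by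
  induction t generalizing x with
  | zero => simp [treeProb]
  | succ t ih =>
    simp only [treeProb, Finset.mem_univ, if_true, ih, ← Finset.sum_mul]
    rw [stochastic_simpleWalk hG x, one_mul]

/-- Once all vertices are visited no further edge is recorded, so longer walks can only gain
probability. -/
lemma treeProb_mono {G : SimpleGraph V} (hG : ∀ x, G.degree x ≠ 0) (T : SimpleGraph V)
    (U : Finset V) (x : V) (E : Finset (Sym2 V)) : Monotone fun t => treeProb G T t U x E := by
  refine monotone_nat_of_le_succ fun t => ?_
  induction t generalizing U x E with
  | zero =>
    by_cases hU : U = Finset.univ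
    · subst hU
      rw [treeProb_univ hG, treeProb_univ hG]
    · simp [treeProb, hU]
  | succ t ih =>
    rw [treeProb, treeProb]
    refine Finset.sum_le_sum fun y _ => mul_le_mul_right ?_ _
    split_ifs <;> exact ih _ _ _

/-- The probability that the walk from `x` completes the visited set `U` and the first-visit
edges `E` to all of the vertices and the tree `T`. -/
def treeLimit (G T : SimpleGraph V) (U : Finset V) (x : V) (E : Finset (Sym2 V)) : ℝ≥0 :=
  ⨆ t, treeProb G T t U x E

lemma tendsto_treeProb {G : SimpleGraph V} (hG : ∀ x, G.degree x ≠ 0) (T : SimpleGraph V)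
    (U : Finset V) (x : V) (E : Finset (Sym2 V)) :
    Filter.Tendsto (fun t => treeProb G T t U x E) Filter.atTop (nhds (treeLimit G T U x E)) :=
  tendsto_atTop_ciSup (treeProb_mono hG T U x E)
    ⟨1, by rintro _ ⟨t, rfl⟩; exact treeProb_le_one hG T t U x E⟩

lemma treeLimit_univ {G : SimpleGraph V} (hG : ∀ x, G.degree x ≠ 0) (T : SimpleGraph V)
    (x : V) (E : Finset (Sym2 V)) :
    treeLimit G T Finset.univ x E =
      if SimpleGraph.fromEdgeSet (E : Set (Sym2 V)) = T then 1 else 0 := by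
  refine tendsto_nhds_unique (tendsto_treeProb hG T Finset.univ x E) ?_
  simp_rw [treeProb_univ hG]
  exact tendsto_const_nhds

/-- The value of a step of the walk from `x` to `y`. -/
def stepValue (Ψ : Finset V → V → Finset (Sym2 V) → ℝ≥0) (U : Finset V) (E : Finset (Sym2 V))
    (x y : V) : ℝ≥0 :=
  if y ∈ U then Ψ U y E else Ψ (insert y U) y (insert s(x, y) E)

/-- `Ψ` is harmonic for the simple random walk that records its first-visit edges. -/
def FirstVisitHarmonic (G : SimpleGraph V) (Ψ : Finset V → V → Finset (Sym2 V) → ℝ≥0) : Prop :=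
  ∀ U x E, Ψ U x E = ∑ y, simpleWalk G x y * stepValue Ψ U E x y

lemma firstVisitHarmonic_treeLimit {G : SimpleGraph V} (hG : ∀ x, G.degree x ≠ 0)
    (T : SimpleGraph V) : FirstVisitHarmonic G (treeLimit G T) := by
  intro U x E
  refine tendsto_nhds_unique ((Filter.tendsto_add_atTop_iff_nat 1).2 (tendsto_treeProb hG T U x E)) ?_
  simp only [treeProb, stepValue]
  refine tendsto_finsetSum _ fun y _ => Filter.Tendsto.const_mul _ ?_
  split_ifs <;> exact tendsto_treeProb hG T _ _ _

lemma treeCount_mul_treeLimit_le_one {G : SimpleGraph V} (hG : ∀ x, G.degree x ≠ 0)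
    (T : SimpleGraph V) (v : V) : treeCount G * treeLimit G T {v} v ∅ ≤ 1 :=
  le_of_tendsto ((tendsto_treeProb hG T {v} v ∅).const_mul _)
    (Filter.Eventually.of_forall fun t => treeCount_mul_treeProb_le_one G T v t)

end TreeLimit

/-! ### Potential theory of the graph Laplacian -/

section Potential

variable {V : Type u} [Fintype V]

/-- The graph Laplacian. -/
def lap (G : SimpleGraph V) (f : V → ℝ) (x : V) : ℝ :=
  G.degree x * f x - ∑ y ∈ G.neighborFinset x, f y

lemma lap_eq_sum (G : SimpleGraph V) (f : V → ℝ) (x : V) :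
    lap G f x = ∑ y ∈ G.neighborFinset x, (f x - f y) := by
  rw [lap, Finset.sum_sub_distrib, Finset.sum_const, SimpleGraph.card_neighborFinset_eq_degree,
    nsmul_eq_mul]

lemma lap_eq_mulVec (G : SimpleGraph V) (f : V → ℝ) (x : V) :
    lap G f x = (G.lapMatrix ℝ).mulVec f x := by
  rw [SimpleGraph.lapMatrix_mulVec_apply, lap]

lemma lap_sub (G : SimpleGraph V) (f g : V → ℝ) (x : V) :
    lap G (fun y => f y - g y) x = lap G f x - lap G g x := by
  simp only [lap, Finset.sum_sub_distrib]
  ring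

lemma sum_neighbor_comm (G : SimpleGraph V) (F : V → V → ℝ) :
    ∑ x, ∑ y ∈ G.neighborFinset x, F x y = ∑ y, ∑ x ∈ G.neighborFinset y, F x y :=
  Finset.sum_comm' fun x y => by simp [SimpleGraph.adj_comm]

/-- Green's identity. -/
lemma sum_mul_lap (G : SimpleGraph V) (f g : V → ℝ) :
    ∑ x, f x * lap G g x = ∑ x, lap G f x * g x := by
  have h := sum_neighbor_comm G fun x y => f x * g y
  simp only [lap, mul_sub, sub_mul, Finset.sum_sub_distrib, Finset.mul_sum, Finset.sum_mul]
  rw [h]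
  congr 1
  exact Finset.sum_congr rfl fun x _ => by ring

lemma sum_lap (G : SimpleGraph V) (f : V → ℝ) : ∑ x, lap G f x = 0 := by
  have h := sum_mul_lap G (fun _ => 1) f
  have h1 : ∀ x, lap G (fun _ => 1) x = 0 := fun x => by simp [lap_eq_sum]
  simpa [h1] using h

/-- The minimum principle. -/
lemma nonneg_of_lap_nonneg {G : SimpleGraph V} (hG : G.Connected) {S : Finset V}
    (hS : S.Nonempty) {f : V → ℝ} (hf : ∀ x, x ∉ S → 0 ≤ lap G f x) (hfS : ∀ x ∈ S, 0 ≤ f x)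
    (x : V) : 0 ≤ f x := by
  have : Nonempty V := ⟨x⟩
  obtain ⟨m, hm⟩ := Finite.exists_min f
  refine le_trans ?_ (hm x)
  by_contra hneg
  rw [not_le] at hneg
  -- A negative minimum is attained off `S`, where the sign of the Laplacian passes it on to all
  -- neighbours; by connectedness it would reach `S`.
  have hstep : ∀ a b, f a = f m → G.Adj a b → f b = f m := by
    intro a b ha hab
    have haS : a ∉ S := fun h => by have := hfS a h; linarith
    have h0 := hf a haS
    rw [lap_eq_sum] at h0
    have hle : ∀ y ∈ G.neighborFinset a, f a - f y ≤ 0 := fun y _ => by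
      have := hm y; linarith
    have hz := (Finset.sum_eq_zero_iff_of_nonpos hle).1 (le_antisymm (Finset.sum_nonpos hle) h0)
      b (by simpa using hab)
    linarith
  obtain ⟨s, hs⟩ := hS
  have hall : ∀ {a b : V} (p : G.Walk a b), f a = f m → f b = f m := by
    intro a b p
    induction p with
    | nil => exact id
    | cons h p ih => exact fun ha => ih (hstep _ _ ha h)
  obtain ⟨p⟩ := hG m s
  have := hall p rfl
  have := hfS s hs
  linarith

lemma eq_of_lap_eq {G : SimpleGraph V} (hG : G.Connected) {S : Finset V}
    (hS : S.Nonempty) {f g : V → ℝ} (hfg : ∀ x, x ∉ S → lap G f x = lap G g x)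
    (hS' : ∀ x ∈ S, f x = g x) : f = g := by
  funext x
  have h1 := nonneg_of_lap_nonneg hG hS (f := fun y => f y - g y)
    (fun x hx => by rw [lap_sub, hfg x hx, sub_self]) (fun x hx => by simp [hS' x hx]) x
  have h2 := nonneg_of_lap_nonneg hG hS (f := fun y => g y - f y)
    (fun x hx => by rw [lap_sub, hfg x hx, sub_self]) (fun x hx => by simp [hS' x hx]) x
  linarith

/-- The Dirichlet problem is solvable. -/
lemma exists_lap_eq {G : SimpleGraph V} (hG : G.Connected) {S : Finset V}
    (hS : S.Nonempty) (b : V → ℝ) :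
    ∃ f : V → ℝ, (∀ x ∈ S, f x = b x) ∧ ∀ x, x ∉ S → lap G f x = b x := by
  let A : (V → ℝ) →ₗ[ℝ] V → ℝ :=
    { toFun := fun f x => if x ∈ S then f x else lap G f x
      map_add' := fun f g => by
        funext x
        simp only [Pi.add_apply, lap, Finset.sum_add_distrib]
        split_ifs
        · rfl
        · ring
      map_smul' := fun c f => by
        funext x
        simp only [Pi.smul_apply, smul_eq_mul, lap, ← Finset.mul_sum, RingHom.id_apply]
        split_ifs
        · rfl
        · ring }
  -- Uniqueness makes this endomorphism of a finite-dimensional space injective, hence surjective.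
  have hinj : Function.Injective A := by
    intro f g h
    refine eq_of_lap_eq hG hS (fun x hx => ?_) fun x hx => ?_
    · have := congrFun h x
      simpa [A, hx] using this
    · have := congrFun h x
      simpa [A, hx] using this
  obtain ⟨f, hf⟩ := LinearMap.injective_iff_surjective.1 hinj b
  refine ⟨f, fun x hx => ?_, fun x hx => ?_⟩
  · have := congrFun hf x
    simpa [A, hx] using this
  · have := congrFun hf x
    simpa [A, hx] using this

/-! ### Hitting times -/

/-- The Dirichlet form. -/
lemma two_mul_sum_mul_lap (G : SimpleGraph V) (f g : V → ℝ) :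
    2 * ∑ x, f x * lap G g x =
      ∑ x, ∑ z ∈ G.neighborFinset x, (f x - f z) * (g x - g z) := by
  have h1 : ∑ x, f x * lap G g x = ∑ x, ∑ z ∈ G.neighborFinset x, f x * (g x - g z) := by
    simp_rw [lap_eq_sum, Finset.mul_sum]
  have h2 : ∑ x, f x * lap G g x = ∑ x, ∑ z ∈ G.neighborFinset x, f z * (g z - g x) := by
    rw [h1, sum_neighbor_comm]
  rw [two_mul]
  nth_rewrite 1 [h1]
  rw [h2]
  simp_rw [← Finset.sum_add_distrib]
  exact Finset.sum_congr rfl fun x _ => Finset.sum_congr rfl fun z _ => by ring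

/-- Along an edge, the expected hitting time of `y` varies by at most twice the square of the number
of vertices. -/
lemma sub_le_of_lap_eq_degree {G : SimpleGraph V} {y : V} {h : V → ℝ} (h0 : ∀ x, 0 ≤ h x)
    (hy : h y = 0) (hl : ∀ x, x ≠ y → lap G h x = G.degree x) {a b : V} (hab : G.Adj a b) :
    h a - h b ≤ 2 * (Fintype.card V : ℝ) ^ 2 := by
  rcases le_or_gt (h a) (h b) with hle | hlt
  · have : (0 : ℝ) ≤ (Fintype.card V : ℝ) ^ 2 := by positivity
    linarith
  -- The flux of `h` out of this superlevel set is the sum of the degrees in it, at most `n²`. All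
  -- edges contribute nonnegatively to the flux, so the edge `ab` alone is bounded by it. The factor
  -- two arises because only one orientation of `ab` is used.
  set U : Finset V := Finset.univ.filter fun x => h b < h x with hU
  have hyU : ∀ x ∈ U, x ≠ y := by
    rintro x hx rfl
    have := (Finset.mem_filter.1 hx).2
    have := h0 b
    linarith
  have hupper : ∑ x ∈ U, lap G h x ≤ (Fintype.card V : ℝ) ^ 2 := by
    calc ∑ x ∈ U, lap G h x = ∑ x ∈ U, (G.degree x : ℝ) :=
          Finset.sum_congr rfl fun x hx => hl x (hyU x hx)
      _ ≤ ∑ x ∈ U, (Fintype.card V : ℝ) := by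
          refine Finset.sum_le_sum fun x _ => ?_
          exact_mod_cast (G.degree_lt_card_verts x).le
      _ ≤ (Fintype.card V : ℝ) ^ 2 := by
          rw [Finset.sum_const, nsmul_eq_mul, sq]
          have : (U.card : ℝ) ≤ Fintype.card V := by exact_mod_cast Finset.card_le_univ U
          exact mul_le_mul_of_nonneg_right this (by positivity)
  set f : V → ℝ := fun x => if h b < h x then 1 else 0 with hf
  have hsum : ∑ x ∈ U, lap G h x = ∑ x, f x * lap G h x := by
    rw [hU, Finset.sum_filter]
    exact Finset.sum_congr rfl fun x _ => by simp [hf]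
  have hterm : ∀ x z, 0 ≤ (f x - f z) * (h x - h z) := by
    intro x z
    simp only [hf]
    split_ifs <;> nlinarith
  have hlower : h a - h b ≤ 2 * ∑ x ∈ U, lap G h x := by
    rw [hsum, two_mul_sum_mul_lap]
    calc h a - h b = (f a - f b) * (h a - h b) := by simp [hf, hlt]
      _ ≤ ∑ z ∈ G.neighborFinset a, (f a - f z) * (h a - h z) :=
          Finset.single_le_sum (f := fun z => (f a - f z) * (h a - h z))
            (fun z _ => hterm a z) (by simpa using hab)
      _ ≤ _ := Finset.single_le_sum
          (f := fun x => ∑ z ∈ G.neighborFinset x, (f x - f z) * (h x - h z))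
          (fun x _ => Finset.sum_nonneg fun z _ => hterm x z) (Finset.mem_univ a)
  linarith

/-- The expected hitting times of `y` are at most twice the cube of the number of vertices. -/
lemma exists_hittingTime {G : SimpleGraph V} (hG : G.Connected) (y : V) :
    ∃ h : V → ℝ, (∀ x, 0 ≤ h x) ∧ h y = 0 ∧ (∀ x, x ≠ y → lap G h x = G.degree x) ∧
      ∀ x, h x ≤ 2 * (Fintype.card V : ℝ) ^ 3 := by
  obtain ⟨h, hS, hl⟩ := exists_lap_eq hG (Finset.singleton_nonempty y)
    fun x => if x = y then 0 else (G.degree x : ℝ)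
  have hy : h y = 0 := by simpa using hS y (by simp)
  have hl' : ∀ x, x ≠ y → lap G h x = G.degree x := fun x hx => by
    simpa [hx] using hl x (by simpa using hx)
  have h0 : ∀ x, 0 ≤ h x := nonneg_of_lap_nonneg hG (Finset.singleton_nonempty y)
    (fun x hx => by rw [hl' x (by simpa using hx)]; positivity)
    (fun x hx => by rw [Finset.mem_singleton.1 hx, hy])
  refine ⟨h, h0, hy, hl', fun x => ?_⟩
  -- A path to `y` has fewer than `n` edges, and `h` drops by at most `2 n²` along each.
  obtain ⟨p, hp⟩ := (hG x y).exists_isPath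
  have hwalk : ∀ {a b : V} (p : G.Walk a b),
      h a ≤ h b + 2 * (Fintype.card V : ℝ) ^ 2 * p.length := by
    intro a b p
    induction p with
    | nil => simp
    | cons hadj p ih =>
      have := sub_le_of_lap_eq_degree h0 hy hl' hadj
      rw [SimpleGraph.Walk.length_cons]
      push_cast
      linarith
  have h1 := hwalk p
  have h2 : (p.length : ℝ) ≤ Fintype.card V := by exact_mod_cast hp.length_lt.le
  have h3 : 2 * (Fintype.card V : ℝ) ^ 2 * p.length ≤ 2 * (Fintype.card V : ℝ) ^ 2 * Fintype.card V :=
    mul_le_mul_of_nonneg_left h2 (by positivity)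
  rw [hy] at h1
  linarith [show 2 * (Fintype.card V : ℝ) ^ 2 * Fintype.card V = 2 * (Fintype.card V : ℝ) ^ 3 by ring]

end Potential

/-! ### The Schur complement graph -/

section Schur

variable {V : Type u} [Fintype V]

/-- `γ` vanishes on `S` except at `p`, where it is normalized, and is harmonic off `S`. Up to the
degree, `γ a` is the expected number of visits to `a` before the walk from `p` returns to `S`. -/
structure IsGreen (G : SimpleGraph V) (S : Finset V) (p : V) (γ : V → ℝ) : Prop where
  self : γ p = 1 / G.degree p
  off : ∀ q ∈ S, q ≠ p → γ q = 0
  lap_eq : ∀ x, x ∉ S → lap G γ x = 0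

lemma exists_isGreen {G : SimpleGraph V} (hG : G.Connected) {S : Finset V} {p : V} (hp : p ∈ S) :
    ∃ γ, IsGreen G S p γ := by
  obtain ⟨γ, h1, h2⟩ := exists_lap_eq hG ⟨p, hp⟩ fun x => if x = p then 1 / (G.degree p : ℝ) else 0
  refine ⟨γ, by simpa using h1 p hp, fun q hq hqp => by simpa [hqp] using h1 q hq, fun x hx => ?_⟩
  have hxp : x ≠ p := by rintro rfl; exact hx hp
  simpa [hxp] using h2 x hx

lemma IsGreen.nonneg {G : SimpleGraph V} (hG : G.Connected) {S : Finset V} {p : V} (hp : p ∈ S)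
    {γ : V → ℝ} (h : IsGreen G S p γ) (x : V) : 0 ≤ γ x := by
  refine nonneg_of_lap_nonneg hG ⟨p, hp⟩ (fun x hx => (h.lap_eq x hx).ge) (fun q hq => ?_) x
  by_cases hqp : q = p
  · rw [hqp, h.self]; positivity
  · rw [h.off q hq hqp]

lemma IsGreen.unique {G : SimpleGraph V} (hG : G.Connected) {S : Finset V} {p : V} (hp : p ∈ S)
    {γ γ' : V → ℝ} (h : IsGreen G S p γ) (h' : IsGreen G S p γ') : γ = γ' := by
  refine eq_of_lap_eq hG ⟨p, hp⟩ (fun x hx => by rw [h.lap_eq x hx, h'.lap_eq x hx]) fun q hq => ?_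
  by_cases hqp : q = p
  · rw [hqp, h.self, h'.self]
  · rw [h.off q hq hqp, h'.off q hq hqp]

lemma IsGreen.lap_of_ne {G : SimpleGraph V} {S : Finset V} {p q : V} {γ : V → ℝ}
    (h : IsGreen G S p γ) (hq : q ∈ S) (hqp : q ≠ p) :
    lap G γ q = -∑ a ∈ G.neighborFinset q, γ a := by
  rw [lap, h.off q hq hqp]
  ring

lemma sum_eq_of_off {S : Finset V} {p : V} (hp : p ∈ S) {F : V → ℝ} (hF : ∀ x, x ∉ S → F x = 0) :
    ∑ x, F x = F p + ∑ q ∈ S.erase p, F q := by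
  rw [Finset.add_sum_erase S F hp]
  exact (Finset.sum_subset (Finset.subset_univ S) fun x _ hx => hF x hx).symm

/-- The escape probability from `p` to the rest of `S`. -/
lemma IsGreen.lap_self {G : SimpleGraph V} {S : Finset V} {p : V} (hp : p ∈ S) {γ : V → ℝ}
    (h : IsGreen G S p γ) :
    lap G γ p = ∑ q ∈ S.erase p, ∑ a ∈ G.neighborFinset q, γ a := by
  have h1 := sum_lap G γ
  rw [sum_eq_of_off hp fun x hx => h.lap_eq x hx] at h1
  have h2 : ∑ q ∈ S.erase p, lap G γ q = -∑ q ∈ S.erase p, ∑ a ∈ G.neighborFinset q, γ a := by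
    rw [← Finset.sum_neg_distrib]
    exact Finset.sum_congr rfl fun q hq =>
      h.lap_of_ne (Finset.mem_of_mem_erase hq) (Finset.ne_of_mem_erase hq)
  linarith

lemma IsGreen.lap_self_le_one {G : SimpleGraph V} (hG : G.Connected) {S : Finset V} {p : V}
    (hp : p ∈ S) {γ : V → ℝ} (h : IsGreen G S p γ) : lap G γ p ≤ 1 := by
  have h1 : 0 ≤ ∑ a ∈ G.neighborFinset p, γ a := Finset.sum_nonneg fun a _ => h.nonneg hG hp a
  have h2 : (G.degree p : ℝ) * (1 / G.degree p) ≤ 1 := by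
    rw [mul_one_div]; exact div_self_le_one _
  rw [lap, h.self]
  linarith

lemma sum_split (S : Finset V) (F : V → ℝ) :
    ∑ x, F x = ∑ s : {x // x ∈ S}, F s + ∑ i : {x // x ∉ S}, F i := by
  convert (Fintype.sum_subtype_add_sum_subtype (fun x => x ∈ S) F).symm

/-- The Schur complement acts on the boundary values of a function that is harmonic off `S`. -/
lemma schurComplement_mulVec {G : SimpleGraph V} (hG : G.Connected) {S : Finset V}
    (hS : S.Nonempty) {f : V → ℝ} (hf : ∀ x, x ∉ S → lap G f x = 0) (q : S) :
    (schurComplement (G.lapMatrix ℝ) S).mulVec (fun s : S => f s) q = lap G f q := by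
  set L := G.lapMatrix ℝ with hL
  set K := L.toBlock (· ∉ S) (· ∉ S) with hK
  set fS : {x // x ∈ S} → ℝ := fun s => f s with hfS
  set fI : {x // x ∉ S} → ℝ := fun i => f i with hfI
  -- A function that vanishes on `S` and is harmonic off `S` is zero, so the interior block is
  -- injective.
  have hKunit : IsUnit K := by
    rw [← Matrix.mulVec_injective_iff_isUnit]
    have hext : ∀ g : {x // x ∉ S} → ℝ, ∀ i : {x // x ∉ S},
        K.mulVec g i = lap G (fun x => if hx : x ∉ S then g ⟨x, hx⟩ else 0) i := by
      intro g i
      rw [lap_eq_mulVec, ← hL, Matrix.mulVec, Matrix.mulVec, dotProduct, dotProduct, sum_split S]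
      have h1 : ∑ s : {x // x ∈ S}, L i s * (if hx : (s : V) ∉ S then g ⟨s, hx⟩ else 0) = 0 :=
        Finset.sum_eq_zero fun s _ => by simp [s.2]
      rw [h1, zero_add]
      refine Finset.sum_congr rfl fun j _ => ?_
      simp [hK, Matrix.toBlock_apply, j.2]
    intro g g' hgg
    have := eq_of_lap_eq hG hS (f := fun x => if hx : x ∉ S then g ⟨x, hx⟩ else 0)
      (g := fun x => if hx : x ∉ S then g' ⟨x, hx⟩ else 0)
      (fun x hx => by rw [← hext g ⟨x, hx⟩, ← hext g' ⟨x, hx⟩, hgg]) (fun x hx => by simp [hx])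
    funext i
    simpa [i.2] using congrFun this i
  -- Harmonicity off `S` is the interior block row of the linear system; solving it for the interior
  -- values gives the Schur complement.
  have hinner : K.mulVec fI = -(L.toBlock (· ∉ S) (· ∈ S)).mulVec fS := by
    funext i
    have h := hf i i.2
    rw [lap_eq_mulVec, Matrix.mulVec, dotProduct, sum_split S] at h
    simp only [Pi.neg_apply, Matrix.mulVec, dotProduct, hK, Matrix.toBlock_apply, hfS, hfI]
    linarith
  have hfIeq : K⁻¹.mulVec ((L.toBlock (· ∉ S) (· ∈ S)).mulVec fS) = -fI := by
    have h1 : (L.toBlock (· ∉ S) (· ∈ S)).mulVec fS = -K.mulVec fI := by rw [hinner, neg_neg]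
    rw [h1, Matrix.mulVec_neg, Matrix.mulVec_mulVec,
      Matrix.nonsing_inv_mul _ ((Matrix.isUnit_iff_isUnit_det _).1 hKunit), Matrix.one_mulVec]
  rw [schurComplement, Matrix.sub_mulVec, ← Matrix.mulVec_mulVec, ← Matrix.mulVec_mulVec, hfIeq,
    Matrix.mulVec_neg, sub_neg_eq_add, lap_eq_mulVec, ← hL]
  simp only [Pi.add_apply, Matrix.mulVec, dotProduct]
  rw [sum_split S]
  rfl

/-- On `S` the Green function is a multiple of the indicator of `p`, so it extracts one column. -/
lemma schurComplement_apply {G : SimpleGraph V} (hG : G.Connected) (hd : ∀ x, G.degree x ≠ 0)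
    {S : Finset V} {p : S} {γ : V → ℝ} (h : IsGreen G S p γ) (q : S) :
    schurComplement (G.lapMatrix ℝ) S q p = G.degree (p : V) * lap G γ q := by
  have hdp : (G.degree (p : V) : ℝ) ≠ 0 := by exact_mod_cast hd p
  have h1 := schurComplement_mulVec hG ⟨p, p.2⟩ h.lap_eq q
  rw [Matrix.mulVec, dotProduct, Finset.sum_eq_single p] at h1
  · rw [h.self] at h1
    rw [← h1]
    field_simp
  · intro s _ hs
    rw [h.off s s.2 fun e => hs (Subtype.ext e), mul_zero]
  · simp

lemma IsGreen.lap_symm {G : SimpleGraph V} {S : Finset V} {p q : V} (hp : p ∈ S) (hq : q ∈ S)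
    {γ γ' : V → ℝ} (h : IsGreen G S p γ) (h' : IsGreen G S q γ') :
    γ p * lap G γ' p = lap G γ q * γ' q := by
  have h1 := sum_mul_lap G γ γ'
  rw [sum_eq_of_off hp fun x hx => by rw [h'.lap_eq x hx, mul_zero],
    sum_eq_of_off hq fun x hx => by rw [h.lap_eq x hx, zero_mul],
    Finset.sum_eq_zero fun x hx => by
      rw [h.off x (Finset.mem_of_mem_erase hx) (Finset.ne_of_mem_erase hx), zero_mul],
    Finset.sum_eq_zero fun x hx => by
      rw [h'.off x (Finset.mem_of_mem_erase hx) (Finset.ne_of_mem_erase hx), mul_zero],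
    add_zero, add_zero] at h1
  exact h1

/-- The column formula involves the Green function of `q`. The symmetry `IsGreen.lap_symm` replaces
it by that of `p`, so that one function describes the whole row of `p`. -/
lemma coe_schurWeight {G : SimpleGraph V} (hG : G.Connected) (hd : ∀ x, G.degree x ≠ 0)
    {S : Finset V} {p q : S} (hpq : p ≠ q) {γ : V → ℝ} (h : IsGreen G S p γ) :
    (schurWeight G S p q : ℝ) = G.degree (p : V) * ∑ a ∈ G.neighborFinset (q : V), γ a := by
  obtain ⟨γ', h'⟩ := exists_isGreen hG q.2
  have hqp : (q : V) ≠ p := fun e => hpq (Subtype.ext e.symm)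
  have hdp : (G.degree (p : V) : ℝ) ≠ 0 := by exact_mod_cast hd p
  have hdq : (G.degree (q : V) : ℝ) ≠ 0 := by exact_mod_cast hd q
  have hs := h.lap_symm p.2 q.2 h'
  rw [h.self, h'.self, h.lap_of_ne q.2 hqp] at hs
  rw [schurWeight, if_neg hpq, schurComplement_apply hG hd h' p, Real.coe_toNNReal']
  have he : -((G.degree (q : V) : ℝ) * lap G γ' p) =
      G.degree (p : V) * ∑ a ∈ G.neighborFinset (q : V), γ a := by
    field_simp at hs
    linarith
  rw [he]
  exact max_eq_left (mul_nonneg (by positivity) (Finset.sum_nonneg fun a _ => h.nonneg hG p.2 a))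

lemma sum_subtype_ne {Y : Type*} {S : Finset Y} (p : S) (F : Y → ℝ) :
    ∑ q : S, (if p = q then 0 else F q) = ∑ q ∈ S.erase p, F q := by
  have h1 : ∀ q : S, (if p = q then 0 else F q) = if (q : Y) ≠ p then F q else 0 := by
    intro q
    by_cases h : p = q
    · simp [h]
    · have : (q : Y) ≠ p := fun e => h (Subtype.ext e.symm)
      simp [h, this]
  rw [Finset.sum_congr rfl fun q _ => h1 q,
    Finset.sum_coe_sort S fun q => if q ≠ (p : Y) then F q else 0, ← Finset.sum_filter]
  refine Finset.sum_congr ?_ fun _ _ => rfl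
  ext q
  simp [and_comm]

/-- The transition probabilities of the walk on the Schur complement graph. -/
lemma coe_transition_schurWeight {G : SimpleGraph V} (hG : G.Connected)
    (hd : ∀ x, G.degree x ≠ 0) {S : Finset V} {p : S} {γ : V → ℝ} (h : IsGreen G S p γ) (q : S) :
    (transition (schurWeight G S) p q : ℝ) =
      if p = q then 0 else (∑ a ∈ G.neighborFinset (q : V), γ a) / lap G γ p := by
  have hdp : (G.degree (p : V) : ℝ) ≠ 0 := by exact_mod_cast hd p
  have hw : ∀ q : S, (schurWeight G S p q : ℝ) =
      G.degree (p : V) * if p = q then 0 else ∑ a ∈ G.neighborFinset (q : V), γ a := by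
    intro q
    split_ifs with hpq
    · simp [schurWeight, hpq]
    · exact coe_schurWeight hG hd hpq h
  rw [transition]
  push_cast
  simp_rw [hw]
  rw [← Finset.mul_sum, sum_subtype_ne p fun q => ∑ a ∈ G.neighborFinset q, γ a, ← h.lap_self p.2,
    mul_div_mul_left _ _ hdp]
  split_ifs <;> simp

/-- The hitting times of the simple random walk satisfy the inequality for hitting times on the
Schur complement graph. -/
lemma IsGreen.one_le_lap_mul_sub {G : SimpleGraph V} (hG : G.Connected)
    (hd : ∀ x, G.degree x ≠ 0) {S : Finset V} {x y : V} (hx : x ∈ S) (hy : y ∈ S) (hxy : x ≠ y)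
    {γ : V → ℝ} (hγ : IsGreen G S x γ) {h : V → ℝ} (hl : ∀ z, z ≠ y → lap G h z = G.degree z) :
    1 ≤ lap G γ x * h x - ∑ q ∈ S.erase x, (∑ a ∈ G.neighborFinset q, γ a) * h q := by
  have hdx : (G.degree x : ℝ) ≠ 0 := by exact_mod_cast hd x
  -- In Green's identity for `γ` and `h` all terms `γ z * lap G h z` are nonnegative, as `γ`
  -- vanishes at `y`, and the term at `x` is already one.
  have h1 := sum_mul_lap G γ h
  rw [sum_eq_of_off hx (F := fun z => lap G γ z * h z)
    fun z hz => by rw [hγ.lap_eq z hz, zero_mul]] at h1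
  have h2 : ∑ q ∈ S.erase x, lap G γ q * h q =
      -∑ q ∈ S.erase x, (∑ a ∈ G.neighborFinset q, γ a) * h q := by
    rw [← Finset.sum_neg_distrib]
    refine Finset.sum_congr rfl fun q hq => ?_
    rw [hγ.lap_of_ne (Finset.mem_of_mem_erase hq) (Finset.ne_of_mem_erase hq), neg_mul]
  have h3 : ∀ z, 0 ≤ γ z * lap G h z := by
    intro z
    by_cases hz : z = y
    · rw [hz, hγ.off y hy (Ne.symm hxy), zero_mul]
    · rw [hl z hz]
      exact mul_nonneg (hγ.nonneg hG hx z) (by positivity)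
  have h4 : γ x * lap G h x ≤ ∑ z, γ z * lap G h z :=
    Finset.single_le_sum (f := fun z => γ z * lap G h z) (fun z _ => h3 z) (Finset.mem_univ x)
  rw [hl x hxy, hγ.self, one_div_mul_cancel hdx] at h4
  linarith

/-- Without escape from `x` the inequality for hitting times would read `1 ≤ 0`. -/
lemma IsGreen.lap_self_pos {G : SimpleGraph V} (hG : G.Connected)
    (hd : ∀ x, G.degree x ≠ 0) {S : Finset V} {x y : V} (hx : x ∈ S) (hy : y ∈ S) (hxy : x ≠ y)
    {γ : V → ℝ} (hγ : IsGreen G S x γ) : 0 < lap G γ x := by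
  obtain ⟨h, h0, -, hl, -⟩ := exists_hittingTime hG y
  have h1 := hγ.one_le_lap_mul_sub hG hd hx hy hxy hl
  have h2 : 0 ≤ ∑ q ∈ S.erase x, (∑ a ∈ G.neighborFinset q, γ a) * h q :=
    Finset.sum_nonneg fun q _ => mul_nonneg (Finset.sum_nonneg fun a _ => hγ.nonneg hG hx a) (h0 q)
  by_contra hneg
  have := mul_nonpos_of_nonpos_of_nonneg (not_lt.1 hneg) (h0 x)
  linarith

lemma stochastic_transition_schurWeight {G : SimpleGraph V} (hG : G.Connected)
    (hd : ∀ x, G.degree x ≠ 0) {S : Finset V} (hS : 2 ≤ S.card) :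
    Stochastic (transition (schurWeight G S)) := by
  intro p
  obtain ⟨γ, hγ⟩ := exists_isGreen hG p.2
  obtain ⟨y, hy, hyp⟩ := Finset.exists_mem_ne hS (p : V)
  have hpos := hγ.lap_self_pos hG hd p.2 hy (Ne.symm hyp)
  rw [← NNReal.coe_inj]
  push_cast
  simp_rw [coe_transition_schurWeight hG hd hγ]
  have := sum_subtype_ne p fun q => (∑ a ∈ G.neighborFinset q, γ a) / lap G γ p
  rw [this, ← Finset.sum_div, ← hγ.lap_self p.2, div_self hpos.ne']

/-- A chain for which all expected hitting times are at most `H`, in the form used below. -/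
def HittingBound {X : Type u} [Fintype X] (M : Matrix X X ℝ≥0) (H : ℝ) : Prop :=
  ∀ y, ∃ h : X → ℝ, (∀ x, 0 ≤ h x) ∧ (∀ x, h x ≤ H) ∧
    ∀ x, x ≠ y → 1 + ∑ z, (M x z : ℝ) * h z ≤ h x

lemma hittingBound_simpleWalk {G : SimpleGraph V} (hG : G.Connected) (hd : ∀ x, G.degree x ≠ 0) :
    HittingBound (simpleWalk G) (2 * (Fintype.card V : ℝ) ^ 3) := by
  intro y
  obtain ⟨h, h0, -, hl, hH⟩ := exists_hittingTime hG y
  refine ⟨h, h0, hH, fun x hx => ?_⟩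
  have hdx : (0 : ℝ) < G.degree x := by exact_mod_cast Nat.pos_of_ne_zero (hd x)
  have h1 := hl x hx
  rw [lap] at h1
  have h2 : ∑ z, (simpleWalk G x z : ℝ) * h z =
      (∑ z ∈ G.neighborFinset x, h z) / G.degree x := by
    rw [SimpleGraph.neighborFinset_eq_filter, Finset.sum_filter, Finset.sum_div]
    refine Finset.sum_congr rfl fun z _ => ?_
    rw [simpleWalk_apply]
    split_ifs
    · push_cast; ring
    · simp
  rw [h2, ← sub_nonneg]
  have : h x - (1 + (∑ z ∈ G.neighborFinset x, h z) / G.degree x) = 0 := by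
    field_simp
    linarith
  exact this.ge

/-- The hitting times of the simple walk on `G` still serve: a step of the Schur walk stands for at
least one step on `G`. Formally, `IsGreen.one_le_lap_mul_sub` is divided by the escape probability,
which lies in `(0, 1]`. -/
lemma hittingBound_schur {G : SimpleGraph V} (hG : G.Connected) (hd : ∀ x, G.degree x ≠ 0)
    (S : Finset V) :
    HittingBound (transition (schurWeight G S)) (2 * (Fintype.card V : ℝ) ^ 3) := by
  intro y
  obtain ⟨h, h0, -, hl, hH⟩ := exists_hittingTime hG (y : V)
  refine ⟨fun x => h x, fun x => h0 x, fun x => hH x, fun x hx => ?_⟩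
  have hxy : (x : V) ≠ y := fun e => hx (Subtype.ext e)
  obtain ⟨γ, hγ⟩ := exists_isGreen hG x.2
  have hpos := hγ.lap_self_pos hG hd x.2 y.2 hxy
  have hle := hγ.lap_self_le_one hG x.2
  have h1 := hγ.one_le_lap_mul_sub hG hd x.2 y.2 hxy hl
  have h2 : ∑ z : S, (transition (schurWeight G S) x z : ℝ) * h z =
      (∑ q ∈ S.erase x, (∑ a ∈ G.neighborFinset q, γ a) * h q) / lap G γ x := by
    rw [Finset.sum_div, ← sum_subtype_ne x fun q => (∑ a ∈ G.neighborFinset q, γ a) * h q / lap G γ x]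
    refine Finset.sum_congr rfl fun z _ => ?_
    rw [coe_transition_schurWeight hG hd hγ]
    split_ifs
    · simp
    · ring
  rw [h2]
  have h3 : lap G γ x + (∑ q ∈ S.erase x, (∑ a ∈ G.neighborFinset q, γ a) * h q) ≤
      lap G γ x * h x := by linarith
  have h4 := div_le_div_of_nonneg_right h3 hpos.le
  rwa [add_div, div_self hpos.ne', mul_div_cancel_left₀ _ hpos.ne'] at h4

end Schur

/-! ### The shortcut graph -/

section Shortcut

variable {V : Type u} [Fintype V]

/-- The probability that the walk from `p` is at `b` at time `k` and has not returned to `S`. -/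
def visitProb (G : SimpleGraph V) (S : Finset V) (p : V) : ℕ → V → ℝ≥0
  | 0, b => if b = p then 1 else 0
  | k + 1, b => if b ∈ S then 0 else ∑ a, visitProb G S p k a * simpleWalk G a b

/-- The weight of a path. -/
def pathWeight (G : SimpleGraph V) {k : ℕ} (x : Fin (k + 1) → V) : ℝ≥0 :=
  ∏ i : Fin k, simpleWalk G (x i.castSucc) (x i.succ)

lemma pathWeight_snoc (G : SimpleGraph V) {k : ℕ} (x : Fin (k + 1) → V) (z : V) :
    pathWeight G (Fin.snoc x z : Fin (k + 2) → V) =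
      pathWeight G x * simpleWalk G (x (Fin.last k)) z := by
  rw [pathWeight, Fin.prod_univ_castSucc, pathWeight]
  congr 1
  · refine Finset.prod_congr rfl fun i _ => ?_
    rw [Fin.succ_castSucc, Fin.snoc_castSucc (α := fun _ => V), Fin.snoc_castSucc (α := fun _ => V)]
  · rw [Fin.succ_last, Fin.snoc_last, Fin.snoc_castSucc (α := fun _ => V)]

lemma snoc_zero {Y : Type*} {k : ℕ} (x : Fin (k + 1) → Y) (z : Y) :
    (Fin.snoc x z : Fin (k + 2) → Y) 0 = x 0 := by
  rw [← Fin.castSucc_zero, Fin.snoc_castSucc (α := fun _ => Y)]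

lemma sum_snoc {k : ℕ} {A : Type*} [AddCommMonoid A] (F : (Fin (k + 2) → V) → A) :
    ∑ x, F x = ∑ z : V, ∑ x : Fin (k + 1) → V, F (Fin.snoc x z) := by
  rw [← (Fin.snocEquiv fun _ : Fin (k + 2) => V).sum_comp, Fintype.sum_prod_type]
  rfl

lemma sum_pathWeight (G : SimpleGraph V) (S : Finset V) (p : V) (k : ℕ) (b : V) :
    ∑ x : Fin (k + 1) → V, (if x 0 = p ∧ (∀ i : Fin (k + 1), 0 < (i : ℕ) → x i ∉ S) ∧
      x (Fin.last k) = b then pathWeight G x else 0) = visitProb G S p k b := by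
  induction k generalizing b with
  | zero =>
    rw [← (Equiv.funUnique (Fin 1) V).symm.sum_comp]
    simp only [visitProb]
    have : ∀ a : V, (if (Equiv.funUnique (Fin 1) V).symm a 0 = p ∧
        (∀ i : Fin 1, 0 < (i : ℕ) → (Equiv.funUnique (Fin 1) V).symm a i ∉ S) ∧
        (Equiv.funUnique (Fin 1) V).symm a (Fin.last 0) = b then
          pathWeight G ((Equiv.funUnique (Fin 1) V).symm a) else 0) =
        if a = b then (if b = p then 1 else 0) else 0 := by
      intro a
      simp only [Equiv.funUnique_symm_apply, uniqueElim_const, pathWeight,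
        Finset.univ_eq_empty, Finset.prod_empty]
      by_cases h1 : a = b
      · subst h1
        simp
      · simp [h1]
    rw [Finset.sum_congr rfl fun a _ => this a]
    simp
  | succ k ih =>
    rw [sum_snoc]
    have hterm : ∀ (z : V) (x : Fin (k + 1) → V),
        (if (Fin.snoc x z : Fin (k + 2) → V) 0 = p ∧
          (∀ i : Fin (k + 2), 0 < (i : ℕ) → (Fin.snoc x z : Fin (k + 2) → V) i ∉ S) ∧
          (Fin.snoc x z : Fin (k + 2) → V) (Fin.last (k + 1)) = b then
            pathWeight G (Fin.snoc x z : Fin (k + 2) → V) else 0) =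
        if z = b then (if b ∈ S then 0 else
          ∑ a, (if x 0 = p ∧ (∀ i : Fin (k + 1), 0 < (i : ℕ) → x i ∉ S) ∧ x (Fin.last k) = a
            then pathWeight G x else 0) * simpleWalk G a b) else 0 := by
      intro z x
      have hall : (∀ i : Fin (k + 2), 0 < (i : ℕ) → (Fin.snoc x z : Fin (k + 2) → V) i ∉ S) ↔
          (∀ i : Fin (k + 1), 0 < (i : ℕ) → x i ∉ S) ∧ z ∉ S := by
        rw [Fin.forall_fin_succ']
        simp [Fin.snoc_castSucc (α := fun _ => V)]
      simp only [hall, snoc_zero, Fin.snoc_last, pathWeight_snoc]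
      by_cases hz : z = b
      · subst hz
        by_cases hS : z ∈ S
        · simp [hS]
        · simp only [hS, not_false_eq_true, and_true, if_true, if_false]
          rw [Finset.sum_eq_single (x (Fin.last k))]
          · simp only [and_true]
            split_ifs <;> simp
          · intro a _ ha
            simp [Ne.symm ha]
          · simp
      · simp [hz]
    simp only [hterm]
    rw [Finset.sum_eq_single b (fun z _ hz => by simp [hz]) (by simp)]
    simp only [if_true, visitProb]
    split_ifs with hS
    · simp
    · rw [Finset.sum_comm]
      refine Finset.sum_congr rfl fun a _ => ?_
      rw [← Finset.sum_mul, ih]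

lemma sum_shortcut_paths (G : SimpleGraph V) (S : Finset V) (p b : V) (k : ℕ) :
    (∑ x : Fin (k + 2) → V,
      if x 0 = p ∧ (∀ i : Fin (k + 2), 0 < (i : ℕ) → (i : ℕ) < k + 1 → x i ∉ S) ∧
        x (Fin.last k).castSucc = b ∧ x (Fin.last (k + 1)) ∈ S
      then ((∏ i : Fin (k + 1), simpleWalk G (x i.castSucc) (x i.succ) : ℝ≥0) : ℝ≥0∞)
      else 0) = ((visitProb G S p k b * ∑ z ∈ S, simpleWalk G b z : ℝ≥0) : ℝ≥0∞) := by
  rw [sum_snoc]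
  have hterm : ∀ (z : V) (x : Fin (k + 1) → V),
      (if (Fin.snoc x z : Fin (k + 2) → V) 0 = p ∧
        (∀ i : Fin (k + 2), 0 < (i : ℕ) → (i : ℕ) < k + 1 →
          (Fin.snoc x z : Fin (k + 2) → V) i ∉ S) ∧
        (Fin.snoc x z : Fin (k + 2) → V) (Fin.last k).castSucc = b ∧
        (Fin.snoc x z : Fin (k + 2) → V) (Fin.last (k + 1)) ∈ S
      then ((pathWeight G (Fin.snoc x z : Fin (k + 2) → V) : ℝ≥0) : ℝ≥0∞) else 0) =
      (((if x 0 = p ∧ (∀ i : Fin (k + 1), 0 < (i : ℕ) → x i ∉ S) ∧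
        x (Fin.last k) = b then pathWeight G x else 0) *
        if z ∈ S then simpleWalk G b z else 0 : ℝ≥0) : ℝ≥0∞) := by
    intro z x
    have hall : (∀ i : Fin (k + 2), 0 < (i : ℕ) → (i : ℕ) < k + 1 →
        (Fin.snoc x z : Fin (k + 2) → V) i ∉ S) ↔
        ∀ i : Fin (k + 1), 0 < (i : ℕ) → x i ∉ S := by
      rw [Fin.forall_fin_succ']
      simp only [Fin.snoc_castSucc (α := fun _ => V), Fin.val_castSucc, Fin.val_last, lt_irrefl,
        false_imp_iff, imp_true_iff, and_true]
      exact ⟨fun h i h0 => h i h0 i.2, fun h i h0 _ => h i h0⟩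
    simp only [hall, snoc_zero, Fin.snoc_last, Fin.snoc_castSucc (α := fun _ => V), pathWeight_snoc]
    by_cases h1 : x (Fin.last k) = b
    · subst h1
      by_cases hz : z ∈ S <;> simp [hz]
      split_ifs <;> simp
    · simp [h1]
  change ∑ z, ∑ x : Fin (k + 1) → V, (if (Fin.snoc x z : Fin (k + 2) → V) 0 = p ∧
        (∀ i : Fin (k + 2), 0 < (i : ℕ) → (i : ℕ) < k + 1 →
          (Fin.snoc x z : Fin (k + 2) → V) i ∉ S) ∧
        (Fin.snoc x z : Fin (k + 2) → V) (Fin.last k).castSucc = b ∧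
        (Fin.snoc x z : Fin (k + 2) → V) (Fin.last (k + 1)) ∈ S
      then ((pathWeight G (Fin.snoc x z : Fin (k + 2) → V) : ℝ≥0) : ℝ≥0∞) else 0) = _
  simp only [hterm]
  rw [← sum_pathWeight]
  norm_cast
  simp_rw [← Finset.sum_mul, ← Finset.mul_sum]
  rw [Finset.sum_ite_mem, Finset.univ_inter]

lemma sum_mul_simpleWalk (G : SimpleGraph V) (f : V → ℝ) (b : V) :
    ∑ a, f a * (simpleWalk G a b : ℝ) = ∑ a ∈ G.neighborFinset b, f a / G.degree a := by
  rw [SimpleGraph.neighborFinset_eq_filter, Finset.sum_filter]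
  refine Finset.sum_congr rfl fun a _ => ?_
  rw [simpleWalk_apply, SimpleGraph.adj_comm]
  split_ifs
  · push_cast; ring
  · simp

/-- This is the recursion satisfied by the expected numbers of visits off `S`. -/
lemma IsGreen.degree_mul {G : SimpleGraph V} (hd : ∀ x, G.degree x ≠ 0) {S : Finset V} {p : V}
    {γ : V → ℝ} (h : IsGreen G S p γ) {b : V} (hb : b ∉ S) :
    G.degree b * γ b = ∑ a, (G.degree a * γ a) * (simpleWalk G a b : ℝ) := by
  have h1 := h.lap_eq b hb
  rw [lap] at h1
  rw [sum_mul_simpleWalk]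
  have h2 : ∀ a, (G.degree a : ℝ) * γ a / G.degree a = γ a := fun a =>
    mul_div_cancel_left₀ _ (by exact_mod_cast hd a)
  simp_rw [h2]
  linarith

/-- The expected number of visits to `b` before the return to `S`. -/
lemma hasSum_visitProb {G : SimpleGraph V} (hG : G.Connected) (hd : ∀ x, G.degree x ≠ 0)
    {S : Finset V} {p : V} (hp : p ∈ S) {γ : V → ℝ} (h : IsGreen G S p γ) (b : V) :
    HasSum (fun k => (visitProb G S p k b : ℝ)) (G.degree b * γ b) := by
  have hdr : ∀ x, (G.degree x : ℝ) ≠ 0 := fun x => by exact_mod_cast hd x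
  -- Partial sums stay below the Green function by induction on the horizon, which gives
  -- summability. The full sums then satisfy the equations of `IsGreen`, and uniqueness identifies
  -- them.
  have hbound : ∀ n b, ∑ k ∈ Finset.range n, (visitProb G S p k b : ℝ) ≤ G.degree b * γ b := by
    intro n
    induction n with
    | zero =>
      intro b
      simpa using mul_nonneg (Nat.cast_nonneg _) (h.nonneg hG hp b)
    | succ n ih =>
      intro b
      rw [Finset.sum_range_succ']
      by_cases hb : b ∈ S
      · have h0 : ∀ k, visitProb G S p (k + 1) b = 0 := fun k => by rw [visitProb, if_pos hb]
        rw [Finset.sum_eq_zero fun k _ => by rw [h0, NNReal.coe_zero], zero_add, visitProb]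
        split_ifs with hbp
        · rw [hbp, h.self, mul_one_div_cancel (hdr p)]; simp
        · rw [h.off b hb hbp]; simp
      · have hbp : b ≠ p := by rintro rfl; exact hb hp
        have h0 : visitProb G S p 0 b = 0 := by rw [visitProb, if_neg hbp]
        rw [h0, NNReal.coe_zero, add_zero, h.degree_mul hd hb]
        calc ∑ k ∈ Finset.range n, (visitProb G S p (k + 1) b : ℝ)
            = ∑ a, (∑ k ∈ Finset.range n, (visitProb G S p k a : ℝ)) * (simpleWalk G a b : ℝ) := by
              simp_rw [Finset.sum_mul]
              rw [Finset.sum_comm]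
              refine Finset.sum_congr rfl fun k _ => ?_
              rw [visitProb, if_neg hb]
              push_cast
              rfl
          _ ≤ _ := Finset.sum_le_sum fun a _ =>
              mul_le_mul_of_nonneg_right (ih a) (NNReal.coe_nonneg _)
  have hsum : ∀ b, Summable fun k => (visitProb G S p k b : ℝ) := fun b =>
    summable_of_sum_range_le (fun k => NNReal.coe_nonneg _) (fun n => hbound n b)
  set U : V → ℝ := fun b => ∑' k, (visitProb G S p k b : ℝ) with hU
  have hUrec : ∀ b, U b = (visitProb G S p 0 b : ℝ) + ∑' k, (visitProb G S p (k + 1) b : ℝ) :=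
    fun b => (hsum b).tsum_eq_zero_add
  have hUS : ∀ b ∈ S, U b = if b = p then 1 else 0 := by
    intro b hb
    have h0 : ∀ k, visitProb G S p (k + 1) b = 0 := fun k => by rw [visitProb, if_pos hb]
    rw [hUrec, tsum_congr fun k => by rw [h0, NNReal.coe_zero], tsum_zero, add_zero, visitProb]
    split_ifs <;> simp
  have hUoff : ∀ b, b ∉ S → U b = ∑ a, U a * (simpleWalk G a b : ℝ) := by
    intro b hb
    have hbp : b ≠ p := by rintro rfl; exact hb hp
    have h0 : visitProb G S p 0 b = 0 := by rw [visitProb, if_neg hbp]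
    rw [hUrec, h0, NNReal.coe_zero, zero_add]
    have h1 : ∀ k, (visitProb G S p (k + 1) b : ℝ) =
        ∑ a, (visitProb G S p k a : ℝ) * (simpleWalk G a b : ℝ) := by
      intro k
      rw [visitProb, if_neg hb]
      push_cast
      rfl
    simp_rw [h1]
    rw [Summable.tsum_finsetSum fun a _ => (hsum a).mul_right _]
    exact Finset.sum_congr rfl fun a _ => tsum_mul_right
  have hgreen : IsGreen G S p fun b => U b / G.degree b := by
    refine ⟨?_, fun q hq hqp => ?_, fun x hx => ?_⟩
    · rw [hUS p hp, if_pos rfl]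
    · rw [hUS q hq, if_neg hqp, zero_div]
    · rw [lap, mul_div_cancel₀ _ (hdr x), hUoff x hx, sum_mul_simpleWalk, sub_self]
  have hUγ : U b = G.degree b * γ b := by
    have := congrFun (h.unique hG hp hgreen) b
    rw [this, mul_div_cancel₀ _ (hdr b)]
  rw [← hUγ]
  exact (hsum b).hasSum

lemma sum_simpleWalk_mem (G : SimpleGraph V) (S : Finset V) (b : V) :
    ∑ z ∈ S, simpleWalk G b z = (degInto G S b : ℝ≥0) / G.degree b := by
  simp_rw [simpleWalk_apply, ← Finset.sum_div, Finset.sum_boole, degInto]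

/-- The transition probabilities of the shortcut graph. -/
lemma coe_shortcut {G : SimpleGraph V} (hG : G.Connected) (hd : ∀ x, G.degree x ≠ 0)
    {S : Finset V} {p : V} (hp : p ∈ S) {γ : V → ℝ} (h : IsGreen G S p γ) (b : V) :
    (shortcut G S p b : ℝ) = γ b * degInto G S b := by
  have hdb : (G.degree b : ℝ) ≠ 0 := by exact_mod_cast hd b
  have hs := (hasSum_visitProb hG hd hp h b).mul_right
    ((∑ z ∈ S, simpleWalk G b z : ℝ≥0) : ℝ)
  have hs' : HasSum (fun k => visitProb G S p k b * ∑ z ∈ S, simpleWalk G b z)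
      (⟨γ b * degInto G S b, mul_nonneg (h.nonneg hG hp b) (Nat.cast_nonneg _)⟩ : ℝ≥0) := by
    -- The expected visits to `b` are multiplied by the chance `degInto G S b / G.degree b` to enter
    -- `S` next.
    have he : G.degree b * γ b * ((∑ z ∈ S, simpleWalk G b z : ℝ≥0) : ℝ) =
        γ b * degInto G S b := by
      rw [sum_simpleWalk_mem]
      push_cast
      field_simp
    rw [he] at hs
    exact NNReal.hasSum_coe.1 hs
  rw [shortcut]
  simp_rw [sum_shortcut_paths]
  rw [← ENNReal.coe_tsum hs'.summable, ENNReal.toNNReal_coe, hs'.tsum_eq]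
  rfl

end Shortcut

/-! ### Walks that do not cover -/

section Cover

variable {X : Type u} [Fintype X]

/-- Since `h ≤ H`, the decrease of `h` by one per step is at least a decrease by `h / H`; so `h` is
contracted by `1 - 1 / H`. -/
lemma HittingBound.pathExpect_notMem_le {M : Matrix X X ℝ≥0} {H : ℝ} (hH : HittingBound M H)
    (hH1 : 1 ≤ H) (k : ℕ) (x y : X) :
    pathExpect M k x (fun l => if y ∈ l then 0 else 1) ≤
      ENNReal.ofReal (1 - 1 / H) ^ k * ENNReal.ofReal H := by
  obtain ⟨h, h0, hle, hstep⟩ := hH y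
  have hH0 : 0 < H := by linarith
  have hsum0 : ∀ x, 0 ≤ ∑ z, (M x z : ℝ) * h z := fun x =>
    Finset.sum_nonneg fun z _ => mul_nonneg (NNReal.coe_nonneg _) (h0 z)
  refine (SpanningTreeSampler.pathExpect_notMem_le (h := fun z => ENNReal.ofReal (h z))
    (c := ENNReal.ofReal (1 - 1 / H)) (fun z hz => ?_) (fun z hz => ?_) k x).trans
    (mul_le_mul_right (ENNReal.ofReal_le_ofReal (hle x)) _)
  · rw [ENNReal.one_le_ofReal]
    have := hstep z hz
    have := hsum0 z
    linarith
  · have hc : 0 ≤ 1 - 1 / H := by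
      rw [sub_nonneg, div_le_one hH0]; exact hH1
    have he : ∀ a, (M z a : ℝ≥0∞) * ENNReal.ofReal (h a) = ENNReal.ofReal ((M z a : ℝ) * h a) := by
      intro a
      rw [ENNReal.ofReal_mul (NNReal.coe_nonneg _), ENNReal.ofReal_coe_nnreal]
    simp_rw [he]
    rw [← ENNReal.ofReal_sum_of_nonneg fun a _ => mul_nonneg (NNReal.coe_nonneg _) (h0 a),
      ← ENNReal.ofReal_mul hc]
    refine ENNReal.ofReal_le_ofReal ?_
    have h1 := hstep z hz
    have h2 : h z / H ≤ 1 := by rw [div_le_one hH0]; exact hle z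
    have h3 : (1 - 1 / H) * h z = h z - h z / H := by ring
    rw [h3]
    linarith

/-- The probability of not covering all the states. -/
lemma HittingBound.pathExpect_not_cover_le {M : Matrix X X ℝ≥0} {H : ℝ} (hH : HittingBound M H)
    (hH1 : 1 ≤ H) (k : ℕ) (x : X) :
    pathExpect M k x (fun l => if ∀ y, y ∈ l then 0 else 1) ≤
      Fintype.card X * (ENNReal.ofReal (1 - 1 / H) ^ k * ENNReal.ofReal H) := by
  calc pathExpect M k x (fun l => if ∀ y, y ∈ l then 0 else 1)
      ≤ pathExpect M k x (fun l => ∑ y : X, 1 * if y ∈ l then 0 else 1) := by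
        refine pathExpect_mono fun l => ?_
        split_ifs with h
        · exact zero_le
        · push Not at h
          obtain ⟨y, hy⟩ := h
          refine le_trans ?_ (Finset.single_le_sum (f := fun y => 1 * if y ∈ l then (0 : ℝ≥0∞) else 1)
            (fun _ _ => zero_le) (Finset.mem_univ y))
          simp [hy]
    _ = ∑ y : X, 1 * pathExpect M k x (fun l => if y ∈ l then 0 else 1) :=
        pathExpect_sum_mul _ _ _ _ _ _
    _ ≤ ∑ _y : X, ENNReal.ofReal (1 - 1 / H) ^ k * ENNReal.ofReal H := by
        refine Finset.sum_le_sum fun y _ => ?_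
        rw [one_mul]
        exact hH.pathExpect_notMem_le hH1 k x y
    _ = _ := by simp

end Cover

/-! ### Stopped walks -/

section Stopped

/-- The walk up to the time at which it has visited, together with `Z`, at least `ρ` vertices. -/
def cutWalk {X : Type u} (ρ : ℕ) : Finset X → List X → List X
  | _, [] => []
  | Z, x :: l => if ρ ≤ (insert x Z).card then [x] else x :: cutWalk ρ (insert x Z) l

lemma exists_cutWalk_eq_take {X : Type u} (ρ : ℕ) (Z : Finset X) {z : List X} (hz : z ≠ []) :
    ∃ N, 1 ≤ N ∧ N ≤ z.length ∧ cutWalk ρ Z z = z.take N ∧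
      (N = 1 ∨ (Z ∪ (z.take (N - 1)).toFinset).card < ρ) ∧
      (N = z.length ∨ ρ ≤ (Z ∪ (z.take N).toFinset).card) := by
  induction z generalizing Z with
  | nil => exact absurd rfl hz
  | cons x l ih =>
    by_cases hρ : ρ ≤ (insert x Z).card
    · refine ⟨1, le_rfl, by simp, by simp [cutWalk, hρ], Or.inl rfl, Or.inr ?_⟩
      rw [Finset.insert_eq, Finset.union_comm] at hρ
      simpa using hρ
    · rcases eq_or_ne l [] with rfl | hl
      · exact ⟨1, le_rfl, by simp, by simp [cutWalk, hρ], Or.inl rfl, Or.inl rfl⟩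
      · obtain ⟨N, h1, h2, h3, h4, h5⟩ := ih (insert x Z) hl
        have hu : ∀ m, Z ∪ ((x :: l).take (m + 1)).toFinset = insert x Z ∪ (l.take m).toFinset := by
          intro m
          ext a
          simp only [List.take_succ_cons, List.toFinset_cons, Finset.mem_union, Finset.mem_insert]
          tauto
        refine ⟨N + 1, by omega, by simpa using h2, by simp [cutWalk, hρ, h3], Or.inr ?_, ?_⟩
        · obtain ⟨m, rfl⟩ : ∃ m, N = m + 1 := ⟨N - 1, by omega⟩
          rw [Nat.add_sub_cancel, hu]
          rcases h4 with h4 | h4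
          · obtain rfl : m = 0 := by omega
            simpa using hρ
          · simpa using h4
        · rw [hu]
          exact h5.imp (fun h => by simp [h]) id

/-- The recursive form makes truncation accessible to induction on the first step of the trajectory.
-/
lemma truncate_eq_cutWalk {X : Type u} (ρ : ℕ) (z : List X) : truncate ρ z = cutWalk ρ ∅ z := by
  rcases eq_or_ne z [] with rfl | hz
  · simp [truncate, cutWalk]
  · obtain ⟨N, h1, h2, h3, h4, h5⟩ := exists_cutWalk_eq_take ρ ∅ hz
    rw [Finset.empty_union] at h4 h5
    rw [h3, truncate, truncLength_eq h1 h2 h4 h5]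

lemma cutWalk_cons {X : Type u} (ρ : ℕ) (Z : Finset X) (x : X) (l : List X) :
    ∃ l', cutWalk ρ Z (x :: l) = x :: l' := by
  rw [cutWalk]
  split_ifs
  · exact ⟨[], rfl⟩
  · exact ⟨_, rfl⟩

variable {V : Type u}

/-- For each pair `(p, b)` of a list, a vertex `a` is drawn from `e p b`, and the edge `ab` is
recorded. -/
def recordEdges (e : V → V → PMF (Option V)) : List (V × V) → PMF (Option (Finset (Sym2 V)))
  | [] => PMF.pure (some ∅)
  | (p, b) :: l => andThen (e p b) fun a =>
      andThen (recordEdges e l) fun E => PMF.pure (some (insert s(a, b) E))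

lemma recordEdges_pure (l : List (V × V)) :
    recordEdges (fun p _ => PMF.pure (some p)) l =
      PMF.pure (some (l.map fun e => s(e.1, e.2)).toFinset) := by
  induction l with
  | nil => rfl
  | cons g l ih =>
    rw [recordEdges, ih]
    simp [andThen, PMF.pure_bind]

/-- The expected value of the state after the walk `W`. -/
def walkValue (e : V → V → PMF (Option V)) (Ψ : Finset V → V → Finset (Sym2 V) → ℝ≥0)
    (U : Finset V) (E : Finset (Sym2 V)) (Z : Finset V) (d : V) (W : List V) : ℝ≥0∞ :=
  -- A failed draw receives the value one, which bounds every test function.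
  expect (recordEdges e (firstVisits Z W)) fun o => o.elim 1 fun E' =>
    (Ψ (U ∪ W.toFinset) (W.getLastD d) (E ∪ E') : ℝ≥0∞)

lemma walkValue_singleton {e : V → V → PMF (Option V)}
    {Ψ : Finset V → V → Finset (Sym2 V) → ℝ≥0} {U : Finset V} {E : Finset (Sym2 V)}
    {Z : Finset V} {d p : V} (hp : p ∈ U) : walkValue e Ψ U E Z d [p] = Ψ U p E := by
  have : U ∪ {p} = U := Finset.union_eq_left.2 (by simpa using hp)
  simp [walkValue, firstVisits, recordEdges, expect_pure, this]

lemma walkValue_cons_of_mem {e : V → V → PMF (Option V)}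
    {Ψ : Finset V → V → Finset (Sym2 V) → ℝ≥0} {U : Finset V} {E : Finset (Sym2 V)}
    {Z : Finset V} {d p q : V} {W : List V} (hp : p ∈ U) (hq : q ∈ Z) :
    walkValue e Ψ U E Z d (p :: q :: W) = walkValue e Ψ U E Z d (q :: W) := by
  have : U ∪ (p :: q :: W).toFinset = U ∪ (q :: W).toFinset := by
    rw [List.toFinset_cons, Finset.union_insert, Finset.insert_eq_of_mem
      (Finset.mem_union_left _ hp)]
  rw [walkValue, this, firstVisits, if_pos hq]
  rfl

lemma walkValue_cons_of_notMem {e : V → V → PMF (Option V)}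
    {Ψ : Finset V → V → Finset (Sym2 V) → ℝ≥0} {U : Finset V} {E : Finset (Sym2 V)}
    {Z : Finset V} {d p q : V} {W : List V} (hp : p ∈ U) (hq : q ∉ Z) :
    walkValue e Ψ U E Z d (p :: q :: W) = expect (e p q) fun o => o.elim 1 fun a =>
      walkValue e Ψ (insert q U) (insert s(a, q) E) (insert q Z) d (q :: W) := by
  have : U ∪ (p :: q :: W).toFinset = insert q U ∪ (q :: W).toFinset := by
    ext a
    simp only [List.toFinset_cons, Finset.mem_union, Finset.mem_insert]
    constructor
    · rintro (h | rfl | h | h) <;> tauto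
    · tauto
  rw [walkValue, this, firstVisits, if_neg hq, recordEdges, expect_andThen]
  congr 1
  funext o
  rcases o with _ | a
  · rfl
  · simp only [Option.elim]
    rw [expect_andThen, walkValue]
    congr 1
    funext o
    rcases o with _ | E'
    · rfl
    · simp only [Option.elim]
      rw [expect_pure, Finset.insert_union s(a, q), ← Finset.union_insert s(a, q)]
      rfl

variable [Fintype V]

lemma sampleEdges_eq (G : SimpleGraph V) (S : Finset V) (l : List (V × V)) :
    sampleEdges G S l = recordEdges (fun p b => sampleWeighted fun a =>
      if G.Adj a b then shortcut G S p a * (1 / degInto G S a) else 0) l := by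
  induction l with
  | nil => rfl
  | cons g l ih => rw [sampleEdges, recordEdges, ih]

/-- The value of a walk on `X` that records first-visit edges is a supermartingale, and so is the
value of the stopped walk. -/
lemma pathExpect_walkValue_le {X : Type u} [Fintype X] {M : Matrix X X ℝ≥0} (hM : Stochastic M)
    (ι : X → V) {e : V → V → PMF (Option V)} {Ψ : Finset V → V → Finset (Sym2 V) → ℝ≥0}
    {U₀ : Finset V}
    (hstep : ∀ U p E, U₀ ⊆ U → ι p ∈ U → ∑ q, (M p q : ℝ≥0∞) *
      (if ι q ∈ U then (Ψ U (ι q) E : ℝ≥0∞) else expect (e (ι p) (ι q)) fun o => o.elim 1 fun a =>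
        (Ψ (insert (ι q) U) (ι q) (insert s(a, ι q) E) : ℝ≥0∞)) ≤ Ψ U (ι p) E)
    (ρ k : ℕ) (d : V) {p : X} {U Z : Finset V} {E : Finset (Sym2 V)} (Y : Finset X)
    (hU : U₀ ⊆ U) (hp : ι p ∈ U) (hZ : ∀ x, ι x ∈ Z ↔ ι x ∈ U) :
    pathExpect M k p (fun y => walkValue e Ψ U E Z d ((cutWalk ρ Y y).map ι)) ≤ Ψ U (ι p) E := by
  induction k generalizing p U Z E Y with
  | zero =>
    have : cutWalk ρ Y [p] = [p] := by simp [cutWalk]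
    rw [pathExpect, this, List.map_singleton, walkValue_singleton hp]
  | succ k ih =>
    by_cases hcut : ρ ≤ (insert p Y).card
    · have hc : ∀ l, cutWalk ρ Y (p :: l) = [p] := fun l => by rw [cutWalk, if_pos hcut]
      simp only [pathExpect, hc, List.map_singleton, walkValue_singleton hp, pathExpect_const hM]
      rw [← Finset.sum_mul, hM.coe_sum, one_mul]
    · refine le_trans ?_ (hstep U p E hU hp)
      refine Finset.sum_le_sum fun q _ => mul_le_mul_right ?_ _
      have hc : ∀ l, cutWalk ρ Y (p :: l) = p :: cutWalk ρ (insert p Y) l := fun l => by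
        rw [cutWalk, if_neg hcut]
      simp only [hc, List.map_cons]
      split_ifs with hq
      · refine le_trans (pathExpect_mono_on fun l _ _ => ?_) (ih (insert p Y) hU hq hZ)
        obtain ⟨l', hl'⟩ := cutWalk_cons ρ (insert p Y) q l
        -- The set `Z` known to the walk and the visited set `U` agree on the vertices that the walk
        -- can meet.
        rw [hl', List.map_cons, walkValue_cons_of_mem hp ((hZ q).2 hq)]
      · have hcongr : pathExpect M k q (fun l =>
            walkValue e Ψ U E Z d (ι p :: (cutWalk ρ (insert p Y) l).map ι)) =
            pathExpect M k q (fun l => ∑ o, (e (ι p) (ι q)) o * o.elim 1 fun a =>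
              walkValue e Ψ (insert (ι q) U) (insert s(a, ι q) E) (insert (ι q) Z) d
                ((cutWalk ρ (insert p Y) l).map ι)) := by
          refine pathExpect_congr_on fun l _ _ => ?_
          obtain ⟨l', hl'⟩ := cutWalk_cons ρ (insert p Y) q l
          rw [hl', List.map_cons, walkValue_cons_of_notMem hp fun h => hq ((hZ q).1 h),
            expect_fintype]
        rw [hcongr, pathExpect_sum_mul, expect_fintype]
        refine Finset.sum_le_sum fun o _ => mul_le_mul_right ?_ _
        rcases o with _ | a
        · simp only [Option.elim]
          rw [pathExpect_const hM]
        · simp only [Option.elim]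
          refine ih (insert p Y) (hU.trans (Finset.subset_insert _ _)) (Finset.mem_insert_self _ _)
            fun x => ?_
          rw [Finset.mem_insert, Finset.mem_insert, hZ x]

end Stopped

/-! ### The error of a phase -/

section Phase

variable {V : Type u} [Fintype V]

lemma FirstVisitHarmonic.sum_neighborFinset {G : SimpleGraph V} (hd : ∀ x, G.degree x ≠ 0)
    {Ψ : Finset V → V → Finset (Sym2 V) → ℝ≥0} (hΨ : FirstVisitHarmonic G Ψ) (U : Finset V)
    (E : Finset (Sym2 V)) (x : V) :
    ∑ y ∈ G.neighborFinset x, (stepValue Ψ U E x y : ℝ) = G.degree x * (Ψ U x E : ℝ) := by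
  have hdx : (G.degree x : ℝ) ≠ 0 := by exact_mod_cast hd x
  rw [hΨ U x E, SimpleGraph.neighborFinset_eq_filter, Finset.sum_filter]
  push_cast
  rw [Finset.mul_sum]
  refine Finset.sum_congr rfl fun y _ => ?_
  rw [simpleWalk_apply]
  split_ifs
  · push_cast; field_simp
  · simp

/-- The walk from `p`, stopped when it enters `S` at a vertex other than `p`. -/
lemma IsGreen.sum_mul_stepValue {G : SimpleGraph V} (hd : ∀ x, G.degree x ≠ 0) {S : Finset V}
    {p : V} (hp : p ∈ S) {γ : V → ℝ} (hγ : IsGreen G S p γ)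
    {Ψ : Finset V → V → Finset (Sym2 V) → ℝ≥0} (hΨ : FirstVisitHarmonic G Ψ) {U : Finset V}
    (hU : Sᶜ ⊆ U) (hpU : p ∈ U) (E : Finset (Sym2 V)) :
    ∑ q ∈ S.erase p, ∑ a ∈ G.neighborFinset q, γ a * (stepValue Ψ U E a q : ℝ) =
      lap G γ p * (Ψ U p E : ℝ) := by
  have hval : ∀ a y, y ∈ U → stepValue Ψ U E a y = Ψ U y E := fun a y hy => by
    rw [stepValue, if_pos hy]
  -- The value carried into `y` along edges, minus the value held there. Its total vanishes by
  -- harmonicity of `Ψ` at the tails of the edges. It is zero off `S`, where `γ` is harmonic and all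
  -- vertices are visited; it is `-(lap G γ p) * Ψ` at `p`, and elsewhere in `S` only the inflow
  -- remains because `γ = 0`.
  set D : V → ℝ := fun y => ∑ a ∈ G.neighborFinset y, γ a * (stepValue Ψ U E a y : ℝ) -
    G.degree y * γ y * (Ψ U y E : ℝ) with hD
  have hDU : ∀ y ∈ U, D y = -(lap G γ y * (Ψ U y E : ℝ)) := by
    intro y hy
    simp only [hD, hval _ y hy, ← Finset.sum_mul, lap]
    ring
  have hsum : ∑ y, D y = 0 := by
    rw [hD, Finset.sum_sub_distrib, sub_eq_zero,
      ← sum_neighbor_comm G fun a y => γ a * (stepValue Ψ U E a y : ℝ)]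
    refine Finset.sum_congr rfl fun a _ => ?_
    rw [← Finset.mul_sum, hΨ.sum_neighborFinset hd]
    ring
  rw [sum_eq_of_off hp fun x hx => by
    rw [hDU x (hU (Finset.mem_compl.2 hx)), hγ.lap_eq x hx, zero_mul, neg_zero], hDU p hpU] at hsum
  have he : ∑ q ∈ S.erase p, D q =
      ∑ q ∈ S.erase p, ∑ a ∈ G.neighborFinset q, γ a * (stepValue Ψ U E a q : ℝ) := by
    refine Finset.sum_congr rfl fun q hq => ?_
    rw [hD]
    simp only
    rw [hγ.off q (Finset.mem_of_mem_erase hq) (Finset.ne_of_mem_erase hq)]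
    ring
  linarith

/-- The weights from which the first-visit edges of a later phase are drawn. -/
lemma coe_edgeWeight {G : SimpleGraph V} (hG : G.Connected) (hd : ∀ x, G.degree x ≠ 0)
    {S : Finset V} {p q : V} (hp : p ∈ S) (hq : q ∈ S) {γ : V → ℝ} (hγ : IsGreen G S p γ) (a : V) :
    ((if G.Adj a q then shortcut G S p a * (1 / degInto G S a) else 0 : ℝ≥0) : ℝ) =
      if G.Adj q a then γ a else 0 := by
  rw [SimpleGraph.adj_comm]
  split_ifs with h
  · have h0 : (degInto G S a : ℝ) ≠ 0 := by
      -- The vertex `q` is itself a neighbour of `a` in `S`.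
      have : 0 < degInto G S a := Finset.card_pos.2 ⟨q, by simp [hq, h.symm]⟩
      exact_mod_cast this.ne'
    push_cast
    rw [coe_shortcut hG hd hp hγ]
    field_simp
  · rfl

/-- One step of the walk on the Schur complement graph, with the choice of the first-visit edge. -/
lemma schur_step_le {G : SimpleGraph V} (hG : G.Connected) (hd : ∀ x, G.degree x ≠ 0)
    {S : Finset V} (hS : 2 ≤ S.card) {Ψ : Finset V → V → Finset (Sym2 V) → ℝ≥0}
    (hΨ : FirstVisitHarmonic G Ψ) (U : Finset V) (p : S) (E : Finset (Sym2 V)) (hU : Sᶜ ⊆ U)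
    (hpU : (p : V) ∈ U) :
    ∑ q : S, (transition (schurWeight G S) p q : ℝ≥0∞) *
      (if (q : V) ∈ U then (Ψ U q E : ℝ≥0∞) else
        expect (sampleWeighted fun a =>
          if G.Adj a q then shortcut G S p a * (1 / degInto G S a) else 0) fun o =>
            o.elim 1 fun a => (Ψ (insert (q : V) U) q (insert s(a, (q : V)) E) : ℝ≥0∞)) ≤
      Ψ U p E := by
  obtain ⟨γ, hγ⟩ := exists_isGreen hG p.2
  obtain ⟨y, hy, hyp⟩ := Finset.exists_mem_ne hS (p : V)
  have hpos := hγ.lap_self_pos hG hd p.2 hy (Ne.symm hyp)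
  have hγ0 := hγ.nonneg hG p.2
  -- The total edge weight towards `q` is the numerator of the transition probability and the
  -- normalization of the draw, so it cancels.
  have hterm : ∀ q : S, (transition (schurWeight G S) p q : ℝ≥0∞) *
      (if (q : V) ∈ U then (Ψ U q E : ℝ≥0∞) else
        expect (sampleWeighted fun a =>
          if G.Adj a q then shortcut G S p a * (1 / degInto G S a) else 0) fun o =>
            o.elim 1 fun a => (Ψ (insert (q : V) U) q (insert s(a, (q : V)) E) : ℝ≥0∞)) =
      ENNReal.ofReal (if p = q then 0 else
        (∑ a ∈ G.neighborFinset (q : V), γ a * (stepValue Ψ U E a q : ℝ)) / lap G γ p) := by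
    intro q
    have htr := coe_transition_schurWeight hG hd hγ q
    by_cases hpq : p = q
    · rw [if_pos hpq] at htr
      have h0 : transition (schurWeight G S) p q = 0 := by exact_mod_cast htr
      rw [if_pos hpq, h0]; simp
    · rw [if_neg hpq] at htr
      rw [if_neg hpq]
      have htr' : (transition (schurWeight G S) p q : ℝ≥0∞) =
          ENNReal.ofReal ((∑ a ∈ G.neighborFinset (q : V), γ a) / lap G γ p) := by
        rw [← htr, ENNReal.ofReal_coe_nnreal]
      have hR0 : 0 ≤ ∑ a ∈ G.neighborFinset (q : V), γ a := Finset.sum_nonneg fun a _ => hγ0 a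
      rw [htr']
      by_cases hqU : (q : V) ∈ U
      · rw [if_pos hqU, ← ENNReal.ofReal_coe_nnreal, ← ENNReal.ofReal_mul (div_nonneg hR0 hpos.le)]
        congr 1
        simp only [stepValue, if_pos hqU]
        rw [← Finset.sum_mul]
        ring
      · rw [if_neg hqU]
        set w : V → ℝ≥0 := fun a =>
          if G.Adj a q then shortcut G S p a * (1 / degInto G S a) else 0 with hw
        have hwa : ∀ a, (w a : ℝ) = if G.Adj q a then γ a else 0 := fun a =>
          coe_edgeWeight hG hd p.2 q.2 hγ a
        have hwsum : ((∑ a, w a : ℝ≥0) : ℝ) = ∑ a ∈ G.neighborFinset (q : V), γ a := by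
          rw [SimpleGraph.neighborFinset_eq_filter, Finset.sum_filter]
          push_cast
          exact Finset.sum_congr rfl fun a _ => hwa a
        -- The draw would fail here, but then the step to `q` has probability zero.
        by_cases hR : ∑ a, w a = 0
        · have h1 : ∑ a ∈ G.neighborFinset (q : V), γ a = 0 := by rw [← hwsum, hR]; rfl
          have h2 : ∑ a ∈ G.neighborFinset (q : V), γ a * (stepValue Ψ U E a q : ℝ) = 0 := by
            refine Finset.sum_eq_zero fun a ha => ?_
            rw [(Finset.sum_eq_zero_iff_of_nonneg fun a _ => hγ0 a).1 h1 a ha, zero_mul]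
          rw [h1, h2]
          simp
        · have hRpos : 0 < ∑ a ∈ G.neighborFinset (q : V), γ a := by
            rw [← hwsum]
            exact_mod_cast pos_iff_ne_zero.2 hR
          rw [expect_sampleWeighted hR]
          simp only [Option.elim]
          have hws : ∑ a, (w a : ℝ≥0∞) = ENNReal.ofReal (∑ a ∈ G.neighborFinset (q : V), γ a) := by
            rw [← hwsum, ENNReal.ofReal_coe_nnreal]
            push_cast
            rfl
          have hta : ∀ a, (w a : ℝ≥0∞) / (∑ b, (w b : ℝ≥0∞)) *
              (Ψ (insert (q : V) U) q (insert s(a, (q : V)) E) : ℝ≥0∞) =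
              ENNReal.ofReal ((if G.Adj q a then γ a * (stepValue Ψ U E a q : ℝ) else 0) /
                ∑ a ∈ G.neighborFinset (q : V), γ a) := by
            intro a
            rw [hws, ← ENNReal.ofReal_coe_nnreal (p := w a), ← ENNReal.ofReal_div_of_pos hRpos,
              ← ENNReal.ofReal_coe_nnreal (p := Ψ _ _ _),
              ← ENNReal.ofReal_mul (div_nonneg (NNReal.coe_nonneg _) hR0), hwa]
            congr 1
            simp only [stepValue, if_neg hqU]
            split_ifs <;> ring
          rw [Finset.sum_congr rfl fun a _ => hta a, ← ENNReal.ofReal_sum_of_nonneg,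
            ← ENNReal.ofReal_mul (div_nonneg hR0 hpos.le), ← Finset.sum_div, ← Finset.sum_filter,
            ← SimpleGraph.neighborFinset_eq_filter]
          · congr 1
            field_simp
          · intro a _
            refine div_nonneg ?_ hR0
            split_ifs
            · exact mul_nonneg (hγ0 a) (NNReal.coe_nonneg _)
            · exact le_rfl
  rw [Finset.sum_congr rfl fun q _ => hterm q, ← ENNReal.ofReal_sum_of_nonneg,
    sum_subtype_ne p fun q =>
      (∑ a ∈ G.neighborFinset q, γ a * (stepValue Ψ U E a q : ℝ)) / lap G γ p,
    ← Finset.sum_div, hγ.sum_mul_stepValue hd p.2 hΨ hU hpU, mul_div_cancel_left₀ _ hpos.ne',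
    ENNReal.ofReal_coe_nnreal]
  intro q _
  split_ifs
  · exact le_rfl
  · exact div_nonneg (Finset.sum_nonneg fun a _ => mul_nonneg (hγ0 a) (NNReal.coe_nonneg _)) hpos.le

lemma simpleWalk_step_le {G : SimpleGraph V} {Ψ : Finset V → V → Finset (Sym2 V) → ℝ≥0}
    (hΨ : FirstVisitHarmonic G Ψ) (U : Finset V) (p : V) (E : Finset (Sym2 V)) :
    ∑ q, (simpleWalk G p q : ℝ≥0∞) *
      (if q ∈ U then (Ψ U q E : ℝ≥0∞) else
        expect (PMF.pure (some p)) fun o =>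
            o.elim 1 fun a => (Ψ (insert q U) q (insert s(a, q) E) : ℝ≥0∞)) ≤ Ψ U p E := by
  rw [hΨ U p E]
  push_cast
  refine Finset.sum_le_sum fun q _ => mul_le_mul_right ?_ _
  rw [stepValue]
  split_ifs
  · exact le_rfl
  · rw [expect_pure]; exact le_rfl

/-- The failure probability of a walk of length `k` for which expected hitting times are at
most `H`, on at most `n` states. -/
def coverError (n : ℕ) (H : ℝ) (k : ℕ) : ℝ≥0∞ :=
  n * (ENNReal.ofReal (1 - 1 / H) ^ k * ENNReal.ofReal H)

/-- The value of a function of the walk of a phase. -/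
lemma expect_phaseWalk_le_of_walkValue {X : Type u} [Fintype X] {sampler : MatchingSampler} {δ : ℝ}
    (hs : sampler.ErrorAtMost δ) {ρ : ℕ} (hρ : 2 ≤ ρ) {M : Matrix X X ℝ≥0} (hM : Stochastic M)
    {H : ℝ} (hH : HittingBound M H) (hH1 : 1 ≤ H) (r : ℕ)
    (ι : X → V) {e : V → V → PMF (Option V)} {Ψ : Finset V → V → Finset (Sym2 V) → ℝ≥0}
    {U : Finset V}
    (hstep : ∀ U' p E, U ⊆ U' → ι p ∈ U' → ∑ q, (M p q : ℝ≥0∞) *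
      (if ι q ∈ U' then (Ψ U' (ι q) E : ℝ≥0∞) else
        expect (e (ι p) (ι q)) fun o => o.elim 1 fun a =>
          (Ψ (insert (ι q) U') (ι q) (insert s(a, ι q) E) : ℝ≥0∞)) ≤ Ψ U' (ι p) E)
    {x : X} (hx : ι x ∈ U) {Z : Finset V} (hZ : ∀ x, ι x ∈ Z ↔ ι x ∈ U) (E : Finset (Sym2 V))
    (d : V) {f : Option (List X) → ℝ≥0∞} (hf : ∀ o, f o ≤ 1) {β : ℝ≥0∞}
    (hfβ : ∀ W : List X, x ∈ W → min ρ (Fintype.card X) ≤ W.toFinset.card →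
      f (some W) ≤ walkValue e Ψ U E Z d (W.map ι) + β) :
    expect (phaseWalk sampler ρ r M x) f ≤
      Ψ U (ι x) E + (β + (coverError (Fintype.card X) H (2 ^ r) + r * ENNReal.ofReal δ)) := by
  refine (expect_phaseWalk_le hs hρ hM r x hf).trans ?_
  rw [← add_assoc, ← add_assoc]
  refine add_le_add ?_ le_rfl
  calc pathExpect M (2 ^ r) x (fun y =>
        if min ρ (Fintype.card X) ≤ (truncate ρ y).toFinset.card then f (some (truncate ρ y))
        else f none)
      ≤ pathExpect M (2 ^ r) x (fun y =>
          (walkValue e Ψ U E Z d ((cutWalk ρ ∅ y).map ι) + β) +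
            if ∀ z, z ∈ y then 0 else 1) := by
        -- A truncated walk that passes the test is bounded by its value. One that does not pass
        -- comes from a trajectory that misses a vertex and is charged one.
        refine pathExpect_mono_on fun l _ _ => ?_
        split_ifs with h1 h2 h2
        · rw [add_zero, ← truncate_eq_cutWalk]
          refine hfβ _ ?_ h1
          obtain ⟨l', hl'⟩ := cutWalk_cons ρ ∅ x l
          rw [truncate_eq_cutWalk, hl']
          simp
        · rw [← truncate_eq_cutWalk]
          refine (hfβ _ ?_ h1).trans (le_add_right le_rfl)
          obtain ⟨l', hl'⟩ := cutWalk_cons ρ ∅ x l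
          rw [truncate_eq_cutWalk, hl']
          simp
        · exfalso
          refine h1 (le_trans (min_le_min_left ρ ?_) (min_le_card_truncate (x :: l)))
          have : (x :: l).toFinset = Finset.univ := by
            ext z
            simpa using h2 z
          rw [this, Finset.card_univ]
        · exact (hf none).trans (le_add_left le_rfl)
    _ ≤ _ := by
        rw [pathExpect_add, pathExpect_add, pathExpect_const hM]
        refine add_le_add (add_le_add ?_ le_rfl) (hH.pathExpect_not_cover_le hH1 _ x)
        exact pathExpect_walkValue_le hM ι hstep ρ _ d ∅ subset_rfl hx hZ

lemma coverError_mono {m n : ℕ} (h : m ≤ n) (H : ℝ) (k : ℕ) : coverError m H k ≤ coverError n H k :=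
  mul_le_mul_left (by exact_mod_cast h) _

/-- The value of the state after the first phase. -/
lemma expect_firstPhase_le {G : SimpleGraph V} (hG : G.Connected) (hd : ∀ x, G.degree x ≠ 0)
    {sampler : MatchingSampler} {δ : ℝ} (hs : sampler.ErrorAtMost δ) {ρ : ℕ} (hρ : 2 ≤ ρ) (r : ℕ)
    {Ψ : Finset V → V → Finset (Sym2 V) → ℝ≥0} (hΨ : FirstVisitHarmonic G Ψ) (w₀ : V)
    {g : Option (PhaseState V) → ℝ≥0∞} (hg : ∀ o, g o ≤ 1) {β : ℝ≥0∞}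
    (hgβ : ∀ s : PhaseState V, s.current ∈ s.visited →
      g (some s) ≤ Ψ s.visited s.current s.edges + β) :
    expect (firstPhase sampler ρ r G w₀) g ≤ Ψ {w₀} w₀ ∅ + (β +
      (coverError (Fintype.card V) (2 * (Fintype.card V : ℝ) ^ 3) (2 ^ r) +
        r * ENNReal.ofReal δ)) := by
  have hn : (1 : ℝ) ≤ 2 * (Fintype.card V : ℝ) ^ 3 := by
    have h1 : (1 : ℝ) ≤ Fintype.card V := by exact_mod_cast Fintype.card_pos_iff.2 ⟨w₀⟩
    have := one_le_pow₀ (n := 3) h1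
    linarith
  rw [firstPhase, expect_andThen]
  refine expect_phaseWalk_le_of_walkValue (e := fun p _ => PMF.pure (some p)) (Z := {w₀}) hs hρ
    (stochastic_simpleWalk hd) (hittingBound_simpleWalk hG hd) hn r id
    (fun U' p E _ _ => simpleWalk_step_le hΨ U' p E) (Finset.mem_singleton_self w₀)
    (fun x => Iff.rfl) ∅ w₀ ?_ ?_
  · rintro (_ | W)
    · exact hg none
    · exact expect_le_one hg
  · intro W hW _
    simp only [Option.elim, expect_pure]
    refine (hgβ _ ?_).trans (add_le_add (le_of_eq ?_) le_rfl)
    · simp only [List.mem_toFinset]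
      rcases W with _ | ⟨a, l⟩
      · simp at hW
      · rw [List.getLastD_cons]
        cases l using List.reverseRecOn with
        | nil => simp
        | append_singleton l b => simp
    · rw [walkValue, recordEdges_pure, expect_pure]
      have : {w₀} ∪ W.toFinset = W.toFinset :=
        Finset.union_eq_right.2 (by simpa using hW)
      simp [this]

lemma getLastD_mem {Y : Type*} (l : List Y) (d : Y) : l.getLastD d = d ∨ l.getLastD d ∈ l := by
  cases l using List.reverseRecOn with
  | nil => left; rfl
  | append_singleton l b => right; simp

/-- The number of vertices that have not been visited. -/
def unvisited (s : PhaseState V) : ℕ :=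
  s.visitedᶜ.card

lemma card_activeSet {s : PhaseState V} (hs : s.current ∈ s.visited) :
    (activeSet s).card = unvisited s + 1 := by
  rw [activeSet, Finset.card_insert_of_notMem (by simpa using hs), unvisited]

/-- Of the vertices of the walk only the current one was visited before, hence the loss of one from
`ρ`. -/
lemma unvisited_le {s : PhaseState V} {ρ : ℕ}
    {W : List V} (hWS : ∀ x ∈ W, x ∈ activeSet s)
    (hW : min ρ (unvisited s + 1) ≤ W.toFinset.card) :
    (s.visited ∪ W.toFinset)ᶜ.card + min (ρ - 1) (unvisited s) ≤ unvisited s := by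
  set N := W.toFinset.erase s.current with hN
  have h1 : N ⊆ s.visitedᶜ := by
    intro x hx
    obtain ⟨h2, h3⟩ := Finset.mem_erase.1 hx
    have := hWS x (List.mem_toFinset.1 h3)
    rw [activeSet, Finset.mem_insert] at this
    exact this.resolve_left h2
  have h2 : min (ρ - 1) (unvisited s) ≤ N.card := by
    have := Finset.pred_card_le_card_erase (s := W.toFinset) (a := s.current)
    rw [← hN] at this
    omega
  have h3 : (s.visited ∪ W.toFinset)ᶜ ⊆ s.visitedᶜ \ N := by
    intro x hx
    simp only [Finset.mem_compl, Finset.mem_union, not_or, Finset.mem_sdiff] at hx ⊢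
    exact ⟨hx.1, fun h => hx.2 (Finset.mem_of_mem_erase h)⟩
  have h4 := Finset.card_le_card h3
  rw [Finset.card_sdiff_of_subset h1] at h4
  have h5 := Finset.card_le_card h1
  rw [unvisited] at *
  omega

/-- The value of the state after a later phase. -/
lemma expect_laterPhase_le {G : SimpleGraph V} (hG : G.Connected) (hd : ∀ x, G.degree x ≠ 0)
    {sampler : MatchingSampler} {δ : ℝ} (hs : sampler.ErrorAtMost δ) {ρ : ℕ} (hρ : 2 ≤ ρ) (r : ℕ)
    {Ψ : Finset V → V → Finset (Sym2 V) → ℝ≥0} (hΨ : FirstVisitHarmonic G Ψ) {s : PhaseState V}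
    (hcur : s.current ∈ s.visited) (hun : s.visited ≠ Finset.univ)
    {g : Option (PhaseState V) → ℝ≥0∞} (hg : ∀ o, g o ≤ 1) {β : ℝ≥0∞}
    (hgβ : ∀ s' : PhaseState V, s'.current ∈ s'.visited →
      unvisited s' + min (ρ - 1) (unvisited s) ≤ unvisited s →
      g (some s') ≤ Ψ s'.visited s'.current s'.edges + β) :
    expect (laterPhase sampler ρ r G s) g ≤ Ψ s.visited s.current s.edges + (β +
      (coverError (Fintype.card V) (2 * (Fintype.card V : ℝ) ^ 3) (2 ^ r) +
        r * ENNReal.ofReal δ)) := by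
  have hn : (1 : ℝ) ≤ 2 * (Fintype.card V : ℝ) ^ 3 := by
    have h1 : (1 : ℝ) ≤ Fintype.card V := by exact_mod_cast Fintype.card_pos_iff.2 ⟨s.current⟩
    have := one_le_pow₀ (n := 3) h1
    linarith
  have hcard := card_activeSet hcur
  have hpos : 0 < unvisited s := by
    rw [unvisited, Finset.card_pos, Finset.nonempty_iff_ne_empty, Ne, Finset.compl_eq_empty_iff]
    exact hun
  have hS : 2 ≤ (activeSet s).card := by omega
  have hsub : (activeSet s)ᶜ ⊆ s.visited := by
    intro x hx
    simp only [activeSet, Finset.mem_compl, Finset.mem_insert, not_or, not_not] at hx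
    exact hx.2
  rw [laterPhase, expect_andThen]
  refine (expect_phaseWalk_le_of_walkValue (U := s.visited) (Z := {s.current})
    (E := s.edges) (d := s.current) (β := β)
    (e := fun p b => sampleWeighted fun a =>
      if G.Adj a b then shortcut G (activeSet s) p a * (1 / degInto G (activeSet s) a) else 0)
    hs hρ (stochastic_transition_schurWeight hG hd hS) (hittingBound_schur hG hd (activeSet s)) hn r
    (fun x : activeSet s => (x : V))
    (fun U' p E hU' hp => schur_step_le hG hd hS hΨ U' p E (hsub.trans hU') hp) hcur
    (fun x => ?_) ?_ ?_).trans ?_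
  · have := x.2
    simp only [activeSet, Finset.mem_insert, Finset.mem_compl] at this
    rw [Finset.mem_singleton]
    constructor
    · intro h; rwa [h]
    · intro h; exact this.resolve_right (not_not.2 h)
  · rintro (_ | W)
    · exact hg none
    · exact expect_le_one hg
  · intro W _ hW
    simp only [Option.elim]
    rw [expect_andThen, sampleEdges_eq, walkValue, ← expect_const (recordEdges _ _) β,
      ← expect_add]
    refine expect_mono fun o => ?_
    rcases o with _ | E
    · exact (hg none).trans (le_add_right le_rfl)
    · simp only [Option.elim]
      rw [expect_pure]
      refine hgβ _ ?_ ?_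
      · simp only [Finset.mem_union, List.mem_toFinset]
        rcases getLastD_mem (W.map Subtype.val) s.current with h | h
        · rw [h]; exact Or.inl hcur
        · exact Or.inr h
      · refine unvisited_le (fun x hx => ?_) ?_
        · obtain ⟨y, -, rfl⟩ := List.mem_map.1 hx
          exact y.2
        · rw [Fintype.card_coe, hcard] at hW
          refine hW.trans (le_of_eq ?_)
          have : (W.map Subtype.val).toFinset = W.toFinset.image Subtype.val := by
            ext x; simp
          rw [this, Finset.card_image_of_injective _ Subtype.val_injective]
          congr 2
          exact Subsingleton.elim _ _
  · refine add_le_add le_rfl (add_le_add le_rfl (add_le_add (coverError_mono ?_ _ _) le_rfl))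
    rw [Fintype.card_coe]
    exact Finset.card_le_univ _

/-! ### The error of the algorithm -/

/-- The expectation of `f` at the tree that completes the given data. -/
def treeValue (G : SimpleGraph V) (f : SimpleGraph V → ℝ≥0) (U : Finset V) (x : V)
    (E : Finset (Sym2 V)) : ℝ≥0 :=
  ∑ T, f T * treeLimit G T U x E

lemma firstVisitHarmonic_treeValue {G : SimpleGraph V} (hd : ∀ x, G.degree x ≠ 0)
    (f : SimpleGraph V → ℝ≥0) : FirstVisitHarmonic G (treeValue G f) := by
  intro U x E
  have h : ∀ y, stepValue (treeValue G f) U E x y =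
      ∑ T, f T * stepValue (treeLimit G T) U E x y := by
    intro y
    simp only [stepValue, treeValue]
    split_ifs <;> rfl
  simp only [h, treeValue, Finset.mul_sum]
  rw [Finset.sum_comm]
  refine Finset.sum_congr rfl fun T _ => ?_
  rw [firstVisitHarmonic_treeLimit hd T U x E, Finset.mul_sum]
  exact Finset.sum_congr rfl fun y _ => by ring

lemma treeValue_univ {G : SimpleGraph V} (hd : ∀ x, G.degree x ≠ 0)
    (f : SimpleGraph V → ℝ≥0) (x : V) (E : Finset (Sym2 V)) :
    treeValue G f Finset.univ x E = f (SimpleGraph.fromEdgeSet (E : Set (Sym2 V))) := by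
  simp [treeValue, treeLimit_univ hd]

/-- The error of one phase. -/
def phaseError (n r : ℕ) (δ : ℝ) : ℝ≥0∞ :=
  coverError n (2 * (n : ℝ) ^ 3) (2 ^ r) + r * ENNReal.ofReal δ

/-- The recursion is bounded by `fuel`, but the error counts only `j`: each successful phase either
finishes or visits at least `ρ - 1` new vertices. -/
lemma expect_laterPhases_le {G : SimpleGraph V} (hG : G.Connected) (hd : ∀ x, G.degree x ≠ 0)
    {sampler : MatchingSampler} {δ : ℝ} (hs : sampler.ErrorAtMost δ) {ρ : ℕ} (hρ : 2 ≤ ρ) (r : ℕ)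
    {f : SimpleGraph V → ℝ≥0} {F : Option (Finset (Sym2 V)) → ℝ≥0∞} (hF : ∀ o, F o ≤ 1)
    (hFf : ∀ E : Finset (Sym2 V), F (some E) = f (SimpleGraph.fromEdgeSet (E : Set (Sym2 V))))
    (fuel j : ℕ) {s : PhaseState V} (hcur : s.current ∈ s.visited) (hfuel : unvisited s ≤ fuel)
    (hj : unvisited s ≤ j * (ρ - 1)) :
    expect (laterPhases sampler ρ r G fuel s) F ≤
      treeValue G f s.visited s.current s.edges + j * phaseError (Fintype.card V) r δ := by
  induction fuel generalizing j s with
  | zero =>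
    have hun : s.visited = Finset.univ := by
      rw [← Finset.compl_eq_empty_iff, ← Finset.card_eq_zero]
      exact Nat.le_zero.1 hfuel
    rw [laterPhases, if_pos hun, expect_pure, hFf, hun, treeValue_univ hd]
    exact le_add_right le_rfl
  | succ fuel ih =>
    rw [laterPhases]
    split_ifs with hun
    · rw [expect_pure, hFf, hun, treeValue_univ hd]
      exact le_add_right le_rfl
    · have hpos : 0 < unvisited s := by
        rw [unvisited, Finset.card_pos, Finset.nonempty_iff_ne_empty, Ne, Finset.compl_eq_empty_iff]
        exact hun
      obtain ⟨i, rfl⟩ : ∃ i, j = i + 1 := by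
        refine ⟨j - 1, ?_⟩
        rcases j with _ | j
        · omega
        · rfl
      rw [expect_andThen]
      refine (expect_laterPhase_le hG hd hs hρ r (firstVisitHarmonic_treeValue hd f) hcur hun
        (g := fun o => o.elim (F none) fun s' => expect (laterPhases sampler ρ r G fuel s') F)
        (β := i * phaseError (Fintype.card V) r δ) ?_ ?_).trans ?_
      · rintro (_ | s')
        · exact hF none
        · exact expect_le_one hF
      · intro s' hcur' hun'
        refine ih i hcur' (by omega) ?_
        have : (i + 1) * (ρ - 1) = i * (ρ - 1) + (ρ - 1) := by ring
        omega
      · rw [phaseError]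
        push_cast
        rw [add_mul, one_mul]

/-- The expectation of a test function of the output of the phases. -/
lemma expect_phases_le {G : SimpleGraph V} (hG : G.Connected) (hd : ∀ x, G.degree x ≠ 0)
    {sampler : MatchingSampler} {δ : ℝ} (hs : sampler.ErrorAtMost δ) {ρ : ℕ} (hρ : 2 ≤ ρ) (r : ℕ)
    (w₀ : V) {f : SimpleGraph V → ℝ≥0} {F : Option (Finset (Sym2 V)) → ℝ≥0∞} (hF : ∀ o, F o ≤ 1)
    (hFf : ∀ E : Finset (Sym2 V), F (some E) = f (SimpleGraph.fromEdgeSet (E : Set (Sym2 V))))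
    {j : ℕ} (hj : Fintype.card V ≤ j * (ρ - 1)) :
    expect (andThen (firstPhase sampler ρ r G w₀) (laterPhases sampler ρ r G (Fintype.card V))) F ≤
      treeValue G f {w₀} w₀ ∅ + (j + 1) * phaseError (Fintype.card V) r δ := by
  rw [expect_andThen]
  refine (expect_firstPhase_le hG hd hs hρ r (firstVisitHarmonic_treeValue hd f) w₀
    (β := j * phaseError (Fintype.card V) r δ) ?_ ?_).trans ?_
  · rintro (_ | s)
    · exact hF none
    · exact expect_le_one hF
  · intro s hcur
    have hle : unvisited s ≤ Fintype.card V := Finset.card_le_univ _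
    exact expect_laterPhases_le hG hd hs hρ r hF hFf _ j hcur hle (hle.trans hj)
  · rw [add_mul, one_mul]
    exact le_rfl

end Phase

/-! ### The possible outputs -/

section Support

variable {X : Type u}

lemma head?_interleave (W ms : List X) : (interleave W ms).head? = W.head? := by
  rcases W with _ | ⟨x, W⟩ <;> rcases ms with _ | ⟨m, ms⟩ <;> simp [interleave]

/-- Filling in midpoints of positive weight gives a possible walk. -/
lemma admissible_interleave {H : Matrix X X ℝ≥0} {W ms : List X}
    (h : List.Forall₂ (fun g j => midpointWeight H g j ≠ 0) (W.zip W.tail) ms) :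
    Admissible H (interleave W ms) := by
  induction ms generalizing W with
  | nil =>
    rw [interleave_nil]
    rcases W with _ | ⟨x, _ | ⟨y, W⟩⟩
    · exact List.IsChain.nil
    · exact List.IsChain.singleton x
    · simp at h
  | cons m ms ih =>
    rcases W with _ | ⟨x, _ | ⟨y, W⟩⟩
    · simp at h
    · simp at h
    · simp only [List.tail_cons, List.zip_cons_cons, List.forall₂_cons] at h
      have h1 : H x m ≠ 0 ∧ H m y ≠ 0 := by
        have := h.1
        simpa [midpointWeight, not_or] using this
      have h2 := ih (W := y :: W) h.2
      rw [interleave_cons_cons]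
      unfold Admissible at h2 ⊢
      rw [List.isChain_cons_cons, List.isChain_cons]
      refine ⟨h1.1, fun z hz => ?_, h2⟩
      rw [head?_interleave] at hz
      simp only [List.head?_cons, Option.mem_def, Option.some.injEq] at hz
      exact hz ▸ h1.2

lemma head?_truncate (ρ : ℕ) (z : List X) : (truncate ρ z).head? = z.head? := by
  rcases z with _ | ⟨x, z⟩
  · simp [truncate]
  · obtain ⟨k, hk⟩ : ∃ k, truncLength ρ (x :: z) = k + 1 := by
      refine Nat.exists_eq_succ_of_ne_zero ?_
      simp [truncLength]
    simp [truncate, hk]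

variable [Fintype X]

lemma admissible_of_mem_support_level {sampler : MatchingSampler} {ρ : ℕ} {H : Matrix X X ℝ≥0}
    {W W' : List X} (hW : W ≠ []) (h : some W' ∈ (level sampler ρ H W).support) :
    Admissible H W' ∧ W'.head? = W.head? := by
  rw [level_eq, some_mem_support_andThen] at h
  obtain ⟨ms, hms, h⟩ := h
  replace hms := forall₂_of_mem_support_sampleMidpoints hms
  have hgl := length_zip_tail W
  have hml : (W.zip W.tail).length = ms.length := hms.length_eq
  have hWpos := List.length_pos_iff.2 hW
  have hlen : W.length = ms.length + 1 := by omega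
  have hN := truncLength_le ρ (interleave W ms)
  rw [length_interleave (by omega)] at hN
  suffices ∃ ms', List.Forall₂ (fun g j => midpointWeight H g j ≠ 0) (W.zip W.tail) ms' ∧
      W' = truncate ρ (interleave W ms') by
    obtain ⟨ms', h1, rfl⟩ := this
    exact ⟨(admissible_interleave h1).truncate ρ, by rw [head?_truncate, head?_interleave]⟩
  rcases hK : truncLength ρ (interleave W ms) / 2 with _ | j
  · refine ⟨ms, hms, ?_⟩
    rw [truncate, take_interleave hlen, hK, List.take_zero, interleave_nil]
    simpa [placeMidpoints, hK] using h
  · have hj : j < ms.length := by omega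
    rw [hK, placeMidpoints_succ _ _ _ _ hj] at h
    dsimp only at h
    set L := Multiset.toList (↑(ms.take j) : Multiset X) with hL
    have hLp : L.Perm (ms.take j) := toList_perm _
    have hLlen : L.length = j := by rw [hLp.length_eq]; simp; omega
    rw [PMF.mem_support_bind_iff] at h
    obtain ⟨σ, -, h⟩ := h
    split_ifs at h with h0
    · simp at h
    · rw [PMF.mem_support_pure_iff, Option.some.injEq] at h
      have hperm := ofFn_getD_perm hLlen σ.symm ms[j]
      -- The new entries are those of the walk filled in with the rearranged midpoints followed by
      -- the discarded ones; positive matching weight makes every midpoint possible in its gap.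
      refine ⟨(List.ofFn fun i => L.getD (σ.symm i) ms[j]) ++ ms.drop j, ?_, ?_⟩
      · rw [← List.take_append_drop j (W.zip W.tail)]
        refine List.rel_append ?_ (List.forall₂_drop j hms)
        rw [List.forall₂_iff_get]
        refine ⟨by simp; omega, fun i hi hi' => ?_⟩
        rw [List.length_ofFn] at hi'
        have h1 : placementWeights H L (W.zip W.tail) ms[j] j (σ.symm ⟨i, hi'⟩) ⟨i, hi'⟩ ≠ 0 := by
          have := Finset.prod_ne_zero_iff.1 h0 (σ.symm ⟨i, hi'⟩) (Finset.mem_univ _)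
          rwa [Equiv.apply_symm_apply] at this
        have hi2 : i < (W.zip W.tail).length := by omega
        rw [placementWeights, List.getD_eq_getElem _ _ hi2] at h1
        simpa using h1
      · rw [(truncate_interleave_rearranged hlen (hperm.trans hLp).symm hj hK).2, h]

lemma admissible_of_mem_support_fillLevels {sampler : MatchingSampler} {ρ : ℕ}
    {M : Matrix X X ℝ≥0} {r : ℕ} {W W' : List X} (hW : W ≠ []) (hM : Admissible (M ^ 2 ^ r) W)
    (h : some W' ∈ (fillLevels sampler ρ M r W).support) :
    Admissible M W' ∧ W'.head? = W.head? := by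
  induction r generalizing W with
  | zero =>
    rw [fillLevels, PMF.mem_support_pure_iff, Option.some.injEq] at h
    rw [pow_zero, pow_one] at hM
    subst h
    exact ⟨hM, rfl⟩
  | succ r ih =>
    rw [fillLevels, some_mem_support_andThen] at h
    obtain ⟨W₁, h1, h2⟩ := h
    obtain ⟨h3, h4⟩ := admissible_of_mem_support_level hW h1
    have hW₁ : W₁ ≠ [] := by
      rintro rfl
      rw [List.head?_nil, eq_comm, List.head?_eq_none_iff] at h4
      exact hW h4
    obtain ⟨h5, h6⟩ := ih hW₁ h3 h2
    exact ⟨h5, h6.trans h4⟩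

/-- The walk of a phase is a possible walk that starts at the given vertex. -/
lemma exists_of_mem_support_phaseWalk {sampler : MatchingSampler} {ρ r : ℕ} {M : Matrix X X ℝ≥0}
    {x₀ : X} {W : List X} (h : some W ∈ (phaseWalk sampler ρ r M x₀).support) :
    ∃ l, W = x₀ :: l ∧ Admissible M W := by
  rw [phaseWalk, some_mem_support_andThen] at h
  obtain ⟨x, hx, h⟩ := h
  rw [some_mem_support_andThen] at h
  obtain ⟨W₁, h1, h2⟩ := h
  have hx := some_mem_support_sampleWeighted hx
  split_ifs at h2 with hc
  · rw [PMF.mem_support_pure_iff, Option.some.injEq] at h2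
    subst h2
    obtain ⟨h3, h4⟩ := admissible_of_mem_support_fillLevels (by simp)
      (by simpa [Admissible] using hx) h1
    rw [List.head?_cons, List.head?_eq_some_iff] at h4
    obtain ⟨l, hl⟩ := h4
    exact ⟨l, hl, h3⟩
  · simp at h2

variable {V : Type u}

/-- The graph with edge set `E` is a tree on the vertices `U`. -/
structure Spans (G : SimpleGraph V) (w₀ : V) (U : Finset V) (E : Finset (Sym2 V)) : Prop where
  edges : ∀ e ∈ E, e ∈ G.edgeSet
  reachable : ∀ v ∈ U, (SimpleGraph.fromEdgeSet (E : Set (Sym2 V))).Reachable w₀ v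
  card_le : E.card + 1 ≤ U.card

lemma Spans.insert_edge {G : SimpleGraph V} {w₀ : V} {U : Finset V} {E : Finset (Sym2 V)}
    (h : Spans G w₀ U E) {a b : V} (ha : a ∈ U) (hb : b ∉ U) (hab : G.Adj a b) :
    Spans G w₀ (insert b U) (insert s(a, b) E) where
  edges e he := by
    rcases Finset.mem_insert.1 he with rfl | he
    · exact hab
    · exact h.edges e he
  reachable := by
    have hmono : SimpleGraph.fromEdgeSet (E : Set (Sym2 V)) ≤
        SimpleGraph.fromEdgeSet ((insert s(a, b) E : Finset (Sym2 V)) : Set (Sym2 V)) :=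
      SimpleGraph.fromEdgeSet_mono (by simp)
    intro v hv
    rcases Finset.mem_insert.1 hv with rfl | hv
    · refine ((h.reachable a ha).mono hmono).trans (SimpleGraph.Adj.reachable ?_)
      rw [SimpleGraph.fromEdgeSet_adj]
      exact ⟨by simp, hab.ne⟩
    · exact (h.reachable v hv).mono hmono
  card_le := by
    rw [Finset.card_insert_of_notMem hb]
    have := Finset.card_insert_le s(a, b) E
    have := h.card_le
    omega

/-- A connected graph with at most `n - 1` edges is a tree, so an upper bound on the number of
recorded edges is enough. -/
lemma Spans.isSpanningTree [Fintype V] {G : SimpleGraph V} {w₀ : V} {E : Finset (Sym2 V)}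
    (h : Spans G w₀ Finset.univ E) :
    IsSpanningTree G (SimpleGraph.fromEdgeSet (E : Set (Sym2 V))) := by
  have hE : (SimpleGraph.fromEdgeSet (E : Set (Sym2 V))).edgeSet = E := by
    rw [SimpleGraph.edgeSet_fromEdgeSet, sdiff_eq_left, Set.disjoint_left]
    intro e he
    exact G.not_isDiag_of_mem_edgeSet (h.edges e he)
  have hc : (SimpleGraph.fromEdgeSet (E : Set (Sym2 V))).Connected := by
    have : Nonempty V := ⟨w₀⟩
    exact ⟨fun x y => (h.reachable x (Finset.mem_univ _)).symm.trans
      (h.reachable y (Finset.mem_univ _))⟩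
  refine ⟨?_, ?_⟩
  · intro a b hab
    exact h.edges s(a, b) (by simpa using (SimpleGraph.fromEdgeSet_adj _).1 hab |>.1)
  · rw [SimpleGraph.isTree_iff_connected_and_card]
    refine ⟨hc, le_antisymm ?_ hc.card_vert_le_card_edgeSet_add_one⟩
    have := h.card_le
    rw [Finset.card_univ] at this
    rw [hE]
    simpa using this

/-- Recording an edge for each first visit extends the tree to the vertices of the walk. -/
lemma Spans.recordEdges {G : SimpleGraph V} {e : V → V → PMF (Option V)} {w₀ : V}
    {seen U : Finset V} {x : V} {l : List V} {E E' : Finset (Sym2 V)} (h : Spans G w₀ U E)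
    (hx : x ∈ U) (hseen : seen ⊆ U) (hl : ∀ y ∈ l, y ∈ U → y ∈ seen)
    (he : (x :: l).IsChain fun p b => ∀ a, some a ∈ (e p b).support → G.Adj a b ∧ (a = p ∨ a ∈ U))
    (hE : some E' ∈ (recordEdges e (firstVisits seen (x :: l))).support) :
    Spans G w₀ (U ∪ (x :: l).toFinset) (E ∪ E') := by
  induction l generalizing seen U x E E' with
  | nil =>
    rw [firstVisits, SpanningTreeSampler.recordEdges, PMF.mem_support_pure_iff,
      Option.some.injEq] at hE
    · subst hE
      simpa [hx] using h
    · simp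
  | cons q l ih =>
    have hU : U ∪ (x :: q :: l).toFinset = insert q U ∪ (q :: l).toFinset := by
      ext y; simp only [List.toFinset_cons, Finset.mem_union, Finset.mem_insert]
      constructor
      · rintro (hy | rfl | hy)
        exacts [Or.inl (Or.inr hy), Or.inl (Or.inr hx), Or.inr hy]
      · tauto
    rw [List.isChain_cons_cons] at he
    rw [firstVisits] at hE
    rw [hU]
    split_ifs at hE with hq
    · have hqU := hseen hq
      rw [Finset.insert_eq_of_mem hqU]
      exact ih h hqU hseen (fun y hy => hl y (List.mem_cons_of_mem _ hy)) he.2 hE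
    · have hqU : q ∉ U := fun hqU => hq (hl q List.mem_cons_self hqU)
      rw [SpanningTreeSampler.recordEdges, some_mem_support_andThen] at hE
      obtain ⟨a, ha, hE⟩ := hE
      rw [some_mem_support_andThen] at hE
      obtain ⟨E'', hE'', hE⟩ := hE
      rw [PMF.mem_support_pure_iff, Option.some.injEq] at hE
      subst hE
      obtain ⟨hadj, haU⟩ := he.1 a ha
      have haU : a ∈ U := by
        rcases haU with rfl | haU
        exacts [hx, haU]
      have := ih (h.insert_edge haU hqU hadj) (Finset.mem_insert_self _ _)
        (Finset.insert_subset_insert _ hseen)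
        (fun y hy hyU => ?_) (he.2.imp fun p b hpb a ha => ?_) hE''
      · rw [Finset.union_insert, ← Finset.insert_union]
        exact this
      · rcases Finset.mem_insert.1 hyU with rfl | hyU
        · exact Finset.mem_insert_self _ _
        · exact Finset.mem_insert_of_mem (hl y (List.mem_cons_of_mem _ hy) hyU)
      · obtain ⟨h1, h2⟩ := hpb a ha
        exact ⟨h1, h2.imp_right (Finset.mem_insert_of_mem)⟩

variable [Fintype V]

lemma adj_of_simpleWalk_ne_zero {G : SimpleGraph V} {x y : V} (h : simpleWalk G x y ≠ 0) :
    G.Adj x y := by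
  by_contra hxy
  exact h (by simp [simpleWalk, transition, hxy])

lemma spans_of_mem_support_firstPhase {sampler : MatchingSampler} {ρ r : ℕ} {G : SimpleGraph V}
    {w₀ : V} {s : PhaseState V} (h : some s ∈ (firstPhase sampler ρ r G w₀).support) :
    Spans G w₀ s.visited s.edges ∧ s.current ∈ s.visited := by
  rw [firstPhase, some_mem_support_andThen] at h
  obtain ⟨W, hW, h⟩ := h
  rw [PMF.mem_support_pure_iff, Option.some.injEq] at h
  subst h
  obtain ⟨l, rfl, hadm⟩ := exists_of_mem_support_phaseWalk hW
  have h0 : Spans G w₀ {w₀} ∅ := ⟨by simp, by simp, by simp⟩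
  have h1 := h0.recordEdges (e := fun p _ => PMF.pure (some p)) (seen := {w₀}) (l := l) (x := w₀)
    (by simp) subset_rfl (fun y _ hy => hy) (hadm.imp fun p b hpb a ha => ?_)
    (by rw [recordEdges_pure]; exact (PMF.mem_support_pure_iff _ _).2 rfl)
  · refine ⟨?_, ?_⟩
    · simpa using h1
    · simp only [List.mem_toFinset]
      rcases getLastD_mem (w₀ :: l) w₀ with h | h
      · rw [h]; simp
      · exact h
  · rw [PMF.mem_support_pure_iff, Option.some.injEq] at ha
    exact ⟨ha ▸ adj_of_simpleWalk_ne_zero hpb, Or.inl ha⟩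

lemma spans_of_mem_support_laterPhase {sampler : MatchingSampler} {ρ r : ℕ} {G : SimpleGraph V}
    (hG : G.Connected) (hd : ∀ x, G.degree x ≠ 0) {w₀ : V} {s s' : PhaseState V}
    (hs : Spans G w₀ s.visited s.edges) (hcur : s.current ∈ s.visited)
    (h : some s' ∈ (laterPhase sampler ρ r G s).support) :
    Spans G w₀ s'.visited s'.edges ∧ s'.current ∈ s'.visited := by
  rw [laterPhase, some_mem_support_andThen] at h
  obtain ⟨W, hW, h⟩ := h
  rw [some_mem_support_andThen] at h
  obtain ⟨E, hE, h⟩ := h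
  rw [PMF.mem_support_pure_iff, Option.some.injEq] at h
  subst h
  refine ⟨?_, ?_⟩
  · obtain ⟨l, rfl, -⟩ := exists_of_mem_support_phaseWalk hW
    rw [sampleEdges_eq, List.map_cons] at hE
    have hact : ∀ y ∈ s.current :: l.map Subtype.val, y ∈ activeSet s := by
      intro y hy
      rw [← List.map_cons (f := Subtype.val) (a := (⟨s.current, Finset.mem_insert_self _ _⟩ :
        activeSet s))] at hy
      obtain ⟨z, -, rfl⟩ := List.mem_map.1 hy
      exact z.2
    rw [List.map_cons]
    refine hs.recordEdges hcur (Finset.singleton_subset_iff.2 hcur) (fun y hy hyU => ?_) ?_ hE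
    · have := hact y (List.mem_cons_of_mem _ hy)
      rw [activeSet, Finset.mem_insert, Finset.mem_compl] at this
      exact Finset.mem_singleton.2 (this.resolve_right (not_not.2 hyU))
    · rw [List.isChain_iff_getElem]
      intro i hi a ha
      have hp := hact _ (List.getElem_mem (Nat.lt_of_succ_lt hi))
      have hw := some_mem_support_sampleWeighted ha
      split_ifs at hw with hadj
      · refine ⟨hadj, ?_⟩
        -- An unvisited vertex other than `p` belongs to `S`, where the Green function, and with it
        -- the drawing weight, is zero. So the edge is attached to the tree built so far.
        by_contra hcon
        rw [not_or] at hcon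
        obtain ⟨γ, hγ⟩ := exists_isGreen hG hp
        have h0 := coe_shortcut hG hd hp hγ a
        rw [hγ.off a (Finset.mem_insert_of_mem (Finset.mem_compl.2 hcon.2)) hcon.1, zero_mul] at h0
        refine hw ?_
        rw [NNReal.coe_eq_zero.1 h0, zero_mul]
      · exact absurd rfl hw
  · simp only [Finset.mem_union, List.mem_toFinset]
    rcases getLastD_mem (W.map Subtype.val) s.current with h | h
    · rw [h]; exact Or.inl hcur
    · exact Or.inr h

lemma isSpanningTree_of_mem_support_laterPhases {sampler : MatchingSampler} {ρ r : ℕ}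
    {G : SimpleGraph V} (hG : G.Connected) (hd : ∀ x, G.degree x ≠ 0) {w₀ : V} {fuel : ℕ}
    {s : PhaseState V} (hs : Spans G w₀ s.visited s.edges) (hcur : s.current ∈ s.visited)
    {E : Finset (Sym2 V)} (h : some E ∈ (laterPhases sampler ρ r G fuel s).support) :
    IsSpanningTree G (SimpleGraph.fromEdgeSet (E : Set (Sym2 V))) := by
  induction fuel generalizing s with
  | zero =>
    rw [laterPhases] at h
    split_ifs at h with hu
    · rw [PMF.mem_support_pure_iff, Option.some.injEq] at h
      exact h ▸ (hu ▸ hs).isSpanningTree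
    · simp at h
  | succ fuel ih =>
    rw [laterPhases] at h
    split_ifs at h with hu
    · rw [PMF.mem_support_pure_iff, Option.some.injEq] at h
      exact h ▸ (hu ▸ hs).isSpanningTree
    · rw [some_mem_support_andThen] at h
      obtain ⟨s', hs', h⟩ := h
      obtain ⟨h1, h2⟩ := spans_of_mem_support_laterPhase hG hd hs hcur hs'
      exact ih h1 h2 h

/-- The output is always a spanning tree. -/
lemma isSpanningTree_of_mem_support_treeSampler {sampler : MatchingSampler} {r : ℕ}
    {G : SimpleGraph V} (hG : G.Connected) (hd : ∀ x, G.degree x ≠ 0) {w₀ : V}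
    {T₀ T : SimpleGraph V} (hT₀ : IsSpanningTree G T₀)
    (h : T ∈ (treeSampler sampler r G w₀ T₀).support) : IsSpanningTree G T := by
  rw [treeSampler, PMF.mem_support_map_iff] at h
  obtain ⟨_ | E, hE, rfl⟩ := h
  · exact hT₀
  · rw [some_mem_support_andThen] at hE
    obtain ⟨s, hs, hE⟩ := hE
    obtain ⟨h1, h2⟩ := spans_of_mem_support_firstPhase hs
    exact isSpanningTree_of_mem_support_laterPhases hG hd h1 h2 hE

end Support

/-! ### The distribution of the output -/

section Output

variable {V : Type u} [Fintype V]

lemma degree_ne_zero_of_connected [Nontrivial V] {G : SimpleGraph V} (hG : G.Connected) (x : V) :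
    G.degree x ≠ 0 :=
  (hG.preconnected.degree_pos_of_nontrivial x).ne'

/-- As `g` is supported on spanning trees, the upper bound on the probability of each tree suffices.
-/
lemma treeValue_le {G : SimpleGraph V} (hG : G.Connected) (hd : ∀ x, G.degree x ≠ 0) (w₀ : V)
    {g : SimpleGraph V → ℝ≥0} (hg : ∀ T, ¬ IsSpanningTree G T → g T = 0) :
    (treeValue G g {w₀} w₀ ∅ : ℝ≥0∞) ≤ expect (uniformSpanningTree G hG) fun T => g T := by
  rw [expect_fintype, treeValue, ENNReal.ofNNReal_finsetSum]
  refine Finset.sum_le_sum fun T _ => ?_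
  by_cases hT : IsSpanningTree G T
  · rw [uniformSpanningTree, PMF.uniformOfFinset_apply_of_mem _ (by simpa using hT), ENNReal.coe_mul,
      mul_comm]
    refine mul_le_mul_left ?_ _
    have h1 : (treeCount G : ℝ≥0∞) * treeLimit G T {w₀} w₀ ∅ ≤ 1 := by
      exact_mod_cast treeCount_mul_treeLimit_le_one hd T w₀
    rw [← treeCount, ENNReal.le_inv_iff_mul_le, mul_comm]
    exact h1
  · simp [hg T hT]

lemma tvDist_treeSampler_le {G : SimpleGraph V} (hG : G.Connected) (hd : ∀ x, G.degree x ≠ 0)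
    {sampler : MatchingSampler} {δ : ℝ} (hs : sampler.ErrorAtMost δ) (r : ℕ) (w₀ : V)
    {T₀ : SimpleGraph V} (hT₀ : IsSpanningTree G T₀)
    (hρ : 2 ≤ ⌈√(Fintype.card V : ℝ)⌉₊) {j : ℕ}
    (hj : Fintype.card V ≤ j * (⌈√(Fintype.card V : ℝ)⌉₊ - 1)) {ε : ℝ} (hε : 0 ≤ ε)
    (h : (j + 1) * phaseError (Fintype.card V) r δ ≤ ENNReal.ofReal ε) :
    tvDist (treeSampler sampler r G w₀ T₀) (uniformSpanningTree G hG) ≤ ε := by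
  refine tvDist_le_of_expect_le hε fun f hf => ?_
  -- Dropping the values of `f` off the spanning trees does not affect the output, which is always a
  -- spanning tree.
  set g : SimpleGraph V → ℝ≥0 := fun T => if IsSpanningTree G T then (f T).toNNReal else 0 with hgdef
  have hft : ∀ T, ((f T).toNNReal : ℝ≥0∞) = f T := fun T =>
    ENNReal.coe_toNNReal ((hf T).trans_lt ENNReal.one_lt_top).ne
  have hgf : ∀ T, (g T : ℝ≥0∞) ≤ f T := by
    intro T
    simp only [hgdef]
    split_ifs
    · exact (hft T).le
    · simp
  calc expect (treeSampler sampler r G w₀ T₀) f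
      ≤ expect (treeSampler sampler r G w₀ T₀) fun T => g T := by
        refine expect_mono_on fun T hT => ?_
        have := isSpanningTree_of_mem_support_treeSampler hG hd hT₀ hT
        simp only [hgdef, if_pos this]
        exact (hft T).ge
    _ ≤ treeValue G g {w₀} w₀ ∅ + (j + 1) * phaseError (Fintype.card V) r δ := by
        rw [treeSampler, expect_map]
        exact expect_phases_le hG hd hs hρ r w₀ (fun o => (hgf _).trans (hf _)) (fun E => rfl) hj
    _ ≤ expect (uniformSpanningTree G hG) f + ENNReal.ofReal ε := by
        refine add_le_add ((treeValue_le hG hd w₀ fun T hT => ?_).trans (expect_mono hgf)) h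
        simp [hgdef, hT]

end Output

/-! ### The choice of the parameters -/

/-- One factor two is lost to the ceiling and one to the power of two. -/
lemma two_pow_clog_ceil_le {x : ℝ} (hx : 1 ≤ x) : (2 : ℝ) ^ Nat.clog 2 ⌈x⌉₊ ≤ 4 * x := by
  have hm : (⌈x⌉₊ : ℝ) ≤ 2 * x := by
    have := Nat.ceil_lt_add_one (zero_le_one.trans hx)
    linarith
  rcases le_or_gt ⌈x⌉₊ 1 with h1 | h1
  · rw [Nat.clog_of_right_le_one h1, pow_zero]
    linarith
  · have h2 := Nat.pow_pred_clog_lt_self (b := 2) one_lt_two h1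
    have h3 := Nat.clog_pos one_lt_two h1
    obtain ⟨k, hk⟩ := Nat.exists_eq_succ_of_ne_zero h3.ne'
    rw [hk, Nat.pred_succ] at h2
    have h4 : ((2 : ℝ) ^ k) < ⌈x⌉₊ := by exact_mod_cast h2
    rw [hk, Nat.succ_eq_add_one, pow_succ]
    linarith

lemma le_two_pow_clog_ceil (x : ℝ) : x ≤ (2 : ℝ) ^ Nat.clog 2 ⌈x⌉₊ := by
  refine (Nat.le_ceil x).trans ?_
  exact_mod_cast Nat.le_pow_clog one_lt_two _

/-- The number of levels is logarithmic in the number of vertices. -/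
lemma logTargetLength_le {A B c₁ : ℝ} (hA : 2 ≤ A) (hB : 20 ≤ B) (hc : 0 < c₁) {n : ℕ}
    (hn : 2 ≤ n) :
    (logTargetLength A B c₁ n : ℝ) ≤
      (Real.log (4 * A * B) / Real.log 2 + 4 + c₁) / Real.log 2 * Real.log n := by
  have hN : (2 : ℝ) ≤ n := by exact_mod_cast hn
  have hN0 : (0 : ℝ) < n := by linarith
  have hp : 1 ≤ (n : ℝ) ^ (1 / 2 + c₁) := Real.one_le_rpow (by linarith) (by linarith)
  set c₂ := A * (n : ℝ) ^ (1 / 2 + c₁) with hc₂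
  have hc₂2 : 2 ≤ c₂ := by nlinarith
  have hlog2 := Real.log_pos one_lt_two
  have hlogN : Real.log 2 ≤ Real.log n := Real.log_le_log two_pos hN
  have hL : Real.log 2 ≤ Real.log c₂ := Real.log_le_log two_pos hc₂2
  have hN3 : (8 : ℝ) ≤ (n : ℝ) ^ 3 := by
    calc (8 : ℝ) = 2 ^ 3 := by norm_num
      _ ≤ _ := by gcongr
  have hx : 1 ≤ B * (n : ℝ) ^ 3 * Real.log c₂ := by
    have h1 : (0.5 : ℝ) ≤ Real.log c₂ := by linarith [Real.log_two_gt_d9]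
    have h2 : (160 : ℝ) ≤ B * (n : ℝ) ^ 3 := by nlinarith
    nlinarith
  have h1 := two_pow_clog_ceil_le hx
  -- By `log c₂ ≤ c₂` the target length is polynomial in `n`; the exponent `7/2 + c₁` is rounded up.
  have h2 : 4 * (B * (n : ℝ) ^ 3 * Real.log c₂) ≤ (4 * A * B) * (n : ℝ) ^ (4 + c₁) := by
    have h3 : (n : ℝ) ^ 3 * (n : ℝ) ^ (1 / 2 + c₁) ≤ (n : ℝ) ^ (4 + c₁) := by
      rw [← Real.rpow_natCast, ← Real.rpow_add hN0]
      exact Real.rpow_le_rpow_of_exponent_le (by linarith) (by norm_num; linarith)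
    have h4 : Real.log c₂ ≤ c₂ := (Real.log_le_sub_one_of_pos (by linarith)).trans (by linarith)
    calc 4 * (B * (n : ℝ) ^ 3 * Real.log c₂) ≤ 4 * (B * (n : ℝ) ^ 3 * c₂) := by gcongr
      _ = (4 * A * B) * ((n : ℝ) ^ 3 * (n : ℝ) ^ (1 / 2 + c₁)) := by rw [hc₂]; ring
      _ ≤ _ := by gcongr
  have h3 : (logTargetLength A B c₁ n : ℝ) * Real.log 2 ≤
      Real.log (4 * A * B) + (4 + c₁) * Real.log n := by
    rw [← Real.log_pow, ← Real.log_rpow hN0, ← Real.log_mul (by positivity) (by positivity)]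
    exact Real.log_le_log (by positivity) (h1.trans h2)
  -- The constant is absorbed into a multiple of `log n`, which is at least `log 2`.
  have h4 : Real.log (4 * A * B) ≤ Real.log (4 * A * B) / Real.log 2 * Real.log n := by
    have h5 : 0 ≤ Real.log (4 * A * B) := Real.log_nonneg (by nlinarith)
    rw [div_mul_eq_mul_div, le_div_iff₀ hlog2]
    gcongr
  rw [div_mul_eq_mul_div, le_div_iff₀ hlog2]
  linarith

/-- A walk of the target length covers the graph, up to a small probability. -/
lemma coverError_logTargetLength_le {A B c₁ : ℝ} (hA : 2 ≤ A) (hB : 20 ≤ B) (hc : 0 < c₁) {n : ℕ}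
    (hn : 2 ≤ n) :
    coverError n (2 * (n : ℝ) ^ 3) (2 ^ logTargetLength A B c₁ n) ≤
      ENNReal.ofReal (A * (n : ℝ) ^ (1 / 2 + c₁))⁻¹ := by
  have hN : (2 : ℝ) ≤ n := by exact_mod_cast hn
  have hN0 : (0 : ℝ) < n := by linarith
  have hN3 : (8 : ℝ) ≤ (n : ℝ) ^ 3 := by
    calc (8 : ℝ) = 2 ^ 3 := by norm_num
      _ ≤ _ := by gcongr
  have hsqrt : (n : ℝ) ≤ ((n : ℝ) ^ (1 / 2 + c₁)) ^ 2 := by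
    rw [← Real.rpow_natCast, ← Real.rpow_mul hN0.le]
    conv_lhs => rw [← Real.rpow_one (n : ℝ)]
    exact Real.rpow_le_rpow_of_exponent_le (by linarith) (by push_cast; linarith)
  have hp : 1 ≤ (n : ℝ) ^ (1 / 2 + c₁) := Real.one_le_rpow (by linarith) (by linarith)
  have hk := le_two_pow_clog_ceil (B * (n : ℝ) ^ 3 * Real.log (A * (n : ℝ) ^ (1 / 2 + c₁)))
  rw [← logTargetLength] at hk
  set r := logTargetLength A B c₁ n
  set c₂ := A * (n : ℝ) ^ (1 / 2 + c₁) with hc₂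
  have hc₂2 : 2 ≤ c₂ := by nlinarith
  have hNc : (n : ℝ) ≤ c₂ ^ 2 := by
    refine hsqrt.trans ?_
    gcongr
    nlinarith
  have hL : 0 < Real.log c₂ := Real.log_pos (by linarith)
  set H : ℝ := 2 * (n : ℝ) ^ 3 with hH
  have hH0 : 0 < H := by positivity
  have hH1 : 0 ≤ 1 - 1 / H := by
    rw [sub_nonneg, div_le_one hH0]; linarith
  -- With `H = 2 n³` and `B ≥ 20` the exponent is at least `10 log c₂`. The tenth power absorbs the
  -- factor `n * H ≤ c₂ ^ 9` and leaves `c₂⁻¹`.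
  have h1 : (1 - 1 / H) ^ 2 ^ r ≤ (c₂ ^ 10)⁻¹ := by
    calc (1 - 1 / H) ^ 2 ^ r ≤ Real.exp (-(1 / H)) ^ 2 ^ r := by
          gcongr
          exact Real.one_sub_le_exp_neg _
      _ = Real.exp (-((2 : ℝ) ^ r / H)) := by
          rw [← Real.exp_nat_mul]; congr 1; push_cast; ring
      _ ≤ Real.exp (-(10 * Real.log c₂)) := by
          rw [Real.exp_le_exp, neg_le_neg_iff, le_div_iff₀ hH0]
          refine le_trans ?_ hk
          rw [hH, show 10 * Real.log c₂ * (2 * (n : ℝ) ^ 3) = 20 * (n : ℝ) ^ 3 * Real.log c₂ by ring]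
          gcongr
      _ = (c₂ ^ 10)⁻¹ := by
          rw [Real.exp_neg, ← Real.exp_log (show 0 < c₂ by linarith), ← Real.exp_nat_mul,
            Real.log_exp]
          norm_num
  rw [coverError, ← ENNReal.ofReal_natCast, ← ENNReal.ofReal_pow hH1,
    ← ENNReal.ofReal_mul (by positivity), ← ENNReal.ofReal_mul (by positivity)]
  refine ENNReal.ofReal_le_ofReal ?_
  have h2 : (n : ℝ) * H ≤ c₂ ^ 9 := by
    calc (n : ℝ) * H = 2 * (n : ℝ) ^ 4 := by rw [hH]; ring
      _ ≤ c₂ * (c₂ ^ 2) ^ 4 := by gcongr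
      _ = c₂ ^ 9 := by ring
  calc (n : ℝ) * ((1 - 1 / H) ^ 2 ^ r * H) = (n * H) * (1 - 1 / H) ^ 2 ^ r := by ring
    _ ≤ c₂ ^ 9 * (c₂ ^ 10)⁻¹ := by gcongr
    _ = c₂⁻¹ := by field_simp

/-- The number of phases is of the order of `√n`. -/
lemma exists_phase_count {n : ℕ} (hn : 2 ≤ n) :
    2 ≤ ⌈√(n : ℝ)⌉₊ ∧ ∃ j : ℕ, n ≤ j * (⌈√(n : ℝ)⌉₊ - 1) ∧ (j + 1 : ℝ) ≤ 4 * √(n : ℝ) := by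
  have hN : (2 : ℝ) ≤ n := by exact_mod_cast hn
  have hs : 1 < √(n : ℝ) := by
    rw [Real.lt_sqrt zero_le_one]; linarith
  have hρ : 2 ≤ ⌈√(n : ℝ)⌉₊ := Nat.lt_ceil.2 (by simpa using hs)
  have hle := Nat.le_ceil (√(n : ℝ))
  set ρ := ⌈√(n : ℝ)⌉₊
  refine ⟨hρ, n / (ρ - 1) + 1, ?_, ?_⟩
  · have := Nat.div_add_mod n (ρ - 1)
    have h2 := Nat.mod_lt n (show 0 < ρ - 1 by omega)
    rw [add_mul, one_mul, mul_comm (n / (ρ - 1))]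
    omega
  · have h1 : ((n / (ρ - 1) : ℕ) : ℝ) ≤ 2 * √(n : ℝ) := by
      refine Nat.cast_div_le.trans ?_
      have h2 : (ρ : ℝ) ≤ 2 * ((ρ - 1 : ℕ) : ℝ) := by
        have : ρ ≤ 2 * (ρ - 1) := by omega
        exact_mod_cast this
      rw [div_le_iff₀ (by linarith)]
      have h3 := Real.mul_self_sqrt (show (0 : ℝ) ≤ n by linarith)
      nlinarith
    -- Besides `2√n` there are two more units, one from rounding and one for the first phase, each
    -- at most `√n`.
    push_cast
    linarith

/-- The guarantee is not vacuous: the empty matrix has a matching of weight one. -/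
lemma MatchingSampler.ErrorAtMost.nonneg {sampler : MatchingSampler} {δ : ℝ} (hs : sampler.ErrorAtMost δ) :
    0 ≤ δ :=
  (tvDist_nonneg _ _).trans (hs 0 0 (by simp [matchingWeight]))

/-- Each source of error receives half of `ε`. Non-covering contributes `4√n / c₂ = (4 / A)
n^(-c₁)`, which is why `A ≥ 8 / κ`, and the matchings contribute `4√n * C log n * δ`, which is why
`D = 8 C`. -/
lemma sum_phaseError_le {A B c₁ κ ε δ : ℝ} (hA : 2 ≤ A) (hAκ : 8 / κ ≤ A) (hB : 20 ≤ B)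
    (hc : 0 < c₁) (hκ : 0 < κ) {n : ℕ} (hn : 2 ≤ n) (hε : κ * (n : ℝ) ^ (-c₁) ≤ ε) (hδ : 0 ≤ δ)
    (hD : 8 * ((Real.log (4 * A * B) / Real.log 2 + 4 + c₁) / Real.log 2) * √(n : ℝ) * Real.log n * δ
      ≤ ε) {j : ℕ} (hj : (j + 1 : ℝ) ≤ 4 * √(n : ℝ)) :
    (j + 1) * phaseError n (logTargetLength A B c₁ n) δ ≤ ENNReal.ofReal ε := by
  have hN : (2 : ℝ) ≤ n := by exact_mod_cast hn
  have hN0 : (0 : ℝ) < n := by linarith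
  have hp : 0 < (n : ℝ) ^ (1 / 2 + c₁) := Real.rpow_pos_of_pos hN0 _
  have hr := logTargetLength_le hA hB hc hn
  set C := (Real.log (4 * A * B) / Real.log 2 + 4 + c₁) / Real.log 2
  set r := logTargetLength A B c₁ n with hrdef
  have hA0 : 0 < A := by linarith
  calc (j + 1) * phaseError n r δ
      ≤ ENNReal.ofReal (4 * √(n : ℝ)) * (ENNReal.ofReal (A * (n : ℝ) ^ (1 / 2 + c₁))⁻¹ +
          ENNReal.ofReal (C * Real.log n) * ENNReal.ofReal δ) := by
        refine mul_le_mul' ?_ (add_le_add (coverError_logTargetLength_le hA hB hc hn)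
          (mul_le_mul' ?_ le_rfl))
        · rw [← ENNReal.ofReal_natCast j, ← ENNReal.ofReal_one,
            ← ENNReal.ofReal_add (Nat.cast_nonneg _) zero_le_one]
          exact ENNReal.ofReal_le_ofReal hj
        · rw [← ENNReal.ofReal_natCast r]
          exact ENNReal.ofReal_le_ofReal hr
    _ = ENNReal.ofReal (4 * √(n : ℝ) * ((A * (n : ℝ) ^ (1 / 2 + c₁))⁻¹ + C * Real.log n * δ)) := by
        have hCl : 0 ≤ C * Real.log n := (Nat.cast_nonneg r).trans hr
        rw [← ENNReal.ofReal_mul hCl, ← ENNReal.ofReal_add (by positivity) (by positivity),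
          ← ENNReal.ofReal_mul (by positivity)]
    _ ≤ ENNReal.ofReal ε := by
        refine ENNReal.ofReal_le_ofReal ?_
        have h1 : 4 * √(n : ℝ) * (A * (n : ℝ) ^ (1 / 2 + c₁))⁻¹ = 4 / A * (n : ℝ) ^ (-c₁) := by
          have hs : 0 < √(n : ℝ) := Real.sqrt_pos.2 hN0
          rw [Real.rpow_add hN0, ← Real.sqrt_eq_rpow, Real.rpow_neg hN0.le]
          field_simp
        have h2 : 4 / A ≤ κ / 2 := by
          rw [div_le_iff₀ hκ] at hAκ
          rw [div_le_div_iff₀ hA0 two_pos]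
          linarith
        have h3 : 4 / A * (n : ℝ) ^ (-c₁) ≤ κ / 2 * (n : ℝ) ^ (-c₁) := by gcongr
        rw [mul_add, h1]
        linarith

end SpanningTreeSampler

end

theorem mainTheorem5 :
    ∃ B₀ : ℝ, 0 < B₀ ∧ ∀ c₁ κ : ℝ, 0 < c₁ → 0 < κ →
      ∃ A₀ : ℝ, 0 < A₀ ∧ ∀ A B : ℝ, A₀ ≤ A → B₀ ≤ B →
        ∃ D : ℝ, 0 < D ∧
          ∀ (V : Type u) [Fintype V] (G : SimpleGraph V) (hG : G.Connected) (w₀ : V)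
            (T₀ : SimpleGraph V) (ε δ : ℝ) (sampler : MatchingSampler),
            IsSpanningTree G T₀ →
            κ * (Fintype.card V : ℝ) ^ (-c₁) ≤ ε →
            D * √(Fintype.card V : ℝ) * Real.log (Fintype.card V) * δ ≤ ε →
            sampler.ErrorAtMost δ →
            (∀ T ∈ (treeSampler sampler (logTargetLength A B c₁ (Fintype.card V)) G w₀ T₀).support,
              IsSpanningTree G T) ∧
            tvDist (treeSampler sampler (logTargetLength A B c₁ (Fintype.card V)) G w₀ T₀)
              (uniformSpanningTree G hG) ≤ ε := by
  refine ⟨20, by norm_num, fun c₁ κ hc hκ => ⟨max 2 (8 / κ), by positivity, fun A B hA hB => ?_⟩⟩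
  have hA2 : 2 ≤ A := (le_max_left _ _).trans hA
  have hAκ : 8 / κ ≤ A := (le_max_right _ _).trans hA
  refine ⟨8 * ((Real.log (4 * A * B) / Real.log 2 + 4 + c₁) / Real.log 2), ?_, ?_⟩
  · have h1 := Real.log_pos one_lt_two
    have h2 : 0 ≤ Real.log (4 * A * B) := Real.log_nonneg (by nlinarith)
    positivity
  intro V _ G hG w₀ T₀ ε δ sampler hT₀ hε hD hs
  have hε0 : 0 ≤ ε := le_trans (by positivity) hε
  rcases subsingleton_or_nontrivial V with hV | hV
  -- On a single vertex degrees vanish and the walk breaks down, but there is only one graph.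
  · refine ⟨fun T _ => Subsingleton.elim T₀ T ▸ hT₀, tvDist_le_of_expect_le hε0 fun f _ => ?_⟩
    have hf : f = fun _ => f T₀ := funext fun T => congrArg f (Subsingleton.elim _ _)
    rw [hf, expect_const, expect_const]
    exact le_self_add
  · have hd := degree_ne_zero_of_connected hG
    have hn : 2 ≤ Fintype.card V := Fintype.one_lt_card
    obtain ⟨hρ, j, hj, hj'⟩ := exists_phase_count hn
    exact ⟨fun T hT => isSpanningTree_of_mem_support_treeSampler hG hd hT₀ hT,
      tvDist_treeSampler_le hG hd hs _ w₀ hT₀ hρ hj hε0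
        (sum_phaseError_le hA2 hAκ hB hc hκ hn hε hs.nonneg hD hj')⟩
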